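/- Let $M=\mathbb{R}\times\mathbb{R}^3$ be Minkowski space with points $x=(t,\mathbf{x})$ and Lebesgue measure, let $m_1,m_2\ge 0$ (no order between them, either may vanish), and let $P_1=\partial_t^2-\nabla^2+m_1^2$. For $m\ge 0$ let $\Delta^+_{(m)}:C_0^\infty(M,\mathbb{C})\to C^\infty(M,\mathbb{C})$ be the operator whose integral kernel is the two-point function of the vacuum state of mass $m$, $$\Delta^+_{(m)}(t_1,\mathbf{x}_1,t_2,\mathbf{x}_2)=\frac{1}{(2\pi)^3}\int_{\mathbb{R}^3}\frac{1}{2\omega}\,e^{i\omega(t_1-t_2)+i\mathbf{k}\cdot(\mathbf{x}_1-\mathbf{x}_2)}\,d\mathbf{k},\qquad \omega=\sqrt{|\mathbf{k}|^2+m^2}.$$ For a smooth $f:M\to\mathbb{R}$ with past-compact support (i.e. $\mathrm{supp} f\cap J^-(K)$ is compact for each compact $K$) let $Q(f)(\phi)=\frac12(m_2^2-m_1^2)\int_M f\phi^2\,dx$, so that $Q(f)^{(1)}\phi=(m_2^2-m_1^2)f\phi$. The retarded classical Møller map $R_{1,Q(f)}$ on $C^\infty(M,\mathbb{C})$ sends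 $\phi$ to the smooth $\psi$ with $(P_1+Q(f)^{(1)})\psi=P_1\phi$ and $\psi=\phi$ outside $J^+(\mathrm{supp}\,Q(f))$; its adjoint $R_{1,Q(f)}^\dagger$ on $C_0^\infty(M,\mathbb{C})$ is taken with respect to the bilinear pairing $\int_M \phi\,h\,dx$. Consider a family $(f_i)$ of such functions and a countably generated filter on the index set (for instance $i=\mu\in(0,\infty)$ and $\mu\to\infty$) along which the adiabatic limit $f_i\to 1$ is performed in the following sense: there are $\chi_i\in C_0^\infty(\mathbb{R})$ with $\chi_i\ge 0$ and $\int\chi_i=1$ such that for each compact $K\subset M$ eventually $f_i(t,\mathbf{x})=\int_{-\infty}^t\chi_i(\tau)\,d\tau$ on $J^-(K)$; $\int_{-\infty}^t\chi_i(\tau)\,d\tau\to 1$ for each $t\in\mathbb{R}$; and $\int_{\mathbb{R}}|\chi_i'(\tau)|\,d\tau\to 0$. (An example is $f_\mu(t,\mathbf{x})=\int_{-\infty}^{t}\mu^{-1}\chi(\tau/\mu)\,d\tau$, $\mu\to\infty$, with $0\le\chi\in C_0^\infty(\mathbb{R})$ of unit integral and supported in $(-\infty,0]$.) Then $R_{1,Q(f_i)}$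 and $R_{1,Q(f_i)}^\dagger$ are well defined (the conditions above have exactly one solution), $\Delta^+_{(m_1)}$ maps test functions to smooth functions, and the integral kernel of $$\Delta^+_{1+Q(f_i)}=R_{1,Q(f_i)}\circ\Delta^+_{(m_1)}\circ R_{1,Q(f_i)}^\dagger$$ converges to the integral kernel of $\Delta^+_{(m_2)}$ as distributions on $M\times M$, i.e. after pairing with each $F\in C_0^\infty(M\times M,\mathbb{C})$, where the kernel of an operator $A$ is paired with $F$ as $\int_M \big(A\,F(x,\cdot)\big)(x)\,dx$. -/

import Mathlib

open MeasureTheory Filter Topology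
open scoped ContDiff

noncomputable section

namespace AdiabaticVacuum

/-- Three-dimensional Euclidean space. -/
abbrev Space : Type := EuclideanSpace ℝ (Fin 3)

/-- Minkowski spacetime `ℝ × ℝ³`, with points `(t, 𝐱)` and the Lebesgue measure. -/
abbrev Spacetime : Type := ℝ × Space

/-- The causal future of a set: all `x` with `x⁰ - y⁰ ≥ |𝐱 - 𝐲|` for some `y` in the set. -/
def causalFuture (S : Set Spacetime) : Set Spacetime :=
  {x | ∃ y ∈ S, ‖x.2 - y.2‖ ≤ x.1 - y.1}

/-- The causal past of a set. -/
def causalPast (S : Set Spacetime) : Set Spacetime :=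
  {x | ∃ y ∈ S, ‖y.2 - x.2‖ ≤ y.1 - x.1}

/-- A set is past-compact if it meets the causal past of each compact set in a compact set. -/
def PastCompact (S : Set Spacetime) : Prop :=
  ∀ K : Set Spacetime, IsCompact K → IsCompact (S ∩ causalPast K)

/-- Smooth complex field configurations. -/
def IsSmooth (φ : Spacetime → ℂ) : Prop := ContDiff ℝ ∞ φ

/-- Complex test functions: smooth with compact support. -/
def IsTest (h : Spacetime → ℂ) : Prop := ContDiff ℝ ∞ h ∧ HasCompactSupport h

/-- The Klein-Gordon operator `-□ + V = ∂ₜ² - ∇² + V` with potential `V`. -/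
def kleinGordon (V : Spacetime → ℝ) (φ : Spacetime → ℂ) (x : Spacetime) : ℂ :=
  iteratedDeriv 2 (fun s : ℝ => φ (s, x.2)) x.1
    - Laplacian.laplacian (fun y : Space => φ (x.1, y)) x.2
    + (V x : ℂ) * φ x

/-- The density `(m₂² - m₁²) f` of the local mass change
`Q(f)(φ) = ½ (m₂² - m₁²) ∫ f φ²`, so that `Q(f)⁽¹⁾ φ = massChange m₁ m₂ f · φ`. -/
def massChange (m₁ m₂ : ℝ) (f : Spacetime → ℝ) (x : Spacetime) : ℝ :=
  (m₂ ^ 2 - m₁ ^ 2) * f x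

/-- `ψ` is the image of `φ` under the retarded classical Møller map `R_{1,Q(f)}`:
`(P₁ + Q(f)⁽¹⁾) ψ = P₁ φ`, and `ψ = φ` outside of the causal future of the support of `Q(f)`. -/
def IsMollerImage (m₁ m₂ : ℝ) (f : Spacetime → ℝ) (φ ψ : Spacetime → ℂ) : Prop :=
  IsSmooth ψ ∧
  (∀ x, kleinGordon (fun y => m₁ ^ 2 + massChange m₁ m₂ f y) ψ x
      = kleinGordon (fun _ => m₁ ^ 2) φ x) ∧
  (∀ x, x ∉ causalFuture (tsupport (massChange m₁ m₂ f)) → ψ x = φ x)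

open Classical in
/-- The retarded classical Møller map `R_{1,Q(f)}` on configurations. -/
def moller (m₁ m₂ : ℝ) (f : Spacetime → ℝ) (φ : Spacetime → ℂ) : Spacetime → ℂ :=
  if H : ∃ ψ, IsMollerImage m₁ m₂ f φ ψ then H.choose else 0

/-- `h'` is the image of `h` under the adjoint of `R_{1,Q(f)}` with respect to the bilinear
pairing `⟨φ, h⟩ = ∫ φ h`. -/
def IsMollerAdjointImage (m₁ m₂ : ℝ) (f : Spacetime → ℝ) (h h' : Spacetime → ℂ) : Prop :=
  IsTest h' ∧
  ∀ φ : Spacetime → ℂ, IsSmooth φ → ∫ x, moller m₁ m₂ f φ x * h x = ∫ x, φ x * h' x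

open Classical in
/-- The adjoint `R_{1,Q(f)}†` on test functions. -/
def mollerAdjoint (m₁ m₂ : ℝ) (f : Spacetime → ℝ) (h : Spacetime → ℂ) : Spacetime → ℂ :=
  if H : ∃ h', IsMollerAdjointImage m₁ m₂ f h h' then H.choose else 0

/-- The energy `ω(𝐤) = √(|𝐤|² + m²)`. -/
def energy (m : ℝ) (k : Space) : ℝ := Real.sqrt (‖k‖ ^ 2 + m ^ 2)

/-- The operator `Δ⁺` from test functions to smooth functions whose integral kernel is the
two-point function of the vacuum state of mass `m`,
`Δ⁺(x, y) = (2π)⁻³ ∫ (2ω)⁻¹ exp (i ω (x⁰ - y⁰) + i 𝐤 · (𝐱 - 𝐲)) d𝐤`.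
The sign in the exponent is the one for which `Δ⁺ = Δˢ + (i/2) (Δᴿ - Δᴬ)`. -/
def vacuumOp (m : ℝ) (h : Spacetime → ℂ) (x : Spacetime) : ℂ :=
  ((2 * Real.pi : ℝ) : ℂ)⁻¹ ^ 3 * ∫ k : Space,
    ((2 * energy m k : ℝ) : ℂ)⁻¹
      * Complex.exp (Complex.I * ((energy m k * x.1 + inner ℝ k x.2 : ℝ) : ℂ))
      * ∫ y : Spacetime,
          Complex.exp (-(Complex.I * ((energy m k * y.1 + inner ℝ k y.2 : ℝ) : ℂ))) * h y

/-- The transported operator `R_{1,Q(f)} ∘ Δ₁⁺ ∘ R_{1,Q(f)}†`. -/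
def transportedOp (m₁ m₂ : ℝ) (f : Spacetime → ℝ) (h : Spacetime → ℂ) : Spacetime → ℂ :=
  moller m₁ m₂ f (vacuumOp m₁ (mollerAdjoint m₁ m₂ f h))

/-- The integral kernel `A(x, y)` of an operator `A` from test functions to smooth functions,
as a distribution on `M × M`: its value `∫∫ A(x, y) F(x, y) dy dx` on a test function `F` is
the integral over `x` of `A (F (x, ·))` at `x`. On `F = g ⊗ h` this is `∫ g · A h`. -/
def kernel (A : (Spacetime → ℂ) → Spacetime → ℂ) (F : Spacetime × Spacetime → ℂ) : ℂ :=
  ∫ x : Spacetime, A (fun y => F (x, y)) x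

/-- The switch-on profile `t ↦ ∫_{-∞}^t χ(τ) dτ`. -/
def profile (χ : ℝ → ℝ) (t : ℝ) : ℝ := ∫ τ in Set.Iic t, χ τ

/-- A family of cutoff functions `f i` on Minkowski spacetime that performs the adiabatic limit
`f → 1` along the filter `l`. The `f i` are smooth with past-compact support, and on the causal
past of each compact set they are eventually spatially constant, equal to a monotone switch-on
profile `t ↦ ∫_{-∞}^t χᵢ` with `χᵢ ≥ 0` a test function of unit integral. The profiles tend
to `1` pointwise, and they are switched on slowly, `∫ |χᵢ'| → 0`. -/
structure IsAdiabaticLimit {ι : Type*} (l : Filter ι)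
    (f : ι → Spacetime → ℝ) (χ : ι → ℝ → ℝ) : Prop where
  smooth : ∀ i, ContDiff ℝ ∞ (f i)
  pastCompact : ∀ i, PastCompact (tsupport (f i))
  smooth_rate : ∀ i, ContDiff ℝ ∞ (χ i)
  compact_rate : ∀ i, HasCompactSupport (χ i)
  nonneg_rate : ∀ i τ, 0 ≤ χ i τ
  integral_rate : ∀ i, ∫ τ, χ i τ = 1
  eventually_eq : ∀ K : Set Spacetime, IsCompact K →
    ∀ᶠ i in l, ∀ x ∈ causalPast K, f i x = profile (χ i) x.1
  tendsto_one : ∀ t, Tendsto (fun i => profile (χ i) t) l (𝓝 1)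
  slow : Tendsto (fun i => ∫ τ, |deriv (χ i) τ|) l (𝓝 0)

end AdiabaticVacuum

end

noncomputable section

namespace AdiabaticVacuum

/-! ### Causal geometry -/

/-! The retarded Møller map satisfies ∫ (Rφ) h = ∫ φ (R†h), and R†h = h - Vv, where V is the mass
change and v is the advanced solution with source h in the switched potential. As v lives on the
causal past of supp h, both R† and (by duality) R feel the cutoff only on the causal past of the
region where they are tested. So for a fixed test function F on M × M the cutoffs may be replaced,
eventually along the filter, by spatially constant ones (`kernel_transportedOp_congr`).

For a cutoff that depends on time only, translation invariance and uniqueness show that R sends the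
plane wave exp(i(ω₁t + 𝐤·𝐱)) to exp(i𝐤·𝐱) u(t). Here u is the solution of u'' + w u = 0 with w =
|𝐤|² + m₁² + (m₂² - m₁²) ∫_{-∞}^t χ that equals exp(iω₁t) at early times. Moving R and R† onto the
plane waves turns the transported two-point function into the integral of (2ω₁)⁻¹ R e_k ⊗ conj(R
e_k) over 𝐤, up to the factor (2π)⁻³ (`transportedOp_switchOn_eq`).

The adiabatic theorem for this oscillator is the WKB approximation with q = w^(-1/4) and phase θ, θ'
= q⁻². The function q exp(±iθ) solves the equation up to an error q'', so the Wronskians of u with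
both of them are nearly conserved. The error is controlled by ∫ |q''|, hence by ∫ (χ² + |χ'|) ≤ 2 ∫
|χ'|, which tends to 0. Thus ω₁⁻¹ u(t) conj(u(s)) tends to ω₂⁻¹ exp(iω₂(t - s)) for each 𝐤 ≠ 0
(`tendsto_mode_product`). The phase accumulated during the switching cancels in this product,
although u itself need not converge.

Dominated convergence finishes the argument. A monotone frequency gives the energy bound |u|² ≤ 2(1
+ ω₁²/ω₂²) uniformly in χ. The resulting singularity at 𝐤 = 0 is at worst |𝐤|⁻², integrable in three
dimensions even for vanishing masses, and decay at large 𝐤 comes from integrating the test function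
by parts in space.

Existence and uniqueness of the Møller maps rest on an explicit retarded propagator for the wave
operator (Kirchhoff's formula `retarded_box`), a Volterra series for the potential, time reflection
for advanced solutions, and Green's identity. -/

/-- A closed past-compact set that contains its causal future. -/
structure IsFutureSet (S : Set Spacetime) : Prop where
  isClosed : IsClosed S
  pastCompact : PastCompact S
  future : causalFuture S ⊆ S

/-- The causal past is the Minkowski sum of the set and the closed backward cone, and the sum of a
compact and a closed set is closed. -/
theorem isClosed_causalPast {K : Set Spacetime} (hK : IsCompact K) : IsClosed (causalPast K) := by
  have hc : IsClosed {z : Spacetime | ‖z.2‖ ≤ -z.1} :=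
    isClosed_le (by fun_prop) (by fun_prop)
  have h := hc.add_left_of_isCompact hK
  convert h using 1
  ext x
  simp only [causalPast, Set.mem_ofPred_eq, Set.mem_add]
  constructor
  · rintro ⟨y, hy, hxy⟩
    exact ⟨y, hy, x - y, by simpa [norm_sub_rev] using hxy, by simp⟩
  · rintro ⟨y, hy, z, hz, rfl⟩
    exact ⟨y, hy, by simpa using hz⟩

theorem isClosed_causalFuture_of_isCompact {K : Set Spacetime} (hK : IsCompact K) :
    IsClosed (causalFuture K) := by
  have hc : IsClosed {z : Spacetime | ‖z.2‖ ≤ z.1} :=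
    isClosed_le (by fun_prop) (by fun_prop)
  have h := hc.add_left_of_isCompact hK
  convert h using 1
  ext x
  simp only [causalFuture, Set.mem_ofPred_eq, Set.mem_add]
  constructor
  · rintro ⟨y, hy, hxy⟩
    exact ⟨y, hy, x - y, by simpa using hxy, by simp⟩
  · rintro ⟨y, hy, z, hz, rfl⟩
    exact ⟨y, hy, by simpa using hz⟩

theorem subset_causalFuture (S : Set Spacetime) : S ⊆ causalFuture S :=
  fun x hx => ⟨x, hx, by simp⟩

theorem subset_causalPast (S : Set Spacetime) : S ⊆ causalPast S :=
  fun x hx => ⟨x, hx, by simp⟩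

theorem causalPast_mono {S T : Set Spacetime} (h : S ⊆ T) : causalPast S ⊆ causalPast T :=
  fun _ ⟨y, hy, hxy⟩ => ⟨y, h hy, hxy⟩

theorem causalFuture_mono {S T : Set Spacetime} (h : S ⊆ T) : causalFuture S ⊆ causalFuture T :=
  fun _ ⟨y, hy, hxy⟩ => ⟨y, h hy, hxy⟩

theorem sub_cone_mem_causalPast {K : Set Spacetime} {x : Spacetime} (hx : x ∈ causalPast K)
    (y : Space) : x - (‖y‖, y) ∈ causalPast K := by
  obtain ⟨z, hz, hxz⟩ := hx
  refine ⟨z, hz, ?_⟩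
  have : z.2 - (x - (‖y‖, y)).2 = (z.2 - x.2) + y := by simp; abel
  rw [this]
  refine (norm_add_le _ _).trans ?_
  simp only [Prod.fst_sub]
  linarith

theorem IsFutureSet.of_sub_cone_mem {S : Set Spacetime} (hS : IsFutureSet S) {x : Spacetime}
    {y : Space} (h : x - (‖y‖, y) ∈ S) : x ∈ S :=
  hS.future ⟨_, h, by simp⟩

/-- Below K the backward cones widen only as fast as one goes back in time, so a lower bound on time
also bounds the spatial extent. -/
theorem isCompact_halfSpace_inter_causalPast (a : ℝ) {K : Set Spacetime} (hK : IsCompact K) :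
    IsCompact ({x : Spacetime | a ≤ x.1} ∩ causalPast K) := by
  refine Metric.isCompact_of_isClosed_isBounded
    ((isClosed_le (by fun_prop) (by fun_prop)).inter (isClosed_causalPast hK)) ?_
  obtain ⟨R, hR⟩ := hK.isBounded.subset_closedBall 0
  refine (Metric.isBounded_closedBall (x := (0 : Spacetime)) (r := 2 * R + |a|)).subset ?_
  rintro x ⟨hxa, y, hy, hxy⟩
  have hy' := hR hy
  simp only [Metric.mem_closedBall, dist_zero_right, Prod.norm_def, sup_le_iff,
    Real.norm_eq_abs, Set.mem_ofPred_eq] at hy' hxa ⊢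
  have h1 := abs_le.1 hy'.1
  have h2 := norm_nonneg (y.2 - x.2)
  have h3 := neg_abs_le a
  have h4 : ‖x.2‖ ≤ ‖y.2‖ + ‖y.2 - x.2‖ := by
    have := norm_sub_le y.2 (y.2 - x.2); simpa using this
  have h5 := norm_nonneg y.2
  refine ⟨abs_le.2 ⟨by linarith, by linarith [abs_nonneg a]⟩, by linarith⟩

theorem isCompact_causalFuture_inter_causalPast {C K : Set Spacetime} (hC : IsCompact C)
    (hK : IsCompact K) : IsCompact (causalFuture C ∩ causalPast K) := by
  obtain ⟨R, hR⟩ := hC.isBounded.subset_closedBall 0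
  refine (isCompact_halfSpace_inter_causalPast (-R) hK).of_isClosed_subset
    ((isClosed_causalFuture_of_isCompact hC).inter (isClosed_causalPast hK)) ?_
  rintro x ⟨⟨y, hy, hxy⟩, hx⟩
  refine ⟨?_, hx⟩
  have hy' := hR hy
  simp only [Metric.mem_closedBall, dist_zero_right, Prod.norm_def, sup_le_iff,
    Real.norm_eq_abs, Set.mem_ofPred_eq] at hy' ⊢
  linarith [(abs_le.1 hy'.1).1, norm_nonneg (x.2 - y.2)]

theorem causal_trans {x y z : Spacetime} (h₁ : ‖y.2 - x.2‖ ≤ y.1 - x.1)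
    (h₂ : ‖z.2 - y.2‖ ≤ z.1 - y.1) : ‖z.2 - x.2‖ ≤ z.1 - x.1 := by
  have := norm_add_le (z.2 - y.2) (y.2 - x.2)
  rw [sub_add_sub_cancel] at this
  linarith

theorem isFutureSet_causalFuture {S : Set Spacetime} (hS : PastCompact S) :
    IsFutureSet (causalFuture S) := by
  have hpc : PastCompact (causalFuture S) := by
    intro K hK
    -- A causal curve from S that ends in the past of K must start in the past of K, so only the
    -- compact part of S there matters.
    have : causalFuture S ∩ causalPast K = causalFuture (S ∩ causalPast K) ∩ causalPast K := by
      ext x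
      constructor
      · rintro ⟨⟨y, hy, hxy⟩, z, hz, hxz⟩
        exact ⟨⟨y, ⟨hy, z, hz, causal_trans hxy hxz⟩, hxy⟩, z, hz, hxz⟩
      · rintro ⟨hx, hx'⟩
        exact ⟨causalFuture_mono Set.inter_subset_left hx, hx'⟩
    rw [this]
    exact isCompact_causalFuture_inter_causalPast (hS K hK) hK
  refine ⟨?_, hpc, ?_⟩
  · refine isClosed_of_closure_subset fun x hx => ?_
    -- A ball around x lies in its own causal past, so near x the causal future of S coincides with
    -- a compact, hence closed, set.
    have hK := hpc _ (isCompact_closedBall x 1)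
    by_contra hxS
    have : x ∉ causalFuture S ∩ causalPast (Metric.closedBall x 1) := fun h => hxS h.1
    have h1 := (hK.isClosed.isOpen_compl.mem_nhds this)
    have h2 := inter_mem h1 (Metric.closedBall_mem_nhds x one_pos)
    obtain ⟨z, ⟨hz1, hz2⟩, hz3⟩ := mem_closure_iff_nhds.1 hx _ h2
    exact hz1 ⟨hz3, subset_causalPast _ hz2⟩
  · rintro x ⟨y, ⟨z, hz, hyz⟩, hxy⟩
    exact ⟨z, hz, causal_trans hyz hxy⟩

theorem isFutureSet_halfSpace (a : ℝ) : IsFutureSet {x : Spacetime | a ≤ x.1} where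
  isClosed := isClosed_le (by fun_prop) (by fun_prop)
  pastCompact := fun _ hK => isCompact_halfSpace_inter_causalPast a hK
  future := by
    rintro x ⟨y, hy, hxy⟩
    simp only [Set.mem_ofPred_eq] at hy ⊢
    linarith [norm_nonneg (x.2 - y.2)]

theorem PastCompact.mono {S T : Set Spacetime} (hT : PastCompact T) (hS : IsClosed S)
    (h : S ⊆ T) : PastCompact S := fun K hK =>
  (hT K hK).of_isClosed_subset (hS.inter (isClosed_causalPast hK))
    (Set.inter_subset_inter_left _ h)

theorem pastCompact_of_isCompact {S : Set Spacetime} (hS : IsCompact S) : PastCompact S :=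
  fun _ hK => hS.inter_right (isClosed_causalPast hK)

/-! ### Functions supported in a future set -/

section Supported

variable {E : Type*} [NormedAddCommGroup E]

theorem eventually_eq_zero_of_notMem {X : Type*} [TopologicalSpace X] {S : Set X}
    (hS : IsClosed S) {u : X → E} (hu : ∀ x ∉ S, u x = 0) {x : X} (hx : x ∉ S) :
    u =ᶠ[𝓝 x] 0 := by
  filter_upwards [hS.isOpen_compl.mem_nhds hx] with y hy using hu y hy

theorem IsFutureSet.exists_bound {S : Set Spacetime} (hS : IsFutureSet S) {u : Spacetime → E}
    (hu : ∀ x ∉ S, u x = 0) (hc : Continuous u) {K : Set Spacetime} (hK : IsCompact K) :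
    ∃ B, 0 ≤ B ∧ ∀ z ∈ causalPast K, ‖u z‖ ≤ B := by
  obtain ⟨B, hB⟩ := (hS.pastCompact K hK).exists_bound_of_continuousOn hc.continuousOn
  refine ⟨max B 0, le_max_right _ _, fun z hz => ?_⟩
  by_cases hzS : z ∈ S
  · exact (hB z ⟨hzS, hz⟩).trans (le_max_left _ _)
  · rw [hu z hzS, norm_zero]; exact le_max_right _ _

/-- The backward light cones with tips in K meet S in a bounded region. Integrals over such cones
therefore run over a fixed ball when the source vanishes off S. -/
theorem IsFutureSet.exists_radius {S : Set Spacetime} (hS : IsFutureSet S) {K : Set Spacetime}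
    (hK : IsCompact K) : ∃ R, 0 ≤ R ∧ ∀ x ∈ K, ∀ y : Space, x - (‖y‖, y) ∈ S → ‖y‖ ≤ R := by
  obtain ⟨R₁, h₁⟩ := (hS.pastCompact K hK).isBounded.subset_closedBall 0
  obtain ⟨R₂, h₂⟩ := hK.isBounded.subset_closedBall 0
  refine ⟨max (R₁ + R₂) 0, le_max_right _ _, fun x hx y hy => le_max_of_le_left ?_⟩
  have h3 := h₁ ⟨hy, sub_cone_mem_causalPast (subset_causalPast K hx) y⟩
  have h4 := h₂ hx
  simp only [Metric.mem_closedBall, dist_zero_right, Prod.norm_def, sup_le_iff,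
    Real.norm_eq_abs, Prod.fst_sub] at h3 h4
  linarith [(abs_le.1 h3.1).1, (abs_le.1 h4.1).2]

variable [NormedSpace ℝ E]

theorem fderiv_eq_zero_of_notMem {S : Set Spacetime} (hS : IsClosed S) {u : Spacetime → E}
    (hu : ∀ x ∉ S, u x = 0) : ∀ x ∉ S, fderiv ℝ u x = 0 := by
  intro x hx
  rw [(eventually_eq_zero_of_notMem hS hu hx).fderiv_eq]
  simp

theorem iteratedFDeriv_eq_zero_of_notMem {S : Set Spacetime} (hS : IsClosed S)
    {u : Spacetime → E} (hu : ∀ x ∉ S, u x = 0) (n : ℕ) :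
    ∀ x ∉ S, iteratedFDeriv ℝ n u x = 0 := by
  intro x hx
  rw [((eventually_eq_zero_of_notMem hS hu hx).iteratedFDeriv ℝ n).eq_of_nhds]
  simp

end Supported

/-! ### Radial integrals -/

section Radial

variable {F : Type*} [NormedAddCommGroup F] [NormedSpace ℝ F]

theorem integrable_radial_iff {g : ℝ → F} :
    Integrable (fun y : Space => g ‖y‖) ↔ IntegrableOn (fun r : ℝ => r ^ 2 • g r) (Set.Ioi 0) := by
  simpa using integrable_fun_norm_addHaar (E := Space) volume (f := g)

theorem integral_radial (g : ℝ → F) :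
    ∫ y : Space, g ‖y‖ = (4 * Real.pi) • ∫ r in Set.Ioi (0 : ℝ), r ^ 2 • g r := by
  have h := integral_fun_norm_addHaar (E := Space) volume g
  have hv : volume.real (Metric.ball (0 : Space) 1) = Real.pi * 4 / 3 := by
    rw [Measure.real, EuclideanSpace.volume_ball_fin_three]
    simp
    positivity
  rw [hv] at h
  rw [h]
  simp only [finrank_euclideanSpace, Fintype.card_fin, ← Nat.cast_smul_eq_nsmul ℝ, smul_smul]
  norm_num
  congr 1
  ring

end Radial

/-- The weight of the retarded propagator on the light cone. -/
def coneWeight (y : Space) : ℝ := (4 * Real.pi * ‖y‖)⁻¹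

theorem coneWeight_nonneg (y : Space) : 0 ≤ coneWeight y := by unfold coneWeight; positivity

theorem measurable_coneWeight : Measurable coneWeight := by unfold coneWeight; fun_prop

theorem integrable_coneWeight_exp {a : ℝ} (ha : 0 < a) :
    Integrable (fun y : Space => coneWeight y * Real.exp (-a * ‖y‖)) := by
  refine (integrable_radial_iff (g := fun r => (4 * Real.pi * r)⁻¹ * Real.exp (-a * r))).2 ?_
  have h2 := integrableOn_rpow_mul_exp_neg_mul_rpow (s := 1) (p := 1) (b := a)
    (by norm_num) one_pos ha
  refine IntegrableOn.congr_fun (h2.const_mul (4 * Real.pi)⁻¹) (fun r hr => ?_) measurableSet_Ioi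
  have hr' : r ≠ 0 := ne_of_gt hr
  simp only [Real.rpow_one, smul_eq_mul, mul_inv]
  field_simp

/-- In polar coordinates this is ∫ r exp(-ar) dr = a⁻². The factor a⁻² is the gain of the retarded
propagator in exponentially weighted norms and drives the convergence of the Volterra series. -/
theorem integral_coneWeight_exp {a : ℝ} (ha : 0 < a) :
    ∫ y : Space, coneWeight y * Real.exp (-a * ‖y‖) = (a ^ 2)⁻¹ := by
  refine (integral_radial fun r : ℝ => (4 * Real.pi * r)⁻¹ * Real.exp (-a * r)).trans ?_
  have h : ∫ r in Set.Ioi (0 : ℝ), r ^ 2 • ((4 * Real.pi * r)⁻¹ * Real.exp (-a * r)) =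
      (4 * Real.pi)⁻¹ * ∫ r in Set.Ioi (0 : ℝ), r ^ ((2 : ℝ) - 1) * Real.exp (-(a * r)) := by
    rw [← integral_const_mul]
    refine setIntegral_congr_fun measurableSet_Ioi fun r hr => ?_
    have hr' : r ≠ 0 := ne_of_gt hr
    norm_num
    field_simp
  rw [h, Real.integral_rpow_mul_exp_neg_mul_Ioi two_pos ha, smul_eq_mul, Real.Gamma_two]
  rw [← mul_assoc, mul_inv_cancel₀ (by positivity)]
  simp

/-! ### The retarded propagator of the wave operator -/

section Retarded

variable {E : Type*} [NormedAddCommGroup E] [NormedSpace ℝ E]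

/-- The retarded solution of the wave equation with source `u`. -/
def retarded (u : Spacetime → E) (x : Spacetime) : E :=
  ∫ y : Space, coneWeight y • u (x - (‖y‖, y))

theorem aestronglyMeasurable_retarded_integrand {u : Spacetime → E} (hc : Continuous u)
    (x : Spacetime) :
    AEStronglyMeasurable (fun y : Space => coneWeight y • u (x - (‖y‖, y))) volume :=
  measurable_coneWeight.aestronglyMeasurable.smul
    (by fun_prop : Continuous fun y : Space => u (x - (‖y‖, y))).aestronglyMeasurable

/-- The factor exp(R - |y|) is at least 1 wherever e does not vanish. It replaces a cutoff at radius
R by one fixed integrable majorant. -/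
theorem norm_coneWeight_smul_le {e : E} {B R : ℝ} (y : Space) (hB : ‖e‖ ≤ B)
    (hR : e ≠ 0 → ‖y‖ ≤ R) :
    ‖coneWeight y • e‖ ≤ B * Real.exp R * (coneWeight y * Real.exp (-1 * ‖y‖)) := by
  have h0 := coneWeight_nonneg y
  rw [norm_smul, Real.norm_of_nonneg h0]
  have hB0 : 0 ≤ B := (norm_nonneg _).trans hB
  by_cases he : e = 0
  · rw [he, norm_zero, mul_zero]; positivity
  · have : 1 ≤ Real.exp R * Real.exp (-1 * ‖y‖) := by
      rw [← Real.exp_add]; exact Real.one_le_exp (by linarith [hR he])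
    calc coneWeight y * ‖e‖ ≤ coneWeight y * B * 1 := by
          rw [mul_one]; exact mul_le_mul_of_nonneg_left hB h0
      _ ≤ coneWeight y * B * (Real.exp R * Real.exp (-1 * ‖y‖)) := by gcongr
      _ = _ := by ring

variable {S : Set Spacetime} (hS : IsFutureSet S) {u : Spacetime → E}

theorem IsFutureSet.exists_retarded_dominated (hS : IsFutureSet S) (hu : ∀ x ∉ S, u x = 0)
    (hc : Continuous u) {K : Set Spacetime} (hK : IsCompact K) :
    ∃ C, ∀ x ∈ K, ∀ y : Space, ‖coneWeight y • u (x - (‖y‖, y))‖ ≤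
      C * (coneWeight y * Real.exp (-1 * ‖y‖)) := by
  obtain ⟨B, -, hB⟩ := hS.exists_bound hu hc hK
  obtain ⟨R, -, hR⟩ := hS.exists_radius hK
  refine ⟨B * Real.exp R, fun x hx y => norm_coneWeight_smul_le y
    (hB _ (sub_cone_mem_causalPast (subset_causalPast K hx) y)) fun h => hR x hx y ?_⟩
  by_contra h'
  exact h (hu _ h')

theorem IsFutureSet.integrable_retarded (hS : IsFutureSet S) (hu : ∀ x ∉ S, u x = 0)
    (hc : Continuous u) (x : Spacetime) :
    Integrable (fun y : Space => coneWeight y • u (x - (‖y‖, y))) := by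
  obtain ⟨C, hC⟩ := hS.exists_retarded_dominated hu hc (isCompact_singleton (x := x))
  exact ((integrable_coneWeight_exp one_pos).const_mul C).mono'
    (aestronglyMeasurable_retarded_integrand hc x) (ae_of_all _ fun y => hC x rfl y)

theorem IsFutureSet.retarded_eq_zero (hS : IsFutureSet S) (hu : ∀ x ∉ S, u x = 0) :
    ∀ x ∉ S, retarded u x = 0 := by
  intro x hx
  unfold retarded
  rw [integral_eq_zero_of_ae (ae_of_all _ fun y => ?_)]
  show coneWeight y • u (x - (‖y‖, y)) = 0
  rw [hu _ fun h => hx (hS.of_sub_cone_mem h), smul_zero]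

theorem IsFutureSet.continuous_retarded (hS : IsFutureSet S) (hu : ∀ x ∉ S, u x = 0)
    (hc : Continuous u) : Continuous (retarded u) := by
  rw [continuous_iff_continuousAt]
  intro x₀
  obtain ⟨C, hC⟩ := hS.exists_retarded_dominated hu hc (isCompact_closedBall x₀ 1)
  refine continuousAt_of_dominated (bound := fun y => C * (coneWeight y * Real.exp (-1 * ‖y‖)))
    (Eventually.of_forall fun x => aestronglyMeasurable_retarded_integrand hc x) ?_
    ((integrable_coneWeight_exp one_pos).const_mul C) (ae_of_all _ fun y => ?_)
  · filter_upwards [Metric.closedBall_mem_nhds x₀ one_pos] with x hx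
    exact ae_of_all _ fun y => hC x hx y
  · fun_prop

/-- The point x enters only through a translation of u, so differentiation under the integral falls
on u and leaves the singular weight untouched. -/
theorem IsFutureSet.hasFDerivAt_retarded (hS : IsFutureSet S) (hu : ∀ x ∉ S, u x = 0)
    (hc : ContDiff ℝ 1 u) (x : Spacetime) :
    HasFDerivAt (retarded u) (retarded (fderiv ℝ u) x) x := by
  have hc' : Continuous (fderiv ℝ u) := hc.continuous_fderiv one_ne_zero
  have hu' := fderiv_eq_zero_of_notMem hS.isClosed hu
  obtain ⟨C, hC⟩ := hS.exists_retarded_dominated hu' hc' (isCompact_closedBall x 1)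
  refine hasFDerivAt_integral_of_dominated_of_fderiv_le
    (F := fun x y => coneWeight y • u (x - (‖y‖, y)))
    (F' := fun x y => coneWeight y • fderiv ℝ u (x - (‖y‖, y)))
    (bound := fun y => C * (coneWeight y * Real.exp (-1 * ‖y‖)))
    (Metric.ball_mem_nhds x one_pos)
    (Eventually.of_forall fun x => aestronglyMeasurable_retarded_integrand hc.continuous x)
    (hS.integrable_retarded hu hc.continuous x)
    (aestronglyMeasurable_retarded_integrand hc' x)
    (ae_of_all _ fun y z hz => hC z (Metric.ball_subset_closedBall hz) y)
    ((integrable_coneWeight_exp one_pos).const_mul C) (ae_of_all _ fun y z _ => ?_)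
  have h := ((hc.differentiable one_ne_zero) (z - (‖y‖, y))).hasFDerivAt
  have h2 : HasFDerivAt (fun z : Spacetime => z - (‖y‖, y)) (ContinuousLinearMap.id ℝ _) z :=
    (hasFDerivAt_id z).sub_const _
  exact (h.comp z h2).const_smul (coneWeight y)

theorem IsFutureSet.fderiv_retarded (hS : IsFutureSet S) (hu : ∀ x ∉ S, u x = 0)
    (hc : ContDiff ℝ 1 u) : fderiv ℝ (retarded u) = retarded (fderiv ℝ u) :=
  funext fun x => (hS.hasFDerivAt_retarded hu hc x).fderiv

/-- The target space is quantified inside the induction because the derivative of a retarded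
potential is the retarded potential of an operator-valued function. -/
theorem contDiff_retarded_nat (hS : IsFutureSet S) (n : ℕ) : ∀ {E : Type _}
    [NormedAddCommGroup E] [NormedSpace ℝ E] {u : Spacetime → E}, (∀ x ∉ S, u x = 0) →
    ContDiff ℝ n u → ContDiff ℝ n (retarded u) := by
  induction n with
  | zero =>
    intro E _ _ u hu hc
    exact contDiff_zero.2 (hS.continuous_retarded hu (contDiff_zero.1 hc))
  | succ n ih =>
    intro E _ _ u hu hc
    have h1 : ContDiff ℝ 1 u := hc.of_le (by exact_mod_cast Nat.le_add_left 1 n)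
    push_cast at hc ⊢
    rw [contDiff_succ_iff_fderiv] at hc ⊢
    refine ⟨fun x => (hS.hasFDerivAt_retarded hu h1 x).differentiableAt, by simp, ?_⟩
    rw [hS.fderiv_retarded hu h1]
    exact ih (fderiv_eq_zero_of_notMem hS.isClosed hu) hc.2.2

theorem IsFutureSet.contDiff_retarded (hS : IsFutureSet S) (hu : ∀ x ∉ S, u x = 0)
    (hc : ContDiff ℝ ∞ u) : ContDiff ℝ ∞ (retarded u) :=
  contDiff_infty.2 fun n => contDiff_retarded_nat hS n hu (contDiff_infty.1 hc n)

theorem retarded_comp_continuousLinearMap {F : Type*} [NormedAddCommGroup F] [NormedSpace ℝ F]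
    [CompleteSpace E] [CompleteSpace F] (L : E →L[ℝ] F) (hS : IsFutureSet S)
    (hu : ∀ x ∉ S, u x = 0) (hc : Continuous u) (x : Spacetime) :
    retarded (fun z => L (u z)) x = L (retarded u x) := by
  unfold retarded
  rw [← L.integral_comp_comm (hS.integrable_retarded hu hc x)]
  simp

/-- Needed to control all derivatives in the Volterra series with the same contraction estimate as
the functions themselves. The currying isometries between derivatives of successive orders are
linear and pass through the integral. -/
theorem IsFutureSet.iteratedFDeriv_retarded [CompleteSpace E] (hS : IsFutureSet S)
    (hu : ∀ x ∉ S, u x = 0) (hc : ContDiff ℝ ∞ u) (n : ℕ) :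
    iteratedFDeriv ℝ n (retarded u) = retarded (iteratedFDeriv ℝ n u) := by
  induction n with
  | zero =>
    funext x
    rw [iteratedFDeriv_zero_eq_comp, iteratedFDeriv_zero_eq_comp]
    exact (retarded_comp_continuousLinearMap
      (continuousMultilinearCurryFin0 ℝ Spacetime
        E).symm.toContinuousLinearEquiv.toContinuousLinearMap hS hu hc.continuous x).symm
  | succ n ih =>
    funext x
    have h1 : ContDiff ℝ ∞ (iteratedFDeriv ℝ n u) :=
      hc.iteratedFDeriv_right (m := ∞) (by exact_mod_cast le_top)
    have h2 := iteratedFDeriv_eq_zero_of_notMem hS.isClosed hu n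
    rw [iteratedFDeriv_succ_eq_comp_left, iteratedFDeriv_succ_eq_comp_left, ih,
      hS.fderiv_retarded h2 (h1.of_le (by exact_mod_cast le_top))]
    exact (retarded_comp_continuousLinearMap
      (continuousMultilinearCurryLeftEquiv ℝ (fun _ : Fin (n + 1) => Spacetime)
        E).symm.toContinuousLinearEquiv.toContinuousLinearMap hS
        (fderiv_eq_zero_of_notMem hS.isClosed h2) (h1.continuous_fderiv (by simp)) x).symm

/-- The retarded propagator contracts exponentially weighted norms on causal pasts. -/
theorem norm_retarded_le {K : Set Spacetime} {a B : ℝ} (ha : 0 < a)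
    (h : ∀ z ∈ causalPast K, ‖u z‖ ≤ B * Real.exp (a * z.1)) {x : Spacetime}
    (hx : x ∈ causalPast K) : ‖retarded u x‖ ≤ B * (a ^ 2)⁻¹ * Real.exp (a * x.1) := by
  have hb : ∀ y : Space, ‖coneWeight y • u (x - (‖y‖, y))‖ ≤
      B * Real.exp (a * x.1) * (coneWeight y * Real.exp (-a * ‖y‖)) := by
    intro y
    rw [norm_smul, Real.norm_of_nonneg (coneWeight_nonneg y)]
    refine (mul_le_mul_of_nonneg_left (h _ (sub_cone_mem_causalPast hx y))
      (coneWeight_nonneg y)).trans (le_of_eq ?_)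
    have : a * (x - (‖y‖, y)).1 = a * x.1 + -a * ‖y‖ := by simp; ring
    rw [this, Real.exp_add]
    ring
  refine (norm_integral_le_of_norm_le ((integrable_coneWeight_exp ha).const_mul _)
    (ae_of_all _ hb)).trans (le_of_eq ?_)
  rw [integral_const_mul, integral_coneWeight_exp ha]
  ring

end Retarded

/-! ### The wave operator -/

/-- The directional derivative of a function on spacetime. -/
def dirDeriv (v : Spacetime) (u : Spacetime → ℂ) (x : Spacetime) : ℂ := fderiv ℝ u x v

/-- The unit vector in the time direction. -/
def timeDir : Spacetime := (1, 0)

/-- The unit vectors in the spatial directions. -/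
def spaceDir (j : Fin 3) : Spacetime := (0, EuclideanSpace.single j 1)

/-- The wave operator `∂ₜ² - ∇²`. -/
def box (u : Spacetime → ℂ) (x : Spacetime) : ℂ :=
  dirDeriv timeDir (dirDeriv timeDir u) x -
    ∑ j, dirDeriv (spaceDir j) (dirDeriv (spaceDir j) u) x

theorem contDiff_dirDeriv (v : Spacetime) {u : Spacetime → ℂ} (hu : ContDiff ℝ ∞ u) :
    ContDiff ℝ ∞ (dirDeriv v u) :=
  (hu.fderiv_right (m := ∞) (by simp)).clm_apply contDiff_const

theorem contDiff_box {u : Spacetime → ℂ} (hu : ContDiff ℝ ∞ u) : ContDiff ℝ ∞ (box u) :=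
  (contDiff_dirDeriv _ (contDiff_dirDeriv _ hu)).sub
    (ContDiff.sum fun _ _ => contDiff_dirDeriv _ (contDiff_dirDeriv _ hu))

theorem dirDeriv_eq_zero_of_notMem {S : Set Spacetime} (hS : IsClosed S) {u : Spacetime → ℂ}
    (hu : ∀ x ∉ S, u x = 0) (v : Spacetime) : ∀ x ∉ S, dirDeriv v u x = 0 := fun x hx => by
  rw [dirDeriv, fderiv_eq_zero_of_notMem hS hu x hx]; rfl

theorem box_eq_zero_of_notMem {S : Set Spacetime} (hS : IsClosed S) {u : Spacetime → ℂ}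
    (hu : ∀ x ∉ S, u x = 0) : ∀ x ∉ S, box u x = 0 := fun x hx => by
  have h := fun v => dirDeriv_eq_zero_of_notMem hS (dirDeriv_eq_zero_of_notMem hS hu v) v x hx
  simp [box, h]

theorem dirDeriv_comm {u : Spacetime → ℂ} (hu : ContDiff ℝ ∞ u) (v w x : Spacetime) :
    dirDeriv v (dirDeriv w u) x = dirDeriv w (dirDeriv v u) x := by
  have hd : DifferentiableAt ℝ (fderiv ℝ u) x :=
    (hu.fderiv_right (m := ∞) (by simp)).differentiable (by simp) x
  have h1 : ∀ a b : Spacetime, dirDeriv a (dirDeriv b u) x = fderiv ℝ (fderiv ℝ u) x a b := by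
    intro a b
    show fderiv ℝ (fun z => fderiv ℝ u z b) x a = _
    rw [fderiv_clm_apply hd (differentiableAt_const b)]
    simp
  rw [h1, h1]
  exact (((contDiff_infty.1 hu 2).contDiffAt (x := x)).isSymmSndFDerivAt (by simp)).eq v w

theorem dirDeriv_retarded {S : Set Spacetime} (hS : IsFutureSet S) {u : Spacetime → ℂ}
    (hu : ∀ x ∉ S, u x = 0) (hc : ContDiff ℝ ∞ u) (v : Spacetime) :
    dirDeriv v (retarded u) = retarded (dirDeriv v u) := by
  funext x
  rw [dirDeriv, hS.fderiv_retarded hu (hc.of_le (by exact_mod_cast le_top))]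
  exact (retarded_comp_continuousLinearMap (ContinuousLinearMap.apply ℝ ℂ v) hS
    (fderiv_eq_zero_of_notMem hS.isClosed hu) (hc.continuous_fderiv (by simp)) x).symm

theorem box_retarded {S : Set Spacetime} (hS : IsFutureSet S) {u : Spacetime → ℂ}
    (hu : ∀ x ∉ S, u x = 0) (hc : ContDiff ℝ ∞ u) (x : Spacetime) :
    box (retarded u) x = retarded (box u) x := by
  have hz := fun v => dirDeriv_eq_zero_of_notMem hS.isClosed hu v
  have hd := fun v => contDiff_dirDeriv v hc
  have h : ∀ v, dirDeriv v (dirDeriv v (retarded u)) = retarded (dirDeriv v (dirDeriv v u)) := by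
    intro v
    rw [dirDeriv_retarded hS hu hc, dirDeriv_retarded hS (hz v) (hd v)]
  have hi : ∀ v, Integrable fun y : Space =>
      coneWeight y • dirDeriv v (dirDeriv v u) (x - (‖y‖, y)) := fun v =>
    hS.integrable_retarded (dirDeriv_eq_zero_of_notMem hS.isClosed (hz v) v)
      (contDiff_dirDeriv v (hd v)).continuous x
  simp only [box, h]
  unfold retarded
  rw [← integral_finsetSum _ fun j _ => hi (spaceDir j), ← integral_sub (hi timeDir)
    (integrable_finsetSum _ fun j _ => hi (spaceDir j))]
  refine integral_congr_ae (ae_of_all _ fun y => ?_)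
  simp only [box, smul_sub, Finset.smul_sum]

/-! ### Kirchhoff's formula -/

/-- The regularised Euclidean norm. -/
def softNorm (ε : ℝ) (y : Space) : ℝ := Real.sqrt (‖y‖ ^ 2 + ε ^ 2)

theorem softNorm_pos {ε : ℝ} (hε : 0 < ε) (y : Space) : 0 < softNorm ε y :=
  Real.sqrt_pos.2 (by positivity)

theorem sq_softNorm (ε : ℝ) (y : Space) : softNorm ε y ^ 2 = ‖y‖ ^ 2 + ε ^ 2 :=
  Real.sq_sqrt (by positivity)

theorem norm_le_softNorm (ε : ℝ) (y : Space) : ‖y‖ ≤ softNorm ε y :=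
  Real.le_sqrt_of_sq_le (by nlinarith [sq_nonneg ε])

theorem le_softNorm (ε : ℝ) (y : Space) : ε ≤ softNorm ε y :=
  Real.le_sqrt_of_sq_le (by nlinarith [sq_nonneg ‖y‖])

theorem continuous_softNorm (ε : ℝ) : Continuous (softNorm ε) := by
  unfold softNorm; fun_prop

theorem sub_softNorm_mem_causalPast (x : Spacetime) (ε : ℝ) (y : Space) :
    x - (softNorm ε y, y) ∈ causalPast {x} :=
  ⟨x, rfl, by simpa using norm_le_softNorm ε y⟩

theorem hasDerivAt_softNorm_line {ε : ℝ} (hε : 0 < ε) (y : Space) (j : Fin 3) :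
    HasDerivAt (fun t : ℝ => softNorm ε (y + t • EuclideanSpace.single j (1 : ℝ)))
      (y j / softNorm ε y) 0 := by
  have h1 : ∀ t : ℝ, ‖y + t • EuclideanSpace.single j (1 : ℝ)‖ ^ 2 + ε ^ 2 =
      ‖y‖ ^ 2 + 2 * (t * y j) + t ^ 2 + ε ^ 2 := by
    intro t
    rw [norm_add_sq_real, inner_smul_right, norm_smul]
    have : inner ℝ y (EuclideanSpace.single j (1 : ℝ)) = y j := by
      simp [EuclideanSpace.inner_single_right]
    simp [this]
  have h2 : HasDerivAt (fun t : ℝ => ‖y‖ ^ 2 + 2 * (t * y j) + t ^ 2 + ε ^ 2) (2 * y j) 0 := by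
    have := ((((hasDerivAt_id (0 : ℝ)).mul_const (y j)).const_mul 2).const_add (‖y‖ ^ 2)).add
      ((hasDerivAt_id (0 : ℝ)).pow 2)
    simpa using this.add_const (ε ^ 2)
  have h3 := h2.sqrt (by simp; positivity)
  unfold softNorm
  simp only [h1]
  convert h3 using 1
  simp
  field_simp

theorem hasDerivAt_comp_softCone {w : Spacetime → ℂ} (hw : ContDiff ℝ ∞ w) (x : Spacetime)
    {ε : ℝ} (hε : 0 < ε) (y : Space) (j : Fin 3) :
    HasDerivAt (fun t : ℝ => w (x - (softNorm ε (y + t • EuclideanSpace.single j (1 : ℝ)),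
        y + t • EuclideanSpace.single j (1 : ℝ))))
      (-((y j / softNorm ε y : ℝ) : ℂ) * dirDeriv timeDir w (x - (softNorm ε y, y))
        - dirDeriv (spaceDir j) w (x - (softNorm ε y, y))) 0 := by
  have h1 : HasDerivAt (fun t : ℝ => y + t • EuclideanSpace.single j (1 : ℝ))
      (EuclideanSpace.single j (1 : ℝ)) 0 := by
    simpa using ((hasDerivAt_id (0 : ℝ)).smul_const (EuclideanSpace.single j (1 : ℝ))).const_add y
  have h2 := ((hasDerivAt_softNorm_line hε y j).prodMk h1).const_sub x
  have h3 := ((hw.differentiable (by simp)) (x - (softNorm ε y, y))).hasFDerivAt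
  have h4 := h3.comp_hasDerivAt_of_eq (0 : ℝ) h2 (by simp)
  refine h4.congr_deriv ?_
  have : -((y j / softNorm ε y, EuclideanSpace.single j (1 : ℝ)) : Spacetime) =
      (-(y j / softNorm ε y)) • timeDir - spaceDir j := by
    ext <;> simp [timeDir, spaceDir]
  rw [this, map_sub, map_smul]
  simp [dirDeriv]

/-- The components of a vector field on space whose divergence is, up to terms that are
negligible or concentrate at the origin as `ε → 0`, the wave operator restricted to the cone. -/
def coneField (u : Spacetime → ℂ) (x : Spacetime) (ε : ℝ) (j : Fin 3) (y : Space) : ℂ :=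
  ((softNorm ε y : ℝ) : ℂ)⁻¹ * dirDeriv (spaceDir j) u (x - (softNorm ε y, y))
    - (y j : ℂ) * ((softNorm ε y : ℝ) : ℂ)⁻¹ ^ 2 * dirDeriv timeDir u (x - (softNorm ε y, y))
    - (y j : ℂ) * ((softNorm ε y : ℝ) : ℂ)⁻¹ ^ 3 * u (x - (softNorm ε y, y))

/-- The derivative of the `j`-th component of `coneField` in direction `j`. -/
def coneFieldDeriv (u : Spacetime → ℂ) (x : Spacetime) (ε : ℝ) (j : Fin 3) (y : Space) : ℂ :=
  -((softNorm ε y : ℝ) : ℂ)⁻¹ *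
      dirDeriv (spaceDir j) (dirDeriv (spaceDir j) u) (x - (softNorm ε y, y))
    + ((y j ^ 2 : ℝ) : ℂ) * ((softNorm ε y : ℝ) : ℂ)⁻¹ ^ 3 *
      dirDeriv timeDir (dirDeriv timeDir u) (x - (softNorm ε y, y))
    - (((softNorm ε y : ℝ) : ℂ)⁻¹ ^ 2 - 3 * ((y j ^ 2 : ℝ) : ℂ) * ((softNorm ε y : ℝ) : ℂ)⁻¹ ^ 4) *
      dirDeriv timeDir u (x - (softNorm ε y, y))
    - (((softNorm ε y : ℝ) : ℂ)⁻¹ ^ 3 - 3 * ((y j ^ 2 : ℝ) : ℂ) * ((softNorm ε y : ℝ) : ℂ)⁻¹ ^ 5) *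
      u (x - (softNorm ε y, y))

/-- The chain rule along the regularised cone r = √(|y|² + ε²). The mixed time-space second
derivatives produced by the first two terms of the field cancel by symmetry. -/
theorem hasLineDerivAt_coneField {u : Spacetime → ℂ} (hu : ContDiff ℝ ∞ u) (x : Spacetime)
    {ε : ℝ} (hε : 0 < ε) (j : Fin 3) (y : Space) :
    HasLineDerivAt ℝ (coneField u x ε j) (coneFieldDeriv u x ε j y) y
      (EuclideanSpace.single j (1 : ℝ)) := by
  have hr := (softNorm_pos hε y).ne'
  have hr' : ((softNorm ε y : ℝ) : ℂ) ≠ 0 := by exact_mod_cast hr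
  have h1 := ((hasDerivAt_softNorm_line hε y j).ofReal_comp).inv (by simpa using hr)
  have h2 : HasDerivAt (fun t : ℝ => (((y + t • EuclideanSpace.single j (1 : ℝ)) j : ℝ) : ℂ))
      1 0 := by
    have := ((hasDerivAt_id (0 : ℝ)).const_add (y j)).ofReal_comp
    simpa using this
  have hj := hasDerivAt_comp_softCone (contDiff_dirDeriv (spaceDir j) hu) x hε y j
  have ht := hasDerivAt_comp_softCone (contDiff_dirDeriv timeDir hu) x hε y j
  have h0 := hasDerivAt_comp_softCone hu x hε y j
  have := ((h1.mul hj).sub ((h2.mul (h1.pow 2)).mul ht)).sub ((h2.mul (h1.pow 3)).mul h0)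
  refine this.congr_deriv ?_
  rw [dirDeriv_comm hu (spaceDir j) timeDir]
  simp only [coneFieldDeriv, zero_smul, add_zero]
  push_cast
  simp only [Pi.inv_apply, Pi.pow_apply, Pi.mul_apply, zero_smul, add_zero]
  generalize dirDeriv timeDir (dirDeriv (spaceDir j) u) (x - (softNorm ε y, y)) = a
  generalize dirDeriv timeDir (dirDeriv timeDir u) (x - (softNorm ε y, y)) = b
  generalize dirDeriv (spaceDir j) (dirDeriv (spaceDir j) u) (x - (softNorm ε y, y)) = c
  generalize dirDeriv timeDir u (x - (softNorm ε y, y)) = d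
  generalize dirDeriv (spaceDir j) u (x - (softNorm ε y, y)) = e
  generalize u (x - (softNorm ε y, y)) = f
  field_simp
  ring

theorem continuous_softCone (x : Spacetime) (ε : ℝ) :
    Continuous fun y : Space => x - (softNorm ε y, y) := by
  have := continuous_softNorm ε
  fun_prop

theorem hasCompactSupport_comp_softCone {S : Set Spacetime} (hS : IsFutureSet S)
    {w : Spacetime → ℂ} (hw : ∀ x ∉ S, w x = 0) (x : Spacetime) (ε : ℝ) :
    HasCompactSupport fun y : Space => w (x - (softNorm ε y, y)) := by
  obtain ⟨R, hR⟩ := ((hS.pastCompact {x} isCompact_singleton)).isBounded.subset_closedBall x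
  refine HasCompactSupport.of_support_subset_isCompact (isCompact_closedBall (0 : Space) R) ?_
  intro y hy
  have h1 : x - (softNorm ε y, y) ∈ S := by
    by_contra h; exact hy (hw _ h)
  have h2 := hR ⟨h1, sub_softNorm_mem_causalPast x ε y⟩
  rw [Metric.mem_closedBall, dist_eq_norm] at h2 ⊢
  have h3 := (norm_snd_le (x - (softNorm ε y, y) - x)).trans h2
  simpa using h3

theorem integrable_softCone_mul {S : Set Spacetime} (hS : IsFutureSet S)
    {w : Spacetime → ℂ} (hw : ∀ x ∉ S, w x = 0) (hc : Continuous w) (x : Spacetime) (ε : ℝ)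
    {k : Space → ℂ} (hk : Continuous k) :
    Integrable fun y : Space => k y * w (x - (softNorm ε y, y)) :=
  (hk.mul (hc.comp (continuous_softCone x ε))).integrable_of_hasCompactSupport
    (hasCompactSupport_comp_softCone hS hw x ε).mul_left

theorem continuous_softNorm_inv {ε : ℝ} (hε : 0 < ε) :
    Continuous fun y : Space => ((softNorm ε y : ℝ) : ℂ)⁻¹ :=
  (Complex.continuous_ofReal.comp (continuous_softNorm ε)).inv₀
    fun y => Complex.ofReal_ne_zero.2 (softNorm_pos hε y).ne'

theorem integral_coneFieldDeriv {S : Set Spacetime} (hS : IsFutureSet S)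
    {u : Spacetime → ℂ} (hu : ∀ x ∉ S, u x = 0) (hc : ContDiff ℝ ∞ u) (x : Spacetime) {ε : ℝ}
    (hε : 0 < ε) (j : Fin 3) :
    Integrable (coneFieldDeriv u x ε j) ∧ ∫ y, coneFieldDeriv u x ε j y = 0 := by
  have hz := fun v => dirDeriv_eq_zero_of_notMem hS.isClosed hu v
  have hd := fun v => contDiff_dirDeriv v hc
  have hzz := fun v => dirDeriv_eq_zero_of_notMem hS.isClosed (hz v) v
  have hdd := fun v => contDiff_dirDeriv v (hd v)
  have hr := continuous_softNorm_inv hε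
  have hI := fun (k : Space → ℂ) (hk : Continuous k) =>
    integrable_softCone_mul hS hu hc.continuous x ε hk
  have hI1 := fun v (k : Space → ℂ) (hk : Continuous k) =>
    integrable_softCone_mul hS (hz v) (hd v).continuous x ε hk
  have hI2 := fun v (k : Space → ℂ) (hk : Continuous k) =>
    integrable_softCone_mul hS (hzz v) (hdd v).continuous x ε hk
  have hA : Integrable (coneField u x ε j) :=
    ((hI1 _ _ hr).sub (hI1 _ _ (by fun_prop))).sub (hI _ (by fun_prop))
  have hA' : Integrable (coneFieldDeriv u x ε j) :=
    (((hI2 _ _ (by fun_prop)).add (hI2 _ _ (by fun_prop))).sub (hI1 _ _ (by fun_prop))).sub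
      (hI _ (by fun_prop))
  refine ⟨hA', ?_⟩
  -- Integration by parts against the constant function 1 says that a derivative of an integrable
  -- field has integral zero.
  have := integral_bilinear_hasLineDerivAt_right_eq_neg_left_of_integrable (μ := volume)
    (B := ContinuousLinearMap.mul ℝ ℂ) (f := fun _ : Space => (1 : ℂ)) (f' := fun _ => 0)
    (g := coneField u x ε j) (g' := coneFieldDeriv u x ε j)
    (v := EuclideanSpace.single j (1 : ℝ)) (by simp) (by simpa using hA') (by simpa using hA)
    (fun y _ => by simpa [HasLineDerivAt] using hasDerivAt_const (0 : ℝ) (1 : ℂ))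
    (fun y _ => hasLineDerivAt_coneField hc x hε j y)
  simpa using this

/-- The algebraic core of Kirchhoff's formula, obtained from |y|² = r² - ε². Beside the wave
operator with weight 1/r there remain terms carrying ε². Those with derivatives of u vanish as ε →
0, and 3ε²r⁻⁵ is an approximate delta of mass 4π. -/
theorem sum_coneFieldDeriv (u : Spacetime → ℂ) (x : Spacetime) {ε : ℝ} (hε : 0 < ε) (y : Space) :
    ∑ j, coneFieldDeriv u x ε j y =
      ((softNorm ε y : ℝ) : ℂ)⁻¹ * box u (x - (softNorm ε y, y))
      - ((ε ^ 2 * (softNorm ε y)⁻¹ ^ 3 : ℝ) : ℂ) *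
        dirDeriv timeDir (dirDeriv timeDir u) (x - (softNorm ε y, y))
      - ((3 * ε ^ 2 * (softNorm ε y)⁻¹ ^ 4 : ℝ) : ℂ) * dirDeriv timeDir u (x - (softNorm ε y, y))
      - ((3 * ε ^ 2 * (softNorm ε y)⁻¹ ^ 5 : ℝ) : ℂ) * u (x - (softNorm ε y, y)) := by
  have hr' : ((softNorm ε y : ℝ) : ℂ) ≠ 0 := by exact_mod_cast (softNorm_pos hε y).ne'
  have hs : ((softNorm ε y : ℝ) : ℂ) ^ 2 = (y 0 : ℂ) ^ 2 + (y 1 : ℂ) ^ 2 + (y 2 : ℂ) ^ 2 +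
      (ε : ℂ) ^ 2 := by
    have := sq_softNorm ε y
    rw [EuclideanSpace.real_norm_sq_eq, Fin.sum_univ_three] at this
    exact_mod_cast this
  have hε2 : (ε : ℂ) ^ 2 = ((softNorm ε y : ℝ) : ℂ) ^ 2 -
      ((y 0 : ℂ) ^ 2 + (y 1 : ℂ) ^ 2 + (y 2 : ℂ) ^ 2) := by rw [hs]; ring
  simp only [coneFieldDeriv, box, Fin.sum_univ_three]
  push_cast
  rw [hε2]
  field_simp
  ring

/-! ### Limits of integrals over regularised cones -/

theorem integrable_inv_norm_mul_exp : Integrable fun y : Space => ‖y‖⁻¹ * Real.exp (-1 * ‖y‖) := by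
  refine ((integrable_coneWeight_exp one_pos).const_mul (4 * Real.pi)).congr
    (ae_of_all _ fun y => ?_)
  simp only [coneWeight, mul_inv]
  field_simp

theorem integrable_inv_norm_sq_mul_exp :
    Integrable fun y : Space => ‖y‖⁻¹ ^ 2 * Real.exp (-1 * ‖y‖) := by
  refine (integrable_radial_iff (g := fun r => r⁻¹ ^ 2 * Real.exp (-1 * r))).2 ?_
  refine IntegrableOn.congr_fun (exp_neg_integrableOn_Ioi 0 one_pos) (fun r hr => ?_)
    measurableSet_Ioi
  have hr' : r ≠ 0 := ne_of_gt hr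
  simp only [smul_eq_mul]
  field_simp

theorem tendsto_softNorm (y : Space) : Tendsto (fun ε => softNorm ε y) (𝓝[>] 0) (𝓝 ‖y‖) := by
  have h : Continuous fun ε : ℝ => softNorm ε y := by unfold softNorm; fun_prop
  have := (h.tendsto 0).mono_left (nhdsWithin_le_nhds (s := Set.Ioi 0))
  simpa [softNorm] using this

/-- Dominated convergence for integrals over regularised cones. -/
theorem tendsto_integral_softCone {S : Set Spacetime} (hS : IsFutureSet S)
    {w : Spacetime → ℂ} (hw : ∀ x ∉ S, w x = 0) (hc : Continuous w) (x : Spacetime)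
    {k : ℝ → Space → ℝ} {k₀ b : Space → ℝ} (hk : ∀ ε > 0, Continuous (k ε))
    (hb : ∀ ε > 0, ∀ y ≠ 0, |k ε y| ≤ b y) (hbi : Integrable fun y => b y * Real.exp (-1 * ‖y‖))
    (hlim : ∀ y ≠ 0, Tendsto (fun ε => k ε y) (𝓝[>] 0) (𝓝 (k₀ y))) :
    Tendsto (fun ε => ∫ y : Space, (k ε y : ℂ) * w (x - (softNorm ε y, y))) (𝓝[>] 0)
      (𝓝 (∫ y : Space, (k₀ y : ℂ) * w (x - (‖y‖, y)))) := by
  obtain ⟨B, hB0, hB⟩ := hS.exists_bound hw hc (isCompact_singleton (x := x))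
  -- For every ε the regularised cone lies inside the solid backward cone of x. One radius therefore
  -- serves for all ε, and exp(R - |y|) ≥ 1 is again the majorant on the support.
  obtain ⟨R, hR⟩ := ((hS.pastCompact {x} isCompact_singleton)).isBounded.subset_closedBall x
  have hpos : ∀ᶠ ε in 𝓝[>] (0 : ℝ), 0 < ε := self_mem_nhdsWithin
  have h0 : ∀ᵐ y : Space, y ≠ 0 := by simp [ae_iff]
  refine tendsto_integral_filter_of_dominated_convergence
    (fun y => B * Real.exp R * (b y * Real.exp (-1 * ‖y‖))) ?_ ?_ (hbi.const_mul _) ?_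
  · filter_upwards [hpos] with ε hε
    exact ((Complex.continuous_ofReal.comp (hk ε hε)).mul
      (hc.comp (continuous_softCone x ε))).aestronglyMeasurable
  · filter_upwards [hpos] with ε hε
    filter_upwards [h0] with y hy0
    have hb0 : 0 ≤ b y := (abs_nonneg _).trans (hb ε hε y hy0)
    rw [norm_mul, Complex.norm_real, Real.norm_eq_abs]
    by_cases hy : x - (softNorm ε y, y) ∈ S
    · have hp := sub_softNorm_mem_causalPast x ε y
      have h2 := hR ⟨hy, hp⟩
      rw [Metric.mem_closedBall, dist_eq_norm] at h2
      have h3 : ‖y‖ ≤ R := by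
        simpa using (norm_snd_le (x - (softNorm ε y, y) - x)).trans h2
      have : 1 ≤ Real.exp R * Real.exp (-1 * ‖y‖) := by
        rw [← Real.exp_add]; exact Real.one_le_exp (by linarith)
      calc |k ε y| * ‖w (x - (softNorm ε y, y))‖ ≤ b y * B * 1 := by
            rw [mul_one]; exact mul_le_mul (hb ε hε y hy0) (hB _ hp) (norm_nonneg _) hb0
        _ ≤ b y * B * (Real.exp R * Real.exp (-1 * ‖y‖)) := by gcongr
        _ = _ := by ring
    · rw [hw _ hy, norm_zero, mul_zero]; positivity
  · filter_upwards [h0] with y hy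
    refine ((Complex.continuous_ofReal.tendsto _).comp (hlim y hy)).mul ?_
    refine (hc.tendsto _).comp ?_
    exact tendsto_const_nhds.sub ((tendsto_softNorm y).prodMk_nhds tendsto_const_nhds)

theorem hasDerivAt_cube_div_softNorm (r : ℝ) :
    HasDerivAt (fun r : ℝ => (r / Real.sqrt (r ^ 2 + 1)) ^ 3)
      (3 * r ^ 2 * (Real.sqrt (r ^ 2 + 1))⁻¹ ^ 5) r := by
  have hp : 0 < r ^ 2 + 1 := by positivity
  have hs : 0 < Real.sqrt (r ^ 2 + 1) := Real.sqrt_pos.2 hp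
  have h1 : HasDerivAt (fun r : ℝ => Real.sqrt (r ^ 2 + 1)) (r / Real.sqrt (r ^ 2 + 1)) r := by
    refine ((((hasDerivAt_id r).pow 2).add_const 1).sqrt hp.ne').congr_deriv ?_
    simp only [Pi.pow_apply, id]
    push_cast
    field_simp
  have h2 := ((hasDerivAt_id r).div h1 hs.ne').pow 3
  refine h2.congr_deriv ?_
  have hsq : Real.sqrt (r ^ 2 + 1) ^ 2 = r ^ 2 + 1 := Real.sq_sqrt hp.le
  simp only [id, Pi.div_apply]
  push_cast
  field_simp
  rw [hsq]
  field_simp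
  ring

/-- In polar coordinates the integrand 3r²(r² + 1)^(-5/2) has the antiderivative (r/√(r² + 1))³,
which rises from 0 to 1. -/
theorem integral_softNorm_one :
    Integrable (fun z : Space => 3 * (softNorm 1 z)⁻¹ ^ 5) ∧
    ∫ z : Space, 3 * (softNorm 1 z)⁻¹ ^ 5 = 4 * Real.pi := by
  have hlim : Tendsto (fun r : ℝ => (r / Real.sqrt (r ^ 2 + 1)) ^ 3) atTop (𝓝 1) := by
    have h1 : Tendsto (fun r : ℝ => (Real.sqrt (1 + (r ^ 2)⁻¹))⁻¹ ^ 3) atTop (𝓝 1) := by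
      have h : Tendsto (fun r : ℝ => 1 + (r ^ 2)⁻¹) atTop (𝓝 (1 + 0)) :=
        tendsto_const_nhds.add ((tendsto_pow_atTop two_ne_zero).inv_tendsto_atTop)
      have := ((h.sqrt).inv₀ (by simp)).pow 3
      simpa using this
    refine h1.congr' ?_
    filter_upwards [eventually_gt_atTop 0] with r hr
    congr 1
    have : r ^ 2 + 1 = r ^ 2 * (1 + (r ^ 2)⁻¹) := by field_simp
    rw [this, Real.sqrt_mul (by positivity), Real.sqrt_sq hr.le, div_mul_eq_div_div,
      div_self hr.ne', one_div]
  have hpos : ∀ r ∈ Set.Ioi (0 : ℝ), 0 ≤ 3 * r ^ 2 * (Real.sqrt (r ^ 2 + 1))⁻¹ ^ 5 :=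
    fun r _ => by positivity
  have hint := integrableOn_Ioi_deriv_of_nonneg' (a := 0)
    (fun r _ => hasDerivAt_cube_div_softNorm r) hpos hlim
  have hval := integral_Ioi_of_hasDerivAt_of_nonneg' (a := 0)
    (fun r _ => hasDerivAt_cube_div_softNorm r) hpos hlim
  have he : ∀ r : ℝ, r ^ 2 • (3 * (Real.sqrt (r ^ 2 + 1 ^ 2))⁻¹ ^ 5) =
      3 * r ^ 2 * (Real.sqrt (r ^ 2 + 1))⁻¹ ^ 5 := fun r => by simp; ring
  constructor
  · refine (integrable_radial_iff (g := fun r => 3 * (Real.sqrt (r ^ 2 + 1 ^ 2))⁻¹ ^ 5)).2 ?_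
    simp only [he]
    exact hint
  · refine (integral_radial (fun r => 3 * (Real.sqrt (r ^ 2 + 1 ^ 2))⁻¹ ^ 5)).trans ?_
    simp only [he]
    rw [hval]
    simp

theorem softNorm_smul {ε : ℝ} (hε : 0 < ε) (z : Space) :
    softNorm ε (ε • z) = ε * softNorm 1 z := by
  unfold softNorm
  rw [norm_smul, Real.norm_of_nonneg hε.le,
    show (ε * ‖z‖) ^ 2 + ε ^ 2 = ε ^ 2 * (‖z‖ ^ 2 + 1 ^ 2) by ring,
    Real.sqrt_mul (by positivity), Real.sqrt_sq hε.le]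

/-- The substitution y = εz turns the weight into the fixed density 3(|z|² + 1)^(-5/2) of mass 4π,
while the argument of w shrinks to x. -/
theorem tendsto_integral_softCone_delta {S : Set Spacetime} (hS : IsFutureSet S)
    {w : Spacetime → ℂ} (hw : ∀ x ∉ S, w x = 0) (hc : Continuous w) (x : Spacetime) :
    Tendsto (fun ε => ∫ y : Space, ((3 * ε ^ 2 * (softNorm ε y)⁻¹ ^ 5 : ℝ) : ℂ) *
      w (x - (softNorm ε y, y))) (𝓝[>] 0) (𝓝 ((4 * Real.pi : ℝ) * w x)) := by
  obtain ⟨B, hB0, hB⟩ := hS.exists_bound hw hc (isCompact_singleton (x := x))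
  have hpos : ∀ᶠ ε in 𝓝[>] (0 : ℝ), 0 < ε := self_mem_nhdsWithin
  have h1 : Tendsto (fun ε : ℝ => ∫ z : Space, ((3 * (softNorm 1 z)⁻¹ ^ 5 : ℝ) : ℂ) *
      w (x - (ε * softNorm 1 z, ε • z))) (𝓝[>] 0)
      (𝓝 (∫ z : Space, ((3 * (softNorm 1 z)⁻¹ ^ 5 : ℝ) : ℂ) * w x)) := by
    have hi := integral_softNorm_one.1
    refine tendsto_integral_filter_of_dominated_convergence
      (fun z => (3 * (softNorm 1 z)⁻¹ ^ 5) * B) ?_ ?_ (hi.mul_const _) ?_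
    · refine Eventually.of_forall fun ε => ?_
      refine (Complex.continuous_ofReal.comp_aestronglyMeasurable hi.1).mul ?_
      have := continuous_softNorm 1
      exact (hc.comp (by fun_prop :
        Continuous fun z : Space => x - (ε * softNorm 1 z, ε • z))).aestronglyMeasurable
    · filter_upwards [hpos] with ε hε
      refine ae_of_all _ fun z => ?_
      rw [norm_mul, Complex.norm_real, Real.norm_of_nonneg
        (by have := softNorm_pos one_pos z; positivity)]
      rw [← softNorm_smul hε]
      refine mul_le_mul_of_nonneg_left (hB _ (sub_softNorm_mem_causalPast x ε _)) ?_
      have := softNorm_pos one_pos z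
      positivity
    · refine ae_of_all _ fun z => tendsto_const_nhds.mul ?_
      have hc' : Continuous fun ε : ℝ => w (x - (ε * softNorm 1 z, ε • z)) := by fun_prop
      have := (hc'.tendsto 0).mono_left (nhdsWithin_le_nhds (s := Set.Ioi 0))
      rw [zero_mul, zero_smul, show ((0, 0) : Spacetime) = 0 from rfl, sub_zero] at this
      exact this
  have h2 : ∫ z : Space, ((3 * (softNorm 1 z)⁻¹ ^ 5 : ℝ) : ℂ) * w x =
      (4 * Real.pi : ℝ) * w x := by
    rw [integral_mul_const, integral_complex_ofReal, integral_softNorm_one.2]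
  rw [h2] at h1
  refine h1.congr' ?_
  filter_upwards [hpos] with ε hε
  have h3 := Measure.integral_comp_smul (μ := (volume : Measure Space)) (fun y : Space =>
    ((3 * ε ^ 2 * (softNorm ε y)⁻¹ ^ 5 : ℝ) : ℂ) * w (x - (softNorm ε y, y))) ε
  rw [finrank_euclideanSpace, Fintype.card_fin, abs_of_pos (by positivity)] at h3
  have h4 : ∫ y : Space, ((3 * ε ^ 2 * (softNorm ε y)⁻¹ ^ 5 : ℝ) : ℂ) *
      w (x - (softNorm ε y, y)) = (ε ^ 3) • ∫ z : Space,
      ((3 * ε ^ 2 * (softNorm ε (ε • z))⁻¹ ^ 5 : ℝ) : ℂ) * w (x - (softNorm ε (ε • z), ε • z)) := by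
    rw [h3, smul_smul, mul_inv_cancel₀ (by positivity), one_smul]
  rw [h4, ← integral_smul]
  refine integral_congr_ae (ae_of_all _ fun z => ?_)
  simp only [softNorm_smul hε, Complex.real_smul, ← mul_assoc]
  congr 1
  have := (softNorm_pos one_pos z).ne'
  rw [← Complex.ofReal_mul]
  congr 1
  field_simp

theorem integral_sub_sub_sub {X : Type*} [MeasurableSpace X] {μ : Measure X} {a b c d : X → ℂ}
    (ha : Integrable a μ) (hb : Integrable b μ) (hc : Integrable c μ) (hd : Integrable d μ) :
    ∫ x, a x - b x - c x - d x ∂μ = ∫ x, a x ∂μ - ∫ x, b x ∂μ - ∫ x, c x ∂μ - ∫ x, d x ∂μ := by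
  have hab : Integrable (fun x => a x - b x) μ := ha.sub hb
  have habc : Integrable (fun x => a x - b x - c x) μ := hab.sub hc
  rw [integral_sub habc hd, integral_sub hab hc, integral_sub ha hb]

/-- **Kirchhoff's formula**: the retarded propagator is a left inverse of the wave operator. -/
theorem retarded_box {S : Set Spacetime} (hS : IsFutureSet S) {u : Spacetime → ℂ}
    (hu : ∀ x ∉ S, u x = 0) (hc : ContDiff ℝ ∞ u) (x : Spacetime) :
    retarded (box u) x = u x := by
  have hz := dirDeriv_eq_zero_of_notMem hS.isClosed hu timeDir
  have hd := contDiff_dirDeriv timeDir hc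
  have hzz := dirDeriv_eq_zero_of_notMem hS.isClosed hz timeDir
  have hdd := contDiff_dirDeriv timeDir hd
  have hbz := box_eq_zero_of_notMem hS.isClosed hu
  have hbc := contDiff_box hc
  have hpos : ∀ᶠ ε in 𝓝[>] (0 : ℝ), 0 < ε := self_mem_nhdsWithin
  have hinv : ∀ ε > 0, Continuous fun y : Space => (softNorm ε y)⁻¹ := fun ε hε =>
    (continuous_softNorm ε).inv₀ fun y => (softNorm_pos hε y).ne'
  have hle : ∀ ε > 0, ∀ y : Space, y ≠ 0 → (softNorm ε y)⁻¹ ≤ ‖y‖⁻¹ := fun ε hε y hy =>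
    inv_anti₀ (norm_pos_iff.2 hy) (norm_le_softNorm ε y)
  have hε1 : ∀ ε > 0, ∀ y : Space, ε * (softNorm ε y)⁻¹ ≤ 1 := fun ε hε y => by
    rw [← div_eq_mul_inv]; exact div_le_one_of_le₀ (le_softNorm ε y) (softNorm_pos hε y).le
  have hlim0 : ∀ y : Space, y ≠ 0 → Tendsto (fun ε => (softNorm ε y)⁻¹) (𝓝[>] 0) (𝓝 ‖y‖⁻¹) :=
    fun y hy => (tendsto_softNorm y).inv₀ (norm_ne_zero_iff.2 hy)
  have hid : Tendsto (fun ε : ℝ => ε) (𝓝[>] 0) (𝓝 0) := tendsto_id.mono_left nhdsWithin_le_nhds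
  have t1 := tendsto_integral_softCone hS hbz hbc.continuous x
    (k := fun ε y => (softNorm ε y)⁻¹) (k₀ := fun y => ‖y‖⁻¹) (b := fun y => ‖y‖⁻¹) hinv
    (fun ε hε y hy => by
      rw [abs_of_nonneg (inv_nonneg.2 (softNorm_pos hε y).le)]; exact hle ε hε y hy)
    integrable_inv_norm_mul_exp hlim0
  have t2 := tendsto_integral_softCone hS hzz hdd.continuous x
    (k := fun ε y => ε ^ 2 * (softNorm ε y)⁻¹ ^ 3) (k₀ := fun y => 0) (b := fun y => ‖y‖⁻¹)
    (fun ε hε => continuous_const.mul ((hinv ε hε).pow 3))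
    (fun ε hε y hy => by
      have hp := inv_nonneg.2 (softNorm_pos hε y).le
      rw [abs_of_nonneg (by positivity)]
      calc ε ^ 2 * (softNorm ε y)⁻¹ ^ 3 = (ε * (softNorm ε y)⁻¹) ^ 2 * (softNorm ε y)⁻¹ := by ring
        _ ≤ 1 * ‖y‖⁻¹ := mul_le_mul (pow_le_one₀ (by positivity) (hε1 ε hε y)) (hle ε hε y hy) hp
            zero_le_one
        _ = ‖y‖⁻¹ := one_mul _)
    integrable_inv_norm_mul_exp
    (fun y hy => by simpa using (hid.pow 2).mul ((hlim0 y hy).pow 3))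
  have t3 := tendsto_integral_softCone hS hz hd.continuous x
    (k := fun ε y => 3 * ε ^ 2 * (softNorm ε y)⁻¹ ^ 4) (k₀ := fun y => 0)
    (b := fun y => 3 * ‖y‖⁻¹ ^ 2)
    (fun ε hε => continuous_const.mul ((hinv ε hε).pow 4))
    (fun ε hε y hy => by
      have hp := inv_nonneg.2 (softNorm_pos hε y).le
      rw [abs_of_nonneg (by positivity)]
      calc 3 * ε ^ 2 * (softNorm ε y)⁻¹ ^ 4
          = 3 * ((ε * (softNorm ε y)⁻¹) ^ 2 * (softNorm ε y)⁻¹ ^ 2) := by ring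
        _ ≤ 3 * (1 * ‖y‖⁻¹ ^ 2) := by
            gcongr
            · exact pow_le_one₀ (by positivity) (hε1 ε hε y)
            · exact norm_le_softNorm ε y
        _ = 3 * ‖y‖⁻¹ ^ 2 := by rw [one_mul])
    (by simpa [mul_assoc] using integrable_inv_norm_sq_mul_exp.const_mul 3)
    (fun y hy => by simpa using ((hid.pow 2).const_mul 3).mul ((hlim0 y hy).pow 4))
  have t4 := tendsto_integral_softCone_delta hS hu hc.continuous x
  have t5 := (t1.sub t2).sub t3
  -- For each ε > 0 the divergence integrates to zero, which equates the three terms with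
  -- derivatives of u to the delta term. Both sides are then compared in the limit.
  have heq := tendsto_nhds_unique (t5.congr' ?_) t4
  · simp only [Complex.ofReal_zero, zero_mul, integral_zero, sub_zero] at heq
    have hpi : (4 * Real.pi : ℝ) ≠ 0 := by positivity
    have : retarded (box u) x = ((4 * Real.pi : ℝ) : ℂ)⁻¹ *
        ∫ y : Space, ((‖y‖⁻¹ : ℝ) : ℂ) * box u (x - (‖y‖, y)) := by
      unfold retarded coneWeight
      rw [← integral_const_mul]
      refine integral_congr_ae (ae_of_all _ fun y => ?_)
      simp only [Complex.real_smul]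
      push_cast
      rw [mul_inv]
      ring
    rw [this, heq, ← mul_assoc, inv_mul_cancel₀ (by exact_mod_cast hpi), one_mul]
  · filter_upwards [hpos] with ε hε
    have i1 : Integrable fun y : Space => (((softNorm ε y)⁻¹ : ℝ) : ℂ) *
        box u (x - (softNorm ε y, y)) :=
      integrable_softCone_mul hS hbz hbc.continuous x ε
        (Complex.continuous_ofReal.comp (hinv ε hε))
    have i2 : Integrable fun y : Space => ((ε ^ 2 * (softNorm ε y)⁻¹ ^ 3 : ℝ) : ℂ) *
        dirDeriv timeDir (dirDeriv timeDir u) (x - (softNorm ε y, y)) :=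
      integrable_softCone_mul hS hzz hdd.continuous x ε
        (Complex.continuous_ofReal.comp (continuous_const.mul ((hinv ε hε).pow 3)))
    have i3 : Integrable fun y : Space => ((3 * ε ^ 2 * (softNorm ε y)⁻¹ ^ 4 : ℝ) : ℂ) *
        dirDeriv timeDir u (x - (softNorm ε y, y)) :=
      integrable_softCone_mul hS hz hd.continuous x ε
        (Complex.continuous_ofReal.comp (continuous_const.mul ((hinv ε hε).pow 4)))
    have i4 : Integrable fun y : Space => ((3 * ε ^ 2 * (softNorm ε y)⁻¹ ^ 5 : ℝ) : ℂ) *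
        u (x - (softNorm ε y, y)) :=
      integrable_softCone_mul hS hu hc.continuous x ε
        (Complex.continuous_ofReal.comp (continuous_const.mul ((hinv ε hε).pow 5)))
    have hs : ∫ y : Space, ∑ j, coneFieldDeriv u x ε j y = 0 := by
      rw [integral_finsetSum _ fun j _ => (integral_coneFieldDeriv hS hu hc x hε j).1]
      exact Finset.sum_eq_zero fun j _ => (integral_coneFieldDeriv hS hu hc x hε j).2
    simp only [sum_coneFieldDeriv u x hε, ← Complex.ofReal_inv] at hs
    exact sub_eq_zero.1 ((integral_sub_sub_sub i1 i2 i3 i4).symm.trans hs)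

/-- **Kirchhoff's formula**: the retarded propagator solves the wave equation. -/
theorem box_retarded_eq {S : Set Spacetime} (hS : IsFutureSet S) {u : Spacetime → ℂ}
    (hu : ∀ x ∉ S, u x = 0) (hc : ContDiff ℝ ∞ u) (x : Spacetime) :
    box (retarded u) x = u x :=
  (box_retarded hS hu hc x).trans (retarded_box hS hu hc x)

/-! ### Retarded solutions for a smooth potential -/

theorem norm_iteratedFDeriv_mul_le_of_le {f g : Spacetime → ℂ} (hf : ContDiff ℝ ∞ f)
    (hg : ContDiff ℝ ∞ g) {k : ℕ} {x : Spacetime} {A B : ℝ} (hA : 0 ≤ A)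
    (hfA : ∀ j ≤ k, ‖iteratedFDeriv ℝ j f x‖ ≤ A) (hgB : ∀ j ≤ k, ‖iteratedFDeriv ℝ j g x‖ ≤ B) :
    ∀ j ≤ k, ‖iteratedFDeriv ℝ j (fun z => f z * g z) x‖ ≤ 2 ^ k * A * B := by
  intro j hj
  have hB : 0 ≤ B := (norm_nonneg _).trans (hgB 0 (Nat.zero_le _))
  refine (norm_iteratedFDeriv_mul_le (n := j) (N := ∞) hf hg x (by exact_mod_cast le_top)).trans ?_
  calc ∑ i ∈ Finset.range (j + 1), (j.choose i : ℝ) * ‖iteratedFDeriv ℝ i f x‖ *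
        ‖iteratedFDeriv ℝ (j - i) g x‖
      ≤ ∑ i ∈ Finset.range (j + 1), (j.choose i : ℝ) * A * B := by
        refine Finset.sum_le_sum fun i hi => ?_
        have hi' : i ≤ j := Nat.lt_succ_iff.1 (Finset.mem_range.1 hi)
        gcongr
        · exact hfA i (hi'.trans hj)
        · exact hgB _ ((Nat.sub_le _ _).trans hj)
    _ = 2 ^ j * A * B := by
        rw [← Finset.sum_mul, ← Finset.sum_mul, ← Nat.cast_sum, Nat.sum_range_choose]
        simp
    _ ≤ 2 ^ k * A * B := by
        gcongr
        norm_num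

theorem exists_bound_iteratedFDeriv_on_compact {f : Spacetime → ℂ} (hf : ContDiff ℝ ∞ f) (k : ℕ)
    {K : Set Spacetime} (hK : IsCompact K) :
    ∃ A, 0 ≤ A ∧ ∀ j ≤ k, ∀ z ∈ K, ‖iteratedFDeriv ℝ j f z‖ ≤ A := by
  have h : ∀ j : ℕ, ∃ A, ∀ z ∈ K, ‖iteratedFDeriv ℝ j f z‖ ≤ A := fun j =>
    hK.exists_bound_of_continuousOn
      (hf.continuous_iteratedFDeriv (m := j) (by exact_mod_cast le_top)).continuousOn
  choose A hA using h
  refine ⟨∑ j ∈ Finset.range (k + 1), |A j|, Finset.sum_nonneg fun _ _ => abs_nonneg _,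
    fun j hj z hz => (hA j z hz).trans ((le_abs_self _).trans ?_)⟩
  exact Finset.single_le_sum (f := fun j => |A j|) (fun _ _ => abs_nonneg _)
    (Finset.mem_range.2 (Nat.lt_succ_of_le hj))

/-- A series of smooth functions with locally uniformly summable derivatives. -/
theorem contDiffAt_tsum_of_local {f : ℕ → Spacetime → ℂ} (hf : ∀ n, ContDiff ℝ ∞ (f n))
    (x : Spacetime) {r : ℝ} (hr : 0 < r) (k : ℕ) {v : ℕ → ℝ} (hv : Summable v)
    (h : ∀ n, ∀ j ≤ k, ∀ z ∈ Metric.ball x r, ‖iteratedFDeriv ℝ j (f n) z‖ ≤ v n) :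
    ContDiffAt ℝ k (fun z => ∑' n, f n z) x := by
  -- Multiplication by a bump function turns the local bounds into the global ones that
  -- differentiation of a series asks for, without changing the sum near x.
  let ρ : ContDiffBump x := ⟨r / 4, r / 2, by positivity, by linarith⟩
  let ρ' : Spacetime → ℂ := fun z => (ρ z : ℂ)
  have hρ : ContDiff ℝ ∞ ρ' := Complex.ofRealCLM.contDiff.comp ρ.contDiff
  obtain ⟨A, hA0, hA⟩ := exists_bound_iteratedFDeriv_on_compact hρ k (isCompact_closedBall x (r / 2))
  have hb : ∀ (j n : ℕ) (z : Spacetime), (j : ℕ∞) ≤ (k : ℕ∞) →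
      ‖iteratedFDeriv ℝ j (fun z => ρ' z * f n z) z‖ ≤ 2 ^ k * A * v n := by
    intro j n z hj
    have hj' : j ≤ k := by exact_mod_cast hj
    by_cases hz : z ∈ Metric.closedBall x (r / 2)
    · have hz' : z ∈ Metric.ball x r :=
        Metric.closedBall_subset_ball (by linarith) hz
      exact norm_iteratedFDeriv_mul_le_of_le hρ (hf n) hA0 (fun i hi => hA i hi z hz)
        (fun i hi => h n i hi z hz') j hj'
    · rw [iteratedFDeriv_eq_zero_of_notMem (S := Metric.closedBall x (r / 2))
        Metric.isClosed_closedBall (fun y hy => ?_) j z hz, norm_zero]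
      · have : 0 ≤ v n := (norm_nonneg _).trans (h n 0 (Nat.zero_le _) x (Metric.mem_ball_self hr))
        positivity
      · have : ρ y = 0 := ρ.zero_of_le_dist (by
          rw [Metric.mem_closedBall, not_le] at hy
          exact hy.le)
        simp [ρ', this]
  have hs := contDiff_tsum (N := (k : ℕ∞)) (f := fun n z => ρ' z * f n z)
    (v := fun _ n => 2 ^ k * A * v n)
    (fun n => (hρ.mul (hf n)).of_le (by exact_mod_cast le_top)) (fun _ _ => hv.mul_left _) hb
  have hs' : ContDiff ℝ (k : ℕ) (fun z => ∑' n, ρ' z * f n z) := by exact_mod_cast hs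
  refine hs'.contDiffAt.congr_of_eventuallyEq ?_
  filter_upwards [Metric.closedBall_mem_nhds x (show 0 < r / 4 by positivity)] with z hz
  have : ρ z = 1 := ρ.one_of_mem_closedBall hz
  simp [ρ', this]

/-- The terms of the Volterra series for `(□ + W) u = g` with retarded boundary condition. -/
def volterra (W : Spacetime → ℝ) (g : Spacetime → ℂ) : ℕ → Spacetime → ℂ
  | 0 => retarded g
  | n + 1 => retarded fun z => -(W z : ℂ) * volterra W g n z

section Volterra

variable {S : Set Spacetime} {W : Spacetime → ℝ} {g : Spacetime → ℂ}

theorem contDiff_ofReal_neg (hW : ContDiff ℝ ∞ W) : ContDiff ℝ ∞ fun z => -(W z : ℂ) :=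
  (Complex.ofRealCLM.contDiff.comp hW).neg

theorem volterra_spec (hS : IsFutureSet S) (hW : ContDiff ℝ ∞ W) (hg : ContDiff ℝ ∞ g)
    (hgS : ∀ x ∉ S, g x = 0) (n : ℕ) :
    ContDiff ℝ ∞ (volterra W g n) ∧ ∀ x ∉ S, volterra W g n x = 0 := by
  induction n with
  | zero => exact ⟨hS.contDiff_retarded hgS hg, hS.retarded_eq_zero hgS⟩
  | succ n ih =>
    have h1 : ∀ x ∉ S, -(W x : ℂ) * volterra W g n x = 0 := fun x hx => by rw [ih.2 x hx, mul_zero]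
    exact ⟨hS.contDiff_retarded h1 ((contDiff_ofReal_neg hW).mul ih.1), hS.retarded_eq_zero h1⟩

/-- In the norm weighted by exp(-at), taken over all derivatives up to order k on the causal past of
K, multiplication by W costs a factor C and the propagator gains a⁻². For large a each step is a
contraction. Only values of W on the compact set S ∩ J⁻(K) enter. -/
theorem volterra_bound (hS : IsFutureSet S) (hW : ContDiff ℝ ∞ W) (hg : ContDiff ℝ ∞ g)
    (hgS : ∀ x ∉ S, g x = 0) (k : ℕ) {K : Set Spacetime} (hK : IsCompact K) :
    ∃ a B, 0 < a ∧ 0 ≤ B ∧ ∀ n, ∀ j ≤ k, ∀ z ∈ causalPast K,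
      ‖iteratedFDeriv ℝ j (volterra W g n) z‖ ≤ B * (1 / 2) ^ n * Real.exp (a * z.1) := by
  have hsp := volterra_spec hS hW hg hgS
  obtain ⟨A, hA0, hA⟩ := exists_bound_iteratedFDeriv_on_compact (contDiff_ofReal_neg hW) k
    (hS.pastCompact K hK)
  set C : ℝ := 2 ^ k * A with hC
  have hC0 : 0 ≤ C := by positivity
  -- Chosen so that C/a² ≤ 1/2, which gives the geometric ratio.
  set a : ℝ := 2 * C + 1 with ha
  have ha0 : 0 < a := by positivity
  have hCa : C * (a ^ 2)⁻¹ ≤ 1 / 2 := by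
    rw [← div_eq_mul_inv, div_le_iff₀ (by positivity)]
    nlinarith
  obtain ⟨A', hA'0, hA'⟩ := exists_bound_iteratedFDeriv_on_compact (hsp 0).1 k
    (hS.pastCompact K hK)
  -- A lower bound b for time on the support lets an ordinary bound on the zeroth term be rewritten
  -- as one with the weight exp(a(t - b)) ≥ 1.
  obtain ⟨b, hb⟩ := ((hS.pastCompact K hK).image (continuous_fst)).bddBelow
  set B : ℝ := A' * Real.exp (-(a * b)) with hB
  refine ⟨a, B, ha0, by positivity, fun n => ?_⟩
  induction n with
  | zero =>
    intro j hj z hz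
    by_cases hzS : z ∈ S
    · have hbz : b ≤ z.1 := hb ⟨z, ⟨hzS, hz⟩, rfl⟩
      have h1 : 1 ≤ Real.exp (-(a * b)) * Real.exp (a * z.1) := by
        rw [← Real.exp_add]
        exact Real.one_le_exp (by nlinarith)
      calc _ ≤ A' * 1 := by rw [mul_one]; exact hA' j hj z ⟨hzS, hz⟩
        _ ≤ A' * (Real.exp (-(a * b)) * Real.exp (a * z.1)) := by gcongr
        _ = _ := by rw [hB]; ring
    · rw [iteratedFDeriv_eq_zero_of_notMem hS.isClosed (hsp 0).2 j z hzS, norm_zero]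
      positivity
  | succ n ih =>
    intro j hj z hz
    have h1 : ∀ x ∉ S, -(W x : ℂ) * volterra W g n x = 0 :=
      fun x hx => by rw [(hsp n).2 x hx, mul_zero]
    have h2 : ContDiff ℝ ∞ fun x => -(W x : ℂ) * volterra W g n x :=
      (contDiff_ofReal_neg hW).mul (hsp n).1
    have h3 : ∀ y ∈ causalPast K,
        ‖iteratedFDeriv ℝ j (fun x => -(W x : ℂ) * volterra W g n x) y‖ ≤
          C * (B * (1 / 2) ^ n) * Real.exp (a * y.1) := by
      intro y hy
      by_cases hyS : y ∈ S
      · refine (norm_iteratedFDeriv_mul_le_of_le (contDiff_ofReal_neg hW) (hsp n).1 hA0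
          (fun i hi => hA i hi y ⟨hyS, hy⟩) (fun i hi => ih i hi y hy) j hj).trans (le_of_eq ?_)
        rw [hC]; ring
      · rw [iteratedFDeriv_eq_zero_of_notMem hS.isClosed h1 j y hyS, norm_zero]
        positivity
    show ‖iteratedFDeriv ℝ j (retarded fun x => -(W x : ℂ) * volterra W g n x) z‖ ≤ _
    rw [hS.iteratedFDeriv_retarded h1 h2]
    refine (norm_retarded_le ha0 h3 hz).trans ?_
    calc C * (B * (1 / 2) ^ n) * (a ^ 2)⁻¹ * Real.exp (a * z.1)
        = (C * (a ^ 2)⁻¹) * ((B * (1 / 2) ^ n) * Real.exp (a * z.1)) := by ring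
      _ ≤ (1 / 2) * ((B * (1 / 2) ^ n) * Real.exp (a * z.1)) := by gcongr
      _ = _ := by ring

/-- The sum of the Volterra series. -/
def volterraSum (W : Spacetime → ℝ) (g : Spacetime → ℂ) (x : Spacetime) : ℂ :=
  ∑' n, volterra W g n x

theorem contDiff_volterraSum (hS : IsFutureSet S) (hW : ContDiff ℝ ∞ W) (hg : ContDiff ℝ ∞ g)
    (hgS : ∀ x ∉ S, g x = 0) : ContDiff ℝ ∞ (volterraSum W g) := by
  rw [contDiff_infty]
  intro k
  rw [contDiff_iff_contDiffAt]
  intro x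
  obtain ⟨a, B, ha, hB, h⟩ := volterra_bound hS hW hg hgS k (isCompact_closedBall x 1)
  refine contDiffAt_tsum_of_local (fun n => (volterra_spec hS hW hg hgS n).1) x one_pos k
    (v := fun n => B * (1 / 2) ^ n * Real.exp (a * (x.1 + 1)))
    ((summable_geometric_two.mul_left B).mul_right _) fun n j hj z hz => ?_
  refine (h n j hj z (subset_causalPast _ (Metric.ball_subset_closedBall hz))).trans ?_
  have : z.1 ≤ x.1 + 1 := by
    have h1 := (norm_fst_le (z - x)).trans (mem_ball_iff_norm.1 hz).le
    have := (abs_le.1 (by simpa using h1 : |z.1 - x.1| ≤ 1)).2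
    linarith
  gcongr

/-- The series solves the integral equation by shifting the index. The geometric bounds make the
integrals of the norms summable, which justifies exchanging sum and cone integral. -/
theorem volterraSum_eq (hS : IsFutureSet S) (hW : ContDiff ℝ ∞ W) (hg : ContDiff ℝ ∞ g)
    (hgS : ∀ x ∉ S, g x = 0) (x : Spacetime) :
    volterraSum W g x = retarded (fun z => g z - (W z : ℂ) * volterraSum W g z) x := by
  have hsp := volterra_spec hS hW hg hgS
  obtain ⟨a, B, ha, hB, h⟩ := volterra_bound hS hW hg hgS 0 (isCompact_singleton (x := x))
  have hbd : ∀ n, ∀ z ∈ causalPast {x},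
      ‖volterra W g n z‖ ≤ B * (1 / 2) ^ n * Real.exp (a * z.1) := fun n z hz => by
    simpa using h n 0 le_rfl z hz
  have hsum : ∀ z ∈ causalPast {x}, Summable fun n => volterra W g n z := fun z hz =>
    Summable.of_norm_bounded ((summable_geometric_two.mul_left B).mul_right _)
      fun n => hbd n z hz
  obtain ⟨M, hM0, hM⟩ := exists_bound_iteratedFDeriv_on_compact (contDiff_ofReal_neg hW) 0
    (hS.pastCompact {x} isCompact_singleton)
  have hz1 : ∀ n, ∀ x ∉ S, -(W x : ℂ) * volterra W g n x = 0 :=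
    fun n x hx => by rw [(hsp n).2 x hx, mul_zero]
  have hc1 : ∀ n, Continuous fun x => -(W x : ℂ) * volterra W g n x := fun n =>
    ((contDiff_ofReal_neg hW).mul (hsp n).1).continuous
  have hint : ∀ n, Integrable fun y : Space =>
      coneWeight y • (-(W (x - (‖y‖, y)) : ℂ) * volterra W g n (x - (‖y‖, y))) := fun n =>
    hS.integrable_retarded (hz1 n) (hc1 n) x
  have hle : ∀ n (y : Space),
      ‖coneWeight y • (-(W (x - (‖y‖, y)) : ℂ) * volterra W g n (x - (‖y‖, y)))‖ ≤
      (M * B * Real.exp (a * x.1) * (1 / 2) ^ n) * (coneWeight y * Real.exp (-a * ‖y‖)) := by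
    intro n y
    have hp : x - (‖y‖, y) ∈ causalPast {x} :=
      sub_cone_mem_causalPast (subset_causalPast _ (Set.mem_singleton x)) y
    by_cases hyS : x - (‖y‖, y) ∈ S
    · have h1 : ‖-(W (x - (‖y‖, y)) : ℂ)‖ ≤ M := by simpa using hM 0 le_rfl _ ⟨hyS, hp⟩
      have h2 := hbd n _ hp
      have h3 : a * (x - (‖y‖, y)).1 = a * x.1 + -a * ‖y‖ := by simp; ring
      rw [h3, Real.exp_add] at h2
      rw [norm_smul, Real.norm_of_nonneg (coneWeight_nonneg y), norm_mul]
      calc _ ≤ coneWeight y * (M * (B * (1 / 2) ^ n * (Real.exp (a * x.1) *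
            Real.exp (-a * ‖y‖)))) := by
            have := coneWeight_nonneg y
            gcongr
        _ = _ := by ring
    · rw [hz1 n _ hyS, smul_zero, norm_zero]
      have := coneWeight_nonneg y
      positivity
  have hsi : Summable fun n => ∫ y : Space,
      ‖coneWeight y • (-(W (x - (‖y‖, y)) : ℂ) * volterra W g n (x - (‖y‖, y)))‖ := by
    refine Summable.of_nonneg_of_le (fun n => integral_nonneg fun _ => norm_nonneg _)
      (fun n => integral_mono (hint n).norm ((integrable_coneWeight_exp ha).const_mul _) (hle n)) ?_
    simp only [integral_const_mul]
    exact (summable_geometric_two.mul_left _).mul_right _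
  have hkey := integral_tsum_of_summable_integral_norm hint hsi
  have hsw : ∀ y : Space, ∑' n, coneWeight y •
      (-(W (x - (‖y‖, y)) : ℂ) * volterra W g n (x - (‖y‖, y))) =
      coneWeight y • (-(W (x - (‖y‖, y)) : ℂ) * volterraSum W g (x - (‖y‖, y))) := fun y => by
    rw [tsum_const_smul'', tsum_mul_left]; rfl
  simp only [hsw] at hkey
  have hz : ∀ x ∉ S, -(W x : ℂ) * volterraSum W g x = 0 := fun x hx => by
    simp [volterraSum, (hsp _).2 x hx]
  have hcv := ((contDiff_ofReal_neg hW).mul (contDiff_volterraSum hS hW hg hgS)).continuous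
  have h0 : volterraSum W g x =
      retarded g x + ∑' n, retarded (fun z => -(W z : ℂ) * volterra W g n z) x :=
    (hsum x (subset_causalPast _ (Set.mem_singleton x))).tsum_eq_zero_add
  rw [h0]
  unfold retarded
  rw [hkey, ← integral_add (hS.integrable_retarded hgS hg.continuous x)
    (hS.integrable_retarded hz hcv x)]
  refine integral_congr_ae (ae_of_all _ fun y => ?_)
  simp only [← smul_add]
  congr 1
  ring

/-- Applying the wave operator to the integral equation and using that the retarded propagator
inverts it yields the differential equation. -/
theorem exists_retarded_solution (hS : IsFutureSet S) (hW : ContDiff ℝ ∞ W) (hg : ContDiff ℝ ∞ g)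
    (hgS : ∀ x ∉ S, g x = 0) : ∃ u : Spacetime → ℂ, ContDiff ℝ ∞ u ∧ (∀ x ∉ S, u x = 0) ∧
      ∀ x, box u x + (W x : ℂ) * u x = g x := by
  have hsp := volterra_spec hS hW hg hgS
  have hc := contDiff_volterraSum hS hW hg hgS
  have hz : ∀ x ∉ S, volterraSum W g x = 0 := fun x hx => by
    simp [volterraSum, (hsp _).2 x hx]
  refine ⟨volterraSum W g, hc, hz, fun x => ?_⟩
  have h1 : volterraSum W g = retarded (fun z => g z - (W z : ℂ) * volterraSum W g z) :=
    funext (volterraSum_eq hS hW hg hgS)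
  have h2 : ContDiff ℝ ∞ fun z => g z - (W z : ℂ) * volterraSum W g z :=
    hg.sub ((Complex.ofRealCLM.contDiff.comp hW).mul hc)
  have h3 := box_retarded_eq hS (fun x hx => by rw [hgS x hx, hz x hx]; simp) h2 x
  rw [← h1] at h3
  rw [h3]
  ring

end Volterra

/-! ### The Klein-Gordon operator in terms of directional derivatives -/

theorem hasDerivAt_time {w : Spacetime → ℂ} (hw : Differentiable ℝ w) (s : ℝ) (y : Space) :
    HasDerivAt (fun s : ℝ => w (s, y)) (dirDeriv timeDir w (s, y)) s :=
  (hw (s, y)).hasFDerivAt.comp_hasDerivAt s ((hasDerivAt_id s).prodMk (hasDerivAt_const s y))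

theorem hasFDerivAt_space {w : Spacetime → ℂ} (hw : Differentiable ℝ w) (s : ℝ) (y : Space) :
    HasFDerivAt (fun y : Space => w (s, y))
      ((fderiv ℝ w (s, y)).comp (ContinuousLinearMap.inr ℝ ℝ Space)) y :=
  (hw (s, y)).hasFDerivAt.comp y (hasFDerivAt_prodMk_right s y)

theorem differentiable_of_smooth {w : Spacetime → ℂ} (hw : ContDiff ℝ ∞ w) :
    Differentiable ℝ w := hw.differentiable (by simp)

theorem kleinGordon_eq_box (V : Spacetime → ℝ) {φ : Spacetime → ℂ} (hφ : ContDiff ℝ ∞ φ)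
    (x : Spacetime) : kleinGordon V φ x = box φ x + (V x : ℂ) * φ x := by
  have hd := fun v => differentiable_of_smooth (contDiff_dirDeriv v hφ)
  have h1 : iteratedDeriv 2 (fun s : ℝ => φ (s, x.2)) x.1 =
      dirDeriv timeDir (dirDeriv timeDir φ) x := by
    rw [iteratedDeriv_succ, iteratedDeriv_one,
      funext fun s => (hasDerivAt_time (differentiable_of_smooth hφ) s x.2).deriv]
    exact (hasDerivAt_time (hd timeDir) x.1 x.2).deriv
  have h2 : Laplacian.laplacian (fun y : Space => φ (x.1, y)) x.2 =
      ∑ j, dirDeriv (spaceDir j) (dirDeriv (spaceDir j) φ) x := by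
    have hs : ContDiff ℝ ∞ fun y : Space => φ (x.1, y) := hφ.comp (by fun_prop)
    have hds : Differentiable ℝ (fderiv ℝ fun y : Space => φ (x.1, y)) :=
      (hs.fderiv_right (m := ∞) (by simp)).differentiable (by simp)
    have key : ∀ v : Space, iteratedFDeriv ℝ 2 (fun y : Space => φ (x.1, y)) x.2 ![v, v] =
        dirDeriv (0, v) (dirDeriv (0, v) φ) x := by
      intro v
      have h3 : (fun z => fderiv ℝ (fun y : Space => φ (x.1, y)) z v) =
          fun z => dirDeriv (0, v) φ (x.1, z) := by
        funext z
        rw [(hasFDerivAt_space (differentiable_of_smooth hφ) x.1 z).fderiv]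
        rfl
      have h4 : fderiv ℝ (fun z => fderiv ℝ (fun y : Space => φ (x.1, y)) z v) x.2 v =
          fderiv ℝ (fderiv ℝ fun y : Space => φ (x.1, y)) x.2 v v := by
        rw [fderiv_clm_apply (hds x.2) (differentiableAt_const v)]
        simp
      rw [iteratedFDeriv_two_apply]
      show fderiv ℝ (fderiv ℝ fun y : Space => φ (x.1, y)) x.2 v v = _
      rw [← h4, h3, (hasFDerivAt_space (hd (0, v)) x.1 x.2).fderiv]
      rfl
    have h5 := congrFun (InnerProductSpace.laplacian_eq_iteratedFDeriv_orthonormalBasis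
      (fun y : Space => φ (x.1, y)) (EuclideanSpace.basisFun (Fin 3) ℝ)) x.2
    refine h5.trans (Finset.sum_congr rfl fun j _ => ?_)
    rw [key]
    simp [spaceDir]
  rw [kleinGordon, h1, h2, box]

/-! ### Linearity and symmetries of the wave operator -/

theorem dirDeriv_add {u w : Spacetime → ℂ} (hu : ContDiff ℝ ∞ u) (hw : ContDiff ℝ ∞ w)
    (v : Spacetime) : dirDeriv v (u + w) = dirDeriv v u + dirDeriv v w := by
  funext x
  simp [dirDeriv, fderiv_add (differentiable_of_smooth hu x) (differentiable_of_smooth hw x)]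

theorem box_add {u w : Spacetime → ℂ} (hu : ContDiff ℝ ∞ u) (hw : ContDiff ℝ ∞ w)
    (x : Spacetime) : box (u + w) x = box u x + box w x := by
  simp only [box, dirDeriv_add hu hw, dirDeriv_add (contDiff_dirDeriv _ hu)
    (contDiff_dirDeriv _ hw), Pi.add_apply, Finset.sum_add_distrib]
  ring

theorem dirDeriv_const_mul {u : Spacetime → ℂ} (hu : ContDiff ℝ ∞ u) (c : ℂ)
    (v : Spacetime) : dirDeriv v (fun x => c * u x) = fun x => c * dirDeriv v u x := by
  funext x
  simp [dirDeriv, fderiv_const_mul (differentiable_of_smooth hu x)]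

theorem box_const_mul {u : Spacetime → ℂ} (hu : ContDiff ℝ ∞ u) (c : ℂ)
    (x : Spacetime) : box (fun x => c * u x) x = c * box u x := by
  simp only [box, dirDeriv_const_mul hu, dirDeriv_const_mul (contDiff_dirDeriv _ hu),
    ← Finset.mul_sum]
  ring

theorem box_sub {u w : Spacetime → ℂ} (hu : ContDiff ℝ ∞ u) (hw : ContDiff ℝ ∞ w)
    (x : Spacetime) : box (fun x => u x - w x) x = box u x - box w x := by
  have h : (fun x => u x - w x) = u + fun x => (-1) * w x := by
    funext x; simp [sub_eq_add_neg]
  rw [h, box_add hu (contDiff_const.mul hw), box_const_mul hw]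
  ring

theorem dirDeriv_comp_linear {u : Spacetime → ℂ} (hu : ContDiff ℝ ∞ u)
    (L : Spacetime →L[ℝ] Spacetime) (v : Spacetime) :
    dirDeriv v (fun x => u (L x)) = fun x => dirDeriv (L v) u (L x) := by
  funext x
  have := ((differentiable_of_smooth hu (L x)).hasFDerivAt.comp x L.hasFDerivAt).fderiv
  rw [dirDeriv]
  erw [this]
  rfl

theorem dirDeriv_translate {u : Spacetime → ℂ} (a v : Spacetime) :
    dirDeriv v (fun x => u (x + a)) = fun x => dirDeriv v u (x + a) := by
  funext x
  rw [dirDeriv, fderiv_comp_add_right]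
  rfl

theorem box_translate {u : Spacetime → ℂ} (a x : Spacetime) :
    box (fun x => u (x + a)) x = box u (x + a) := by
  simp only [box, dirDeriv_translate]

/-- Time reflection. -/
def timeReflection : Spacetime →L[ℝ] Spacetime :=
  (-ContinuousLinearMap.fst ℝ ℝ Space).prod (ContinuousLinearMap.snd ℝ ℝ Space)

theorem timeReflection_apply (x : Spacetime) : timeReflection x = (-x.1, x.2) := rfl

theorem timeReflection_timeReflection (x : Spacetime) :
    timeReflection (timeReflection x) = x := by
  simp [timeReflection_apply]

theorem box_timeReflection {u : Spacetime → ℂ} (hu : ContDiff ℝ ∞ u) (x : Spacetime) :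
    box (fun x => u (timeReflection x)) x = box u (timeReflection x) := by
  have ht : timeReflection timeDir = -timeDir := by simp [timeReflection_apply, timeDir]
  have hs : ∀ j, timeReflection (spaceDir j) = spaceDir j := fun j => by
    simp [timeReflection_apply, spaceDir]
  have hn : ∀ w : Spacetime → ℂ, dirDeriv (-timeDir) w = fun x => (-1) * dirDeriv timeDir w x := by
    intro w; funext x; simp [dirDeriv]
  have hd := fun v => contDiff_dirDeriv v hu
  simp only [box, dirDeriv_comp_linear hu, dirDeriv_comp_linear (hd _), ht, hs]
  rw [hn u, hn, dirDeriv_const_mul (hd _)]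
  ring

/-! ### Advanced solutions -/

/-- Time reflection commutes with the wave operator and exchanges future and past, so this is the
reflection of a retarded solution in the reflected potential. -/
theorem exists_advanced_solution {W : Spacetime → ℝ} (hW : ContDiff ℝ ∞ W) {h : Spacetime → ℂ}
    (hh : IsTest h) : ∃ v : Spacetime → ℂ, ContDiff ℝ ∞ v ∧
      (∀ x ∉ causalPast (tsupport h), v x = 0) ∧ ∀ x, box v x + (W x : ℂ) * v x = h x := by
  have hK : IsCompact (timeReflection '' tsupport h) :=
    hh.2.isCompact.image timeReflection.continuous
  have hS := isFutureSet_causalFuture (pastCompact_of_isCompact hK)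
  obtain ⟨u, hu, hu0, hus⟩ := exists_retarded_solution hS
    (hW.comp timeReflection.contDiff) (hh.1.comp timeReflection.contDiff) (fun x hx => by
      have : timeReflection x ∉ tsupport h := fun h' => hx (subset_causalFuture _
        ⟨_, h', timeReflection_timeReflection x⟩)
      exact image_eq_zero_of_notMem_tsupport (f := h) this)
  refine ⟨fun x => u (timeReflection x), hu.comp timeReflection.contDiff, fun x hx => hu0 _ ?_,
    fun x => ?_⟩
  · rintro ⟨y, ⟨z, hz, rfl⟩, hyz⟩
    refine hx ⟨z, hz, ?_⟩
    simp only [timeReflection_apply] at hyz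
    rw [norm_sub_rev]
    linarith
  · have := hus (timeReflection x)
    simp only [Function.comp, timeReflection_timeReflection] at this
    rw [box_timeReflection hu]
    exact this

/-! ### Green's identity -/

instance isAddHaarMeasure_volume_spacetime : (volume : Measure Spacetime).IsAddHaarMeasure :=
  inferInstanceAs ((volume : Measure ℝ).prod (volume : Measure Space)).IsAddHaarMeasure

theorem integrable_mul_of_inter_compact {A B : Set Spacetime} (hAB : IsCompact (A ∩ B))
    {a b : Spacetime → ℂ} (ha : Continuous a) (hb : Continuous b) (haA : ∀ x ∉ A, a x = 0)
    (hbB : ∀ x ∉ B, b x = 0) : Integrable fun x => a x * b x := by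
  refine (ha.mul hb).integrable_of_hasCompactSupport
    (HasCompactSupport.of_support_subset_isCompact hAB fun x hx => ?_)
  by_contra h
  rcases not_and_or.1 h with h | h
  · exact hx (by simp [haA x h])
  · exact hx (by simp [hbB x h])

section Green

variable {A B : Set Spacetime} {a b : Spacetime → ℂ}

theorem integral_mul_dirDeriv (hA : IsClosed A) (hB : IsClosed B) (hAB : IsCompact (A ∩ B))
    (ha : ContDiff ℝ ∞ a) (hb : ContDiff ℝ ∞ b) (haA : ∀ x ∉ A, a x = 0)
    (hbB : ∀ x ∉ B, b x = 0) (v : Spacetime) :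
    ∫ x, a x * dirDeriv v b x = -∫ x, dirDeriv v a x * b x :=
  integral_mul_fderiv_eq_neg_fderiv_mul_of_integrable
    (integrable_mul_of_inter_compact hAB (contDiff_dirDeriv v ha).continuous hb.continuous
      (dirDeriv_eq_zero_of_notMem hA haA v) hbB)
    (integrable_mul_of_inter_compact hAB ha.continuous (contDiff_dirDeriv v hb).continuous
      haA (dirDeriv_eq_zero_of_notMem hB hbB v))
    (integrable_mul_of_inter_compact hAB ha.continuous hb.continuous haA hbB)
    (fun x _ => differentiable_of_smooth ha x) (fun x _ => differentiable_of_smooth hb x)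

theorem integral_mul_dirDeriv_dirDeriv (hA : IsClosed A) (hB : IsClosed B)
    (hAB : IsCompact (A ∩ B))
    (ha : ContDiff ℝ ∞ a) (hb : ContDiff ℝ ∞ b) (haA : ∀ x ∉ A, a x = 0)
    (hbB : ∀ x ∉ B, b x = 0) (v : Spacetime) :
    ∫ x, a x * dirDeriv v (dirDeriv v b) x = ∫ x, dirDeriv v (dirDeriv v a) x * b x := by
  rw [integral_mul_dirDeriv hA hB hAB ha (contDiff_dirDeriv v hb) haA
    (dirDeriv_eq_zero_of_notMem hB hbB v),
    integral_mul_dirDeriv hA hB hAB (contDiff_dirDeriv v ha) hb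
    (dirDeriv_eq_zero_of_notMem hA haA v) hbB, neg_neg]

/-- The wave operator is formally self-adjoint. No boundary terms arise because the two supports
meet in a compact set, as a future set and the past of a compact set do. -/
theorem integral_mul_box (hA : IsClosed A) (hB : IsClosed B) (hAB : IsCompact (A ∩ B))
    (ha : ContDiff ℝ ∞ a) (hb : ContDiff ℝ ∞ b) (haA : ∀ x ∉ A, a x = 0)
    (hbB : ∀ x ∉ B, b x = 0) :
    ∫ x, a x * box b x = ∫ x, box a x * b x := by
  have i1 : ∀ v, Integrable fun x => a x * dirDeriv v (dirDeriv v b) x := fun v =>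
    integrable_mul_of_inter_compact hAB ha.continuous
      (contDiff_dirDeriv v (contDiff_dirDeriv v hb)).continuous haA
      (dirDeriv_eq_zero_of_notMem hB (dirDeriv_eq_zero_of_notMem hB hbB v) v)
  have i2 : ∀ v, Integrable fun x => dirDeriv v (dirDeriv v a) x * b x := fun v =>
    integrable_mul_of_inter_compact hAB
      (contDiff_dirDeriv v (contDiff_dirDeriv v ha)).continuous hb.continuous
      (dirDeriv_eq_zero_of_notMem hA (dirDeriv_eq_zero_of_notMem hA haA v) v) hbB
  simp only [box, mul_sub, sub_mul, Finset.mul_sum, Finset.sum_mul]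
  rw [integral_sub (i1 _) (integrable_finsetSum _ fun j _ => i1 _),
    integral_sub (i2 _) (integrable_finsetSum _ fun j _ => i2 _),
    integral_finsetSum _ fun j _ => i1 _, integral_finsetSum _ fun j _ => i2 _]
  simp only [integral_mul_dirDeriv_dirDeriv hA hB hAB ha hb haA hbB]

theorem integral_mul_box_add (hA : IsClosed A) (hB : IsClosed B) (hAB : IsCompact (A ∩ B))
    (ha : ContDiff ℝ ∞ a) (hb : ContDiff ℝ ∞ b) (haA : ∀ x ∉ A, a x = 0)
    (hbB : ∀ x ∉ B, b x = 0) {W : Spacetime → ℝ} (hW : Continuous W) :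
    ∫ x, a x * (box b x + (W x : ℂ) * b x) = ∫ x, (box a x + (W x : ℂ) * a x) * b x := by
  have hW' : Continuous fun x => (W x : ℂ) := Complex.continuous_ofReal.comp hW
  have i0 : Integrable fun x => (W x : ℂ) * a x * b x :=
    integrable_mul_of_inter_compact hAB (hW'.mul ha.continuous) hb.continuous
      (fun x hx => by rw [haA x hx, mul_zero]) hbB
  have i1 : Integrable fun x => a x * box b x :=
    integrable_mul_of_inter_compact hAB ha.continuous (contDiff_box hb).continuous haA
      (box_eq_zero_of_notMem hB hbB)
  have i2 : Integrable fun x => box a x * b x :=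
    integrable_mul_of_inter_compact hAB (contDiff_box ha).continuous hb.continuous
      (box_eq_zero_of_notMem hA haA) hbB
  have e1 : ∀ x, a x * (box b x + (W x : ℂ) * b x) = a x * box b x + (W x : ℂ) * a x * b x :=
    fun x => by ring
  simp only [e1, add_mul]
  rw [integral_add i1 i0, integral_add i2 i0, integral_mul_box hA hB hAB ha hb haA hbB]

end Green

/-! ### Separation of continuous functions by test functions -/

/-- The fundamental lemma of the calculus of variations gives equality almost everywhere, and
continuity upgrades it to equality on the open set. -/
theorem eqOn_of_integral_mul_test_eq {U : Set Spacetime} (hU : IsOpen U) {a b : Spacetime → ℂ}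
    (ha : Continuous a) (hb : Continuous b)
    (h : ∀ g, IsTest g → tsupport g ⊆ U → ∫ x, a x * g x = ∫ x, b x * g x) :
    Set.EqOn a b U := by
  have hae := hU.ae_eq_zero_of_integral_contDiff_smul_eq_zero (μ := volume)
    (f := fun x => a x - b x) ((ha.sub hb).locallyIntegrable.locallyIntegrableOn U)
    (fun g hg hgc hgU => by
      have ht : IsTest fun x => (g x : ℂ) :=
        ⟨Complex.ofRealCLM.contDiff.comp hg, hgc.comp_left (g := fun r : ℝ => (r : ℂ)) (by simp)⟩
      have hsub : tsupport (fun x => (g x : ℂ)) ⊆ U := by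
        refine subset_trans (closure_mono fun x hx => ?_) hgU
        intro h0
        exact hx (by simp [h0])
      have hi : ∀ c : Spacetime → ℂ, Continuous c → Integrable fun x => c x * (g x : ℂ) :=
        fun c hc => (hc.mul ht.1.continuous).integrable_of_hasCompactSupport ht.2.mul_left
      have e : ∀ x, g x • (a x - b x) = a x * (g x : ℂ) - b x * (g x : ℂ) := fun x => by
        rw [Complex.real_smul]; ring
      simp only [e]
      rw [integral_sub (hi a ha) (hi b hb), h _ ht hsub, sub_self])
  refine Measure.eqOn_open_of_ae_eq (μ := volume) ?_ hU ha.continuousOn hb.continuousOn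
  rw [Filter.EventuallyEq, ae_restrict_iff' hU.measurableSet]
  filter_upwards [hae] with x hx hxU using sub_eq_zero.1 (hx hxU)

theorem eq_of_integral_mul_test_eq {a b : Spacetime → ℂ} (ha : Continuous a) (hb : Continuous b)
    (h : ∀ g, IsTest g → ∫ x, a x * g x = ∫ x, b x * g x) : a = b :=
  funext fun x => eqOn_of_integral_mul_test_eq isOpen_univ ha hb (fun g hg _ => h g hg)
    (Set.mem_univ x)

/-- Uniqueness of solutions that vanish outside of a future set. -/
theorem eq_zero_of_box_add_eq_zero {S : Set Spacetime} (hS : IsFutureSet S) {W : Spacetime → ℝ}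
    (hW : ContDiff ℝ ∞ W) {d : Spacetime → ℂ} (hd : ContDiff ℝ ∞ d) (hdS : ∀ x ∉ S, d x = 0)
    (hbox : ∀ x, box d x + (W x : ℂ) * d x = 0) : d = 0 := by
  refine eq_of_integral_mul_test_eq hd.continuous continuous_zero fun h hh => ?_
  -- Uniqueness by duality: writing the test function as the image of an advanced solution moves the
  -- operator onto d, where it gives zero.
  obtain ⟨v, hv, hv0, hvs⟩ := exists_advanced_solution hW hh
  have := integral_mul_box_add hS.isClosed (isClosed_causalPast hh.2.isCompact)
    (hS.pastCompact _ hh.2.isCompact) hd hv hdS hv0 hW.continuous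
  simp only [hvs, hbox, zero_mul, integral_zero] at this
  simpa using this

/-! ### The Møller maps -/

theorem IsFutureSet.union {S T : Set Spacetime} (hS : IsFutureSet S) (hT : IsFutureSet T) :
    IsFutureSet (S ∪ T) where
  isClosed := hS.isClosed.union hT.isClosed
  pastCompact := fun K hK => by
    rw [Set.union_inter_distrib_right]
    exact (hS.pastCompact K hK).union (hT.pastCompact K hK)
  future := by
    rintro x ⟨y, hy | hy, hxy⟩
    · exact Or.inl (hS.future ⟨y, hy, hxy⟩)
    · exact Or.inr (hT.future ⟨y, hy, hxy⟩)

/-- Cutoff functions for which the Møller maps are defined. -/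
structure IsCutoff (f : Spacetime → ℝ) : Prop where
  smooth : ContDiff ℝ ∞ f
  pastCompact : PastCompact (tsupport f)

section Moller

variable {m₁ m₂ : ℝ} {f : Spacetime → ℝ}

theorem contDiff_massChange (hf : IsCutoff f) : ContDiff ℝ ∞ (massChange m₁ m₂ f) :=
  contDiff_const.mul hf.smooth

theorem contDiff_potential (hf : IsCutoff f) :
    ContDiff ℝ ∞ fun y => m₁ ^ 2 + massChange m₁ m₂ f y :=
  contDiff_const.add (contDiff_massChange hf)

theorem tsupport_massChange_subset : tsupport (massChange m₁ m₂ f) ⊆ tsupport f :=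
  closure_mono fun x hx h => hx (by simp [massChange, h])

theorem isFutureSet_massChange (hf : IsCutoff f) :
    IsFutureSet (causalFuture (tsupport (massChange m₁ m₂ f))) :=
  isFutureSet_causalFuture (hf.pastCompact.mono (isClosed_tsupport _) tsupport_massChange_subset)

theorem massChange_eq_zero {x : Spacetime} (hx : x ∉ causalFuture (tsupport (massChange m₁ m₂ f))) :
    massChange m₁ m₂ f x = 0 :=
  image_eq_zero_of_notMem_tsupport fun h => hx (subset_causalFuture _ h)

theorem eq_of_kleinGordon_eq (hf : IsCutoff f) {S : Set Spacetime} (hS : IsFutureSet S)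
    {ψ ψ' : Spacetime → ℂ} (hψ : IsSmooth ψ) (hψ' : IsSmooth ψ')
    (h : ∀ x, kleinGordon (fun y => m₁ ^ 2 + massChange m₁ m₂ f y) ψ x =
      kleinGordon (fun y => m₁ ^ 2 + massChange m₁ m₂ f y) ψ' x)
    (hS' : ∀ x ∉ S, ψ x = ψ' x) : ψ = ψ' := by
  have := eq_zero_of_box_add_eq_zero hS (contDiff_potential (m₁ := m₁) (m₂ := m₂) hf)
    (d := fun x => ψ x - ψ' x) (hψ.sub hψ') (fun x hx => sub_eq_zero.2 (hS' x hx)) (fun x => by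
      have hx := h x
      rw [kleinGordon_eq_box _ hψ, kleinGordon_eq_box _ hψ'] at hx
      rw [box_sub hψ hψ']
      linear_combination hx)
  funext x
  exact sub_eq_zero.1 (congrFun this x)

/-- With V the mass change, φ is corrected by the retarded solution of (P₁ + V)u = -Vφ. Its source
is supported where V is, so the correction vanishes off the causal future of that set. -/
theorem exists_isMollerImage (hf : IsCutoff f) {φ : Spacetime → ℂ} (hφ : IsSmooth φ) :
    ∃ ψ, IsMollerImage m₁ m₂ f φ ψ := by
  have hV := contDiff_massChange (m₁ := m₁) (m₂ := m₂) hf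
  have hW := contDiff_potential (m₁ := m₁) (m₂ := m₂) hf
  obtain ⟨u, hu, hu0, hus⟩ := exists_retarded_solution
    (isFutureSet_massChange (m₁ := m₁) (m₂ := m₂) hf) hW
    (g := fun x => -(massChange m₁ m₂ f x : ℂ) * φ x)
    ((contDiff_ofReal_neg hV).mul hφ) (fun x hx => by simp [massChange_eq_zero hx])
  refine ⟨φ + u, hφ.add hu, fun x => ?_, fun x hx => by simp [hu0 x hx]⟩
  rw [kleinGordon_eq_box (φ := φ + u) _ (hφ.add hu), kleinGordon_eq_box _ hφ, box_add hφ hu, Pi.add_apply]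
  have := hus x
  push_cast at this ⊢
  linear_combination this

theorem IsMollerImage.eq (hf : IsCutoff f) {φ ψ ψ' : Spacetime → ℂ}
    (h : IsMollerImage m₁ m₂ f φ ψ) (h' : IsMollerImage m₁ m₂ f φ ψ') : ψ = ψ' :=
  eq_of_kleinGordon_eq hf (isFutureSet_massChange (m₁ := m₁) (m₂ := m₂) hf) h.1 h'.1
    (fun x => (h.2.1 x).trans (h'.2.1 x).symm) fun x hx => (h.2.2 x hx).trans (h'.2.2 x hx).symm

theorem isMollerImage_moller (hf : IsCutoff f) {φ : Spacetime → ℂ} (hφ : IsSmooth φ) :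
    IsMollerImage m₁ m₂ f φ (moller m₁ m₂ f φ) := by
  have H := exists_isMollerImage (m₁ := m₁) (m₂ := m₂) hf hφ
  rw [moller, dif_pos H]
  exact H.choose_spec

/-- The Møller map is determined by the field equation and by the values off any future set. -/
theorem moller_eq_of_eq_off (hf : IsCutoff f) {S : Set Spacetime} (hS : IsFutureSet S)
    {φ ψ : Spacetime → ℂ} (hφ : IsSmooth φ) (hψ : IsSmooth ψ)
    (h : ∀ x, kleinGordon (fun y => m₁ ^ 2 + massChange m₁ m₂ f y) ψ x =
      kleinGordon (fun _ => m₁ ^ 2) φ x) (hS' : ∀ x ∉ S, ψ x = φ x) :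
    moller m₁ m₂ f φ = ψ := by
  have hm := isMollerImage_moller (m₁ := m₁) (m₂ := m₂) hf hφ
  -- The two candidates agree off the union of both future sets, which is again a future set. This
  -- allows a half-space to stand in for the causal future of the support.
  refine eq_of_kleinGordon_eq hf (hS.union (isFutureSet_massChange (m₁ := m₁) (m₂ := m₂) hf))
    hm.1 hψ (fun x => (hm.2.1 x).trans (h x).symm) fun x hx => ?_
  rw [hm.2.2 x fun h => hx (Or.inr h), hS' x fun h => hx (Or.inl h)]

/-- `v` is the advanced solution with source `h` in the potential given by `f`. -/
structure IsAdvanced (m₁ m₂ : ℝ) (f : Spacetime → ℝ) (h v : Spacetime → ℂ) : Prop where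
  smooth : IsSmooth v
  eq_zero : ∀ x ∉ causalPast (tsupport h), v x = 0
  eqn : ∀ x, box v x + ((m₁ ^ 2 + massChange m₁ m₂ f x : ℝ) : ℂ) * v x = h x

theorem exists_isAdvanced (m₁ m₂ : ℝ) (hf : IsCutoff f) {h : Spacetime → ℂ} (hh : IsTest h) :
    ∃ v, IsAdvanced m₁ m₂ f h v :=
  let ⟨v, hv, hv0, hvs⟩ := exists_advanced_solution (contDiff_potential hf) hh
  ⟨v, hv, hv0, hvs⟩

/-- The mass change has past-compact support and v lives on the causal past of a compact set, so
their product is compactly supported. -/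
theorem isTest_sub_advanced (hf : IsCutoff f) {h v : Spacetime → ℂ} (hh : IsTest h)
    (hv : IsAdvanced m₁ m₂ f h v) : IsTest fun x => h x - (massChange m₁ m₂ f x : ℂ) * v x := by
  have hV := contDiff_massChange (m₁ := m₁) (m₂ := m₂) hf
  refine ⟨hh.1.sub ((Complex.ofRealCLM.contDiff.comp hV).mul hv.smooth), ?_⟩
  have hc := hf.pastCompact.mono (isClosed_tsupport _)
    (tsupport_massChange_subset (m₁ := m₁) (m₂ := m₂)) _ hh.2.isCompact
  refine HasCompactSupport.of_support_subset_isCompact (hh.2.isCompact.union hc) fun x hx => ?_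
  by_contra hx'
  simp only [Set.mem_union, not_or] at hx'
  refine hx ?_
  have h1 : h x = 0 := image_eq_zero_of_notMem_tsupport hx'.1
  rcases not_and_or.1 hx'.2 with h2 | h2
  · simp [h1, image_eq_zero_of_notMem_tsupport h2]
  · simp [h1, hv.eq_zero x h2]

theorem IsTest.integrable_mul {h : Spacetime → ℂ} (hh : IsTest h) {c : Spacetime → ℂ}
    (hc : Continuous c) : Integrable fun x => c x * h x :=
  (hc.mul hh.1.continuous).integrable_of_hasCompactSupport hh.2.mul_left

/-- With ψ = Rφ and V the mass change, (P₁ + V)(ψ - φ) = -Vφ. Green's identity between ψ - φ and the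
advanced solution v then gives ∫ (ψ - φ)h = -∫ φVv, which exhibits the adjoint as h - Vv. -/
theorem integral_moller_mul (hf : IsCutoff f) {φ h v : Spacetime → ℂ} (hφ : IsSmooth φ)
    (hh : IsTest h) (hv : IsAdvanced m₁ m₂ f h v) :
    ∫ x, moller m₁ m₂ f φ x * h x =
      ∫ x, φ x * (h x - (massChange m₁ m₂ f x : ℂ) * v x) := by
  have hm := isMollerImage_moller (m₁ := m₁) (m₂ := m₂) hf hφ
  set ψ := moller m₁ m₂ f φ
  have hS := isFutureSet_massChange (m₁ := m₁) (m₂ := m₂) hf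
  have hG := integral_mul_box_add hS.isClosed (isClosed_causalPast hh.2.isCompact)
    (hS.pastCompact _ hh.2.isCompact) (a := fun x => ψ x - φ x) (hm.1.sub hφ) hv.smooth
    (fun x hx => sub_eq_zero.2 (hm.2.2 x hx)) hv.eq_zero
    (contDiff_potential (m₁ := m₁) (m₂ := m₂) hf).continuous
  have e : ∀ x, (box (fun x => ψ x - φ x) x +
      ((m₁ ^ 2 + massChange m₁ m₂ f x : ℝ) : ℂ) * (ψ x - φ x)) * v x =
      φ x * (h x - (massChange m₁ m₂ f x : ℂ) * v x) - φ x * h x := by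
    intro x
    have hx := hm.2.1 x
    rw [kleinGordon_eq_box _ hm.1, kleinGordon_eq_box _ hφ] at hx
    rw [box_sub hm.1 hφ]
    push_cast at hx ⊢
    linear_combination v x * hx
  simp only [hv.eqn, e, sub_mul] at hG
  have i1 := hh.integrable_mul hm.1.continuous
  have i2 := hh.integrable_mul hφ.continuous
  have i3 := (isTest_sub_advanced hf hh hv).integrable_mul hφ.continuous
  rw [integral_sub i1 i2, integral_sub i3 i2] at hG
  exact sub_left_injective hG

theorem isMollerAdjointImage_advanced (hf : IsCutoff f) {h v : Spacetime → ℂ}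
    (hh : IsTest h) (hv : IsAdvanced m₁ m₂ f h v) :
    IsMollerAdjointImage m₁ m₂ f h fun x => h x - (massChange m₁ m₂ f x : ℂ) * v x :=
  ⟨isTest_sub_advanced hf hh hv, fun _ hφ => integral_moller_mul hf hφ hh hv⟩

theorem IsMollerAdjointImage.eq {h h' h'' : Spacetime → ℂ}
    (H' : IsMollerAdjointImage m₁ m₂ f h h') (H'' : IsMollerAdjointImage m₁ m₂ f h h'') :
    h' = h'' := by
  refine eq_of_integral_mul_test_eq H'.1.1.continuous H''.1.1.continuous fun g hg => ?_
  simp only [mul_comm _ (g _)]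
  exact (H'.2 g hg.1).symm.trans (H''.2 g hg.1)

theorem isMollerAdjointImage_mollerAdjoint (hf : IsCutoff f) {h : Spacetime → ℂ}
    (hh : IsTest h) : IsMollerAdjointImage m₁ m₂ f h (mollerAdjoint m₁ m₂ f h) := by
  obtain ⟨v, hv⟩ := exists_isAdvanced m₁ m₂ hf hh
  have H : ∃ h', IsMollerAdjointImage m₁ m₂ f h h' := ⟨_, isMollerAdjointImage_advanced hf hh hv⟩
  rw [mollerAdjoint, dif_pos H]
  exact H.choose_spec

theorem integral_moller_mul_eq (hf : IsCutoff f) {φ h : Spacetime → ℂ} (hφ : IsSmooth φ)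
    (hh : IsTest h) : ∫ x, moller m₁ m₂ f φ x * h x = ∫ x, φ x * mollerAdjoint m₁ m₂ f h x :=
  (isMollerAdjointImage_mollerAdjoint hf hh).2 φ hφ

theorem isTest_mollerAdjoint (hf : IsCutoff f) {h : Spacetime → ℂ}
    (hh : IsTest h) : IsTest (mollerAdjoint m₁ m₂ f h) :=
  (isMollerAdjointImage_mollerAdjoint hf hh).1

/-! ### Locality -/

/-- The advanced solution for f is supported in the causal past of supp h, where f and f' agree. It
is therefore also the advanced solution for f', and the formula h - Vv gives the same function. -/
theorem mollerAdjoint_congr {f' : Spacetime → ℝ} (hf : IsCutoff f) (hf' : IsCutoff f')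
    {K : Set Spacetime} (hff : ∀ x ∈ causalPast K, f x = f' x) {h : Spacetime → ℂ}
    (hh : IsTest h) (hK : tsupport h ⊆ K) :
    mollerAdjoint m₁ m₂ f h = mollerAdjoint m₁ m₂ f' h := by
  obtain ⟨v, hv⟩ := exists_isAdvanced m₁ m₂ hf hh
  have hmv : ∀ x, (massChange m₁ m₂ f x : ℂ) * v x = (massChange m₁ m₂ f' x : ℂ) * v x := by
    intro x
    by_cases hx : x ∈ causalPast (tsupport h)
    · simp [massChange, hff x (causalPast_mono hK hx)]
    · simp [hv.eq_zero x hx]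
  have hv' : IsAdvanced m₁ m₂ f' h v := ⟨hv.smooth, hv.eq_zero, fun x => by
    rw [← hv.eqn x]
    push_cast
    linear_combination -hmv x⟩
  rw [(isMollerAdjointImage_mollerAdjoint hf hh).eq (isMollerAdjointImage_advanced hf hh hv),
    (isMollerAdjointImage_mollerAdjoint hf' hh).eq (isMollerAdjointImage_advanced hf' hh hv')]
  funext x
  rw [hmv]

/-- Locality of the adjoint transfers by duality: tested against functions supported in the interior
of K, both Møller images give the same numbers. -/
theorem moller_congr {f' : Spacetime → ℝ} (hf : IsCutoff f) (hf' : IsCutoff f')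
    {K : Set Spacetime} (hff : ∀ x ∈ causalPast K, f x = f' x) {φ : Spacetime → ℂ}
    (hφ : IsSmooth φ) {x : Spacetime} (hx : x ∈ interior K) :
    moller m₁ m₂ f φ x = moller m₁ m₂ f' φ x :=
  eqOn_of_integral_mul_test_eq isOpen_interior (isMollerImage_moller hf hφ).1.continuous
    (isMollerImage_moller hf' hφ).1.continuous (fun g hg hgK => by
      rw [integral_moller_mul_eq hf hφ hg, integral_moller_mul_eq hf' hφ hg,
        mollerAdjoint_congr hf hf' hff hg (hgK.trans interior_subset)]) hx

theorem moller_zero (hf : IsCutoff f) : moller m₁ m₂ f 0 = 0 := by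
  refine moller_eq_of_eq_off hf (isFutureSet_massChange (m₁ := m₁) (m₂ := m₂) hf)
    contDiff_const contDiff_const (fun x => ?_) fun x _ => rfl
  rw [kleinGordon_eq_box (φ := 0) _ contDiff_const, kleinGordon_eq_box (φ := 0) _ contDiff_const]
  simp

theorem mollerAdjoint_zero (hf : IsCutoff f) : mollerAdjoint m₁ m₂ f 0 = 0 := by
  have h0 : IsTest (0 : Spacetime → ℂ) := ⟨contDiff_const, HasCompactSupport.zero⟩
  refine (isMollerAdjointImage_mollerAdjoint hf h0).eq ⟨h0, fun φ _ => ?_⟩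
  simp

end Moller

/-! ### Plane waves -/

/-- The plane wave `exp (i (σ t + 𝐤 · 𝐱))`. -/
def planeWave (σ : ℝ) (k : Space) (x : Spacetime) : ℂ :=
  Complex.exp (Complex.I * ((σ * x.1 + inner ℝ k x.2 : ℝ) : ℂ))

theorem contDiff_planeWave (σ : ℝ) (k : Space) : ContDiff ℝ ∞ (planeWave σ k) := by
  have h : ContDiff ℝ ∞ fun x : Spacetime => σ * x.1 + inner ℝ k x.2 :=
    (contDiff_const.mul contDiff_fst).add (contDiff_const.inner ℝ contDiff_snd)
  exact (contDiff_const.mul (Complex.ofRealCLM.contDiff.comp h)).cexp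

theorem norm_planeWave (σ : ℝ) (k : Space) (x : Spacetime) : ‖planeWave σ k x‖ = 1 := by
  rw [planeWave, mul_comm, Complex.norm_exp_ofReal_mul_I]

theorem dirDeriv_planeWave (σ : ℝ) (k : Space) (v : Spacetime) :
    dirDeriv v (planeWave σ k) =
      fun x => Complex.I * ((σ * v.1 + inner ℝ k v.2 : ℝ) : ℂ) * planeWave σ k x := by
  funext x
  have h1 : HasFDerivAt (fun x : Spacetime => σ * x.1 + inner ℝ k x.2)
      (σ • ContinuousLinearMap.fst ℝ ℝ Space +
        (innerSL ℝ k).comp (ContinuousLinearMap.snd ℝ ℝ Space)) x := by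
    exact (σ • ContinuousLinearMap.fst ℝ ℝ Space +
        (innerSL ℝ k).comp (ContinuousLinearMap.snd ℝ ℝ Space)).hasFDerivAt
  have h2 := ((Complex.ofRealCLM.hasFDerivAt.comp x h1).const_mul Complex.I).cexp
  rw [dirDeriv]
  erw [h2.fderiv]
  simp [planeWave]
  ring

theorem inner_single_one (k : Space) (j : Fin 3) :
    inner ℝ k (EuclideanSpace.single j (1 : ℝ)) = k j := by
  simp [EuclideanSpace.inner_single_right]

theorem dirDeriv_spaceDir_planeWave (σ : ℝ) (k : Space) (j : Fin 3) :
    dirDeriv (spaceDir j) (planeWave σ k) = fun x => Complex.I * (k j : ℂ) * planeWave σ k x := by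
  rw [dirDeriv_planeWave]
  simp [spaceDir, inner_single_one]

theorem dirDeriv_timeDir_planeWave (σ : ℝ) (k : Space) :
    dirDeriv timeDir (planeWave σ k) = fun x => Complex.I * (σ : ℂ) * planeWave σ k x := by
  rw [dirDeriv_planeWave]
  simp [timeDir]

theorem conj_planeWave (σ : ℝ) (k : Space) (x : Spacetime) :
    (starRingEnd ℂ) (planeWave σ k x) =
      Complex.exp (-(Complex.I * ((σ * x.1 + inner ℝ k x.2 : ℝ) : ℂ))) := by
  rw [planeWave, ← Complex.exp_conj]
  simp

theorem conj_planeWave_eq (σ : ℝ) (k : Space) (x : Spacetime) :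
    (starRingEnd ℂ) (planeWave σ k x) = planeWave (-σ) (-k) x := by
  rw [conj_planeWave, planeWave]
  congr 1
  simp
  ring

theorem continuous_energy (m : ℝ) : Continuous (energy m) := by unfold energy; fun_prop

theorem norm_le_energy (m : ℝ) (k : Space) : ‖k‖ ≤ energy m k :=
  Real.le_sqrt_of_sq_le (by nlinarith [sq_nonneg m])

theorem energy_nonneg (m : ℝ) (k : Space) : 0 ≤ energy m k := Real.sqrt_nonneg _

theorem energy_pos (m : ℝ) {k : Space} (hk : k ≠ 0) : 0 < energy m k :=
  (norm_pos_iff.2 hk).trans_le (norm_le_energy m k)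

theorem sq_energy (m : ℝ) (k : Space) : energy m k ^ 2 = ‖k‖ ^ 2 + m ^ 2 :=
  Real.sq_sqrt (by positivity)

theorem energy_le (m : ℝ) (k : Space) : energy m k ≤ ‖k‖ + |m| :=
  Real.sqrt_le_iff.2 ⟨by positivity, by
    have := sq_abs m
    nlinarith [norm_nonneg k, abs_nonneg m, mul_nonneg (norm_nonneg k) (abs_nonneg m)]⟩

/-! ### Decay in momentum -/

/-- The operator `1 - ∇²` in the spatial variables. -/
def oneSubLaplacian (h : Spacetime → ℂ) (x : Spacetime) : ℂ :=
  h x - ∑ j, dirDeriv (spaceDir j) (dirDeriv (spaceDir j) h) x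

theorem isTest_dirDeriv {h : Spacetime → ℂ} (hh : IsTest h) (v : Spacetime) :
    IsTest (dirDeriv v h) :=
  ⟨contDiff_dirDeriv v hh.1, HasCompactSupport.of_support_subset_isCompact hh.2.isCompact
    fun x hx => by
      by_contra hx'
      exact hx (dirDeriv_eq_zero_of_notMem (isClosed_tsupport h)
        (fun _ => image_eq_zero_of_notMem_tsupport) v x hx')⟩

theorem isTest_oneSubLaplacian {h : Spacetime → ℂ} (hh : IsTest h) : IsTest (oneSubLaplacian h) :=
  ⟨hh.1.sub (ContDiff.sum fun _ _ => contDiff_dirDeriv _ (contDiff_dirDeriv _ hh.1)),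
    HasCompactSupport.of_support_subset_isCompact hh.2.isCompact fun x hx => by
      by_contra hx'
      have h0 : ∀ y ∉ tsupport h, h y = 0 := fun _ => image_eq_zero_of_notMem_tsupport
      have hc := isClosed_tsupport h
      refine hx ?_
      simp [oneSubLaplacian, h0 x hx', fun v => dirDeriv_eq_zero_of_notMem hc
        (dirDeriv_eq_zero_of_notMem hc h0 v) v x hx']⟩

theorem IsTest.integral_mul_dirDeriv_dirDeriv {c h : Spacetime → ℂ} (hc : ContDiff ℝ ∞ c)
    (hh : IsTest h) (v : Spacetime) :
    ∫ x, c x * dirDeriv v (dirDeriv v h) x = ∫ x, dirDeriv v (dirDeriv v c) x * h x :=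
  AdiabaticVacuum.integral_mul_dirDeriv_dirDeriv isClosed_univ (isClosed_tsupport h)
    (by simpa using hh.2.isCompact) hc hh.1 (fun x hx => (hx (Set.mem_univ x)).elim)
    (fun _ => image_eq_zero_of_notMem_tsupport) v

/-- Functions that oscillate in space with wave vector `κ`. -/
def IsSpaceWave (κ : Space) (c : Spacetime → ℂ) : Prop :=
  ContDiff ℝ ∞ c ∧ ∀ j, dirDeriv (spaceDir j) c = fun x => Complex.I * (κ j : ℂ) * c x

theorem isSpaceWave_planeWave (σ : ℝ) (k : Space) : IsSpaceWave k (planeWave σ k) :=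
  ⟨contDiff_planeWave σ k, dirDeriv_spaceDir_planeWave σ k⟩

/-- Two integrations by parts move 1 - ∇² onto c, of which it is an eigenoperator with eigenvalue 1
+ |κ|². -/
theorem IsSpaceWave.integral_mul_oneSubLaplacian {κ : Space} {c : Spacetime → ℂ}
    (hc : IsSpaceWave κ c) {h : Spacetime → ℂ} (hh : IsTest h) :
    ∫ x, c x * oneSubLaplacian h x = ((1 + ‖κ‖ ^ 2 : ℝ) : ℂ) * ∫ x, c x * h x := by
  have hi := hh.integrable_mul hc.1.continuous
  have hij : ∀ j, Integrable fun x =>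
      c x * dirDeriv (spaceDir j) (dirDeriv (spaceDir j) h) x := fun j =>
    (isTest_dirDeriv (isTest_dirDeriv hh _) _).integrable_mul hc.1.continuous
  have hj : ∀ j, ∫ x, c x * dirDeriv (spaceDir j) (dirDeriv (spaceDir j) h) x =
      -((κ j : ℂ) ^ 2 * ∫ x, c x * h x) := by
    intro j
    rw [IsTest.integral_mul_dirDeriv_dirDeriv hc.1 hh, hc.2 j, dirDeriv_const_mul hc.1, hc.2 j,
      ← integral_const_mul, ← integral_neg]
    refine integral_congr_ae (ae_of_all _ fun x => ?_)
    simp only []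
    linear_combination (κ j : ℂ) ^ 2 * c x * h x * Complex.I_sq
  simp only [oneSubLaplacian, mul_sub, Finset.mul_sum]
  rw [integral_sub hi (integrable_finsetSum _ fun j _ => hij j),
    integral_finsetSum _ fun j _ => hij j]
  simp only [hj]
  rw [Finset.sum_neg_distrib, ← Finset.sum_mul, EuclideanSpace.real_norm_sq_eq]
  push_cast
  ring

theorem IsSpaceWave.integral_mul_iterate {κ : Space} {c : Spacetime → ℂ}
    (hc : IsSpaceWave κ c) (N : ℕ) {h : Spacetime → ℂ} (hh : IsTest h) :
    ∫ x, c x * oneSubLaplacian^[N] h x = ((1 + ‖κ‖ ^ 2 : ℝ) : ℂ) ^ N * ∫ x, c x * h x := by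
  induction N generalizing h with
  | zero => simp
  | succ N ih =>
    rw [Function.iterate_succ_apply, ih (isTest_oneSubLaplacian hh),
      hc.integral_mul_oneSubLaplacian hh]
    ring

theorem isTest_iterate_oneSubLaplacian {h : Spacetime → ℂ} (hh : IsTest h) (N : ℕ) :
    IsTest (oneSubLaplacian^[N] h) := by
  induction N generalizing h with
  | zero => exact hh
  | succ N ih => exact ih (isTest_oneSubLaplacian hh)

theorem IsTest.integrable {h : Spacetime → ℂ} (hh : IsTest h) : Integrable h :=
  hh.1.continuous.integrable_of_hasCompactSupport hh.2

/-- Decay in momentum uses spatial oscillation only. It thus applies to the Møller transformed modes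
as well as to plane waves, with no information on their time dependence beyond a sup bound. -/
theorem IsSpaceWave.norm_integral_le {κ : Space} {c : Spacetime → ℂ} (hc : IsSpaceWave κ c)
    {C : ℝ} (hC : ∀ x, ‖c x‖ ≤ C) (N : ℕ) {h : Spacetime → ℂ} (hh : IsTest h) :
    ‖∫ x, c x * h x‖ ≤ C * (∫ x, ‖oneSubLaplacian^[N] h x‖) * (1 + ‖κ‖ ^ 2)⁻¹ ^ N := by
  have hp : (0 : ℝ) < 1 + ‖κ‖ ^ 2 := by positivity
  have h1 : (1 + ‖κ‖ ^ 2) ^ N * ‖∫ x, c x * h x‖ ≤ C * ∫ x, ‖oneSubLaplacian^[N] h x‖ := by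
    have := congrArg norm (hc.integral_mul_iterate N hh)
    rw [norm_mul, norm_pow, Complex.norm_real, Real.norm_of_nonneg hp.le] at this
    rw [← this, ← integral_const_mul]
    refine norm_integral_le_of_norm_le
      ((isTest_iterate_oneSubLaplacian hh N).integrable.norm.const_mul C) (ae_of_all _ fun x => ?_)
    rw [norm_mul]
    gcongr
    exact hC x
  rw [inv_pow, ← div_eq_mul_inv, le_div_iff₀ (by positivity)]
  linarith

theorem integrable_inv_norm_mul_decay :
    Integrable fun k : Space => ‖k‖⁻¹ * (1 + ‖k‖ ^ 2)⁻¹ ^ 2 := by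
  refine (integrable_radial_iff (g := fun r => r⁻¹ * (1 + r ^ 2)⁻¹ ^ 2)).2 ?_
  refine (integrable_inv_one_add_sq.integrableOn (s := Set.Ioi 0)).mono'
    (by fun_prop) ?_
  filter_upwards [self_mem_ae_restrict measurableSet_Ioi] with r hr
  have hr' : (0 : ℝ) < r := hr
  rw [smul_eq_mul, Real.norm_of_nonneg (by positivity),
    show r ^ 2 * (r⁻¹ * (1 + r ^ 2)⁻¹ ^ 2) = (r * (1 + r ^ 2)⁻¹) * (1 + r ^ 2)⁻¹ by field_simp]
  refine mul_le_of_le_one_left (by positivity) ?_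
  rw [← div_eq_mul_inv, div_le_one (by positivity)]
  nlinarith [sq_nonneg (r - 1)]

theorem integrable_inv_norm_sq_mul_decay :
    Integrable fun k : Space => ‖k‖⁻¹ ^ 2 * (1 + ‖k‖ ^ 2)⁻¹ ^ 2 := by
  refine (integrable_radial_iff (g := fun r => r⁻¹ ^ 2 * (1 + r ^ 2)⁻¹ ^ 2)).2 ?_
  refine (integrable_inv_one_add_sq.integrableOn (s := Set.Ioi 0)).mono'
    (by fun_prop) ?_
  filter_upwards [self_mem_ae_restrict measurableSet_Ioi] with r hr
  have hr' : (0 : ℝ) < r := hr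
  rw [smul_eq_mul, Real.norm_of_nonneg (by positivity),
    show r ^ 2 * (r⁻¹ ^ 2 * (1 + r ^ 2)⁻¹ ^ 2) = (1 + r ^ 2)⁻¹ * (1 + r ^ 2)⁻¹ by field_simp]
  refine mul_le_of_le_one_left (by positivity) (inv_le_one_of_one_le₀ ?_)
  nlinarith [sq_nonneg r]

/-! ### The vacuum two-point operator -/

/-- The Fourier transform of `h` on the negative mass shell. -/
def amplitude (m : ℝ) (h : Spacetime → ℂ) (k : Space) : ℂ :=
  ∫ y, (starRingEnd ℂ) (planeWave (energy m k) k y) * h y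

theorem vacuumOp_eq (m : ℝ) (h : Spacetime → ℂ) (x : Spacetime) :
    vacuumOp m h x = ((2 * Real.pi : ℝ) : ℂ)⁻¹ ^ 3 * ∫ k : Space,
      ((2 * energy m k : ℝ) : ℂ)⁻¹ * planeWave (energy m k) k x * amplitude m h k := by
  simp only [vacuumOp, amplitude, conj_planeWave]
  rfl

theorem continuous_planeWave_energy (m : ℝ) (y : Spacetime) :
    Continuous fun k : Space => planeWave (energy m k) k y := by
  have := continuous_energy m
  unfold planeWave
  fun_prop

theorem continuous_amplitude (m : ℝ) {h : Spacetime → ℂ} (hh : IsTest h) :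
    Continuous (amplitude m h) := by
  refine continuous_of_dominated (bound := fun y => ‖h y‖) (fun k => ?_)
    (fun k => ae_of_all _ fun y => ?_) hh.integrable.norm (ae_of_all _ fun y => ?_)
  · exact ((Complex.continuous_conj.comp (contDiff_planeWave _ k).continuous).mul
      hh.1.continuous).aestronglyMeasurable
  · rw [norm_mul, RCLike.norm_conj, norm_planeWave, one_mul]
  · exact (Complex.continuous_conj.comp (continuous_planeWave_energy m y)).mul continuous_const

theorem norm_amplitude_le (m : ℝ) {h : Spacetime → ℂ} (hh : IsTest h) (N : ℕ) (k : Space) :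
    ‖amplitude m h k‖ ≤ (∫ x, ‖oneSubLaplacian^[N] h x‖) * (1 + ‖k‖ ^ 2)⁻¹ ^ N := by
  have := (isSpaceWave_planeWave (-energy m k) (-k)).norm_integral_le
    (fun x => (norm_planeWave _ _ x).le) N hh
  simpa [amplitude, conj_planeWave_eq] using this

theorem inv_two_energy_le (m : ℝ) {k : Space} (hk : k ≠ 0) :
    ‖((2 * energy m k : ℝ) : ℂ)⁻¹‖ ≤ ‖k‖⁻¹ := by
  have h1 := norm_pos_iff.2 hk
  have h2 := norm_le_energy m k
  rw [norm_inv, Complex.norm_real, Real.norm_of_nonneg (by linarith)]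
  exact inv_anti₀ h1 (by linarith)

theorem ae_ne_zero : ∀ᵐ k : Space, k ≠ 0 := by simp [ae_iff]

/-- Of the n + 2 powers of decay, n absorb the polynomial weight and two make |𝐤|⁻¹, the majorant of
the factor (2ω)⁻¹, integrable. -/
theorem integrable_pow_mul_amplitude (m : ℝ) {h : Spacetime → ℂ} (hh : IsTest h) (n : ℕ) :
    Integrable fun k : Space =>
      ‖(energy m k, k)‖ ^ n * ‖((2 * energy m k : ℝ) : ℂ)⁻¹ * amplitude m h k‖ := by
  have hc := continuous_energy m
  have hca := continuous_amplitude m hh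
  set A := ∫ x, ‖oneSubLaplacian^[n + 2] h x‖ with hA
  have hA0 : 0 ≤ A := integral_nonneg fun _ => norm_nonneg _
  refine (integrable_inv_norm_mul_decay.const_mul (A * (2 * (1 + |m|)) ^ n)).mono' ?_ ?_
  · have : Measurable fun k : Space => ((2 * energy m k : ℝ) : ℂ)⁻¹ := by
      have := hc.measurable; fun_prop
    exact ((by fun_prop : Continuous fun k : Space => ‖(energy m k, k)‖ ^ n).measurable.mul
      (this.mul hca.measurable).norm).aestronglyMeasurable
  · filter_upwards [ae_ne_zero] with k hk
    have h1 := norm_amplitude_le m hh (n + 2) k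
    have h2 := inv_two_energy_le m hk
    have h3 : ‖(energy m k, k)‖ ≤ (2 * (1 + |m|)) * (1 + ‖k‖ ^ 2) := by
      rw [Prod.norm_def, Real.norm_of_nonneg (energy_nonneg m k), max_eq_left (norm_le_energy m k)]
      refine (energy_le m k).trans ?_
      nlinarith [sq_nonneg (‖k‖ - 1), abs_nonneg m, mul_nonneg (abs_nonneg m) (sq_nonneg ‖k‖)]
    rw [Real.norm_of_nonneg (by positivity), norm_mul]
    calc _ ≤ ((2 * (1 + |m|)) * (1 + ‖k‖ ^ 2)) ^ n *
          (‖k‖⁻¹ * (A * (1 + ‖k‖ ^ 2)⁻¹ ^ (n + 2))) := by gcongr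
      _ = A * (2 * (1 + |m|)) ^ n * (‖k‖⁻¹ * (1 + ‖k‖ ^ 2)⁻¹ ^ 2) *
          ((1 + ‖k‖ ^ 2) * (1 + ‖k‖ ^ 2)⁻¹) ^ n := by
            generalize 1 + ‖k‖ ^ 2 = q
            generalize 2 * (1 + |m|) = b
            ring
      _ = _ := by rw [mul_inv_cancel₀ (by positivity), one_pow, mul_one]

/-- The operator is a Fourier integral over spacetime with respect to the image of Lebesgue measure
on the mass shell 𝐤 ↦ (ω, 𝐤). All moments of the density are integrable, so it is smooth. -/
theorem isSmooth_vacuumOp (m : ℝ) {h : Spacetime → ℂ} (hh : IsTest h) :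
    IsSmooth (vacuumOp m h) := by
  have hc := continuous_energy m
  have hca := continuous_amplitude m hh
  let s : Space → Spacetime := fun k => (energy m k, k)
  have hs : Measurable s := (by fun_prop : Continuous s).measurable
  let F : Spacetime → ℂ := fun v => ((2 * v.1 : ℝ) : ℂ)⁻¹ * amplitude m h v.2
  have hF : Measurable F := by
    have := hca.measurable
    fun_prop
  let I : Space →L[ℝ] Space →L[ℝ] ℝ := innerSL ℝ
  -- The factor -(2π)⁻¹ undoes both the 2π and the sign in the normalisation of the Fourier
  -- integral, leaving exp(i(ωt + 𝐤·𝐱)).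
  let L : Spacetime →L[ℝ] Spacetime →L[ℝ] ℝ := (-(2 * Real.pi)⁻¹ : ℝ) •
    ((ContinuousLinearMap.mul ℝ ℝ).bilinearComp (ContinuousLinearMap.fst ℝ ℝ Space)
      (ContinuousLinearMap.fst ℝ ℝ Space) + I.bilinearComp
      (ContinuousLinearMap.snd ℝ ℝ Space) (ContinuousLinearMap.snd ℝ ℝ Space))
  have hL : ∀ v w : Spacetime, L v w = -(2 * Real.pi)⁻¹ * (v.1 * w.1 + inner ℝ v.2 w.2) :=
    fun v w => rfl
  have hsm : ContDiff ℝ ∞ (VectorFourier.fourierIntegral Real.fourierChar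
      (Measure.map s volume) L.toLinearMap₁₂ F) := by
    refine VectorFourier.contDiff_fourierIntegral (N := ⊤) L fun n _ => ?_
    rw [integrable_map_measure (by fun_prop) hs.aemeasurable]
    exact integrable_pow_mul_amplitude m hh n
  have he : vacuumOp m h = fun x => ((2 * Real.pi : ℝ) : ℂ)⁻¹ ^ 3 *
      VectorFourier.fourierIntegral Real.fourierChar (Measure.map s volume) L.toLinearMap₁₂ F x := by
    funext x
    rw [vacuumOp_eq, VectorFourier.fourierIntegral, integral_map hs.aemeasurable]
    · congr 1
      refine integral_congr_ae (ae_of_all _ fun k => ?_)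
      simp only [Circle.smul_def, Real.fourierChar_apply, smul_eq_mul, F, s]
      have : L.toLinearMap₁₂ (energy m k, k) x =
          -(2 * Real.pi)⁻¹ * (energy m k * x.1 + inner ℝ k x.2) := hL _ _
      rw [this, planeWave]
      have h2 : (2 * Real.pi * -(-(2 * Real.pi)⁻¹ * (energy m k * x.1 + inner ℝ k x.2)) : ℝ) =
          energy m k * x.1 + inner ℝ k x.2 := by
        field_simp
      rw [h2, mul_comm Complex.I]
      ring
    · refine AEStronglyMeasurable.smul ?_ hF.aestronglyMeasurable
      have hLc : Continuous fun v : Spacetime => ((Real.fourierChar (-(L v x)) : Circle) : ℂ) :=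
        continuous_subtype_val.comp (Real.continuous_fourierChar.comp (by fun_prop))
      exact hLc.aestronglyMeasurable
  rw [he]
  exact contDiff_const.mul hsm

theorem vacuumOp_zero (m : ℝ) : vacuumOp m 0 = 0 := by
  funext x
  simp [vacuumOp]

/-! ### Oscillators with a slowly varying frequency -/

/-- `u` is the solution with derivative `u'` of `u'' + w u = 0` that coincides with
`exp (i ν t)` before the time `a`. -/
structure IsMode (w : ℝ → ℝ) (ν a : ℝ) (u u' : ℝ → ℂ) : Prop where
  hasDerivAt : ∀ t, HasDerivAt u (u' t) t
  hasDerivAt' : ∀ t, HasDerivAt u' (-(w t : ℂ) * u t) t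
  early : ∀ t < a, u t = Complex.exp (Complex.I * ((ν * t : ℝ) : ℂ))

section Mode

variable {w w' : ℝ → ℝ} {ν a : ℝ} {u u' : ℝ → ℂ}

theorem hasDerivAt_exp_I {θ : ℝ → ℝ} {θ' t : ℝ} (h : HasDerivAt θ θ' t) :
    HasDerivAt (fun t => Complex.exp (Complex.I * (θ t : ℂ)))
      (Complex.I * θ' * Complex.exp (Complex.I * (θ t : ℂ))) t := by
  refine ((h.ofReal_comp.const_mul Complex.I).cexp).congr_deriv ?_
  ring

theorem norm_exp_I (r : ℝ) : ‖Complex.exp (Complex.I * (r : ℂ))‖ = 1 := by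
  rw [mul_comm, Complex.norm_exp_ofReal_mul_I]

theorem IsMode.early' (h : IsMode w ν a u u') {t : ℝ} (ht : t < a) :
    u' t = Complex.I * ν * Complex.exp (Complex.I * ((ν * t : ℝ) : ℂ)) := by
  have h1 := h.hasDerivAt t
  have h2 : HasDerivAt u (Complex.I * ν * Complex.exp (Complex.I * ((ν * t : ℝ) : ℂ))) t := by
    have := hasDerivAt_exp_I (θ := fun t => ν * t) (θ' := ν) (t := t)
      (by simpa using (hasDerivAt_id t).const_mul ν)
    refine this.congr_of_eventuallyEq ?_
    filter_upwards [Iio_mem_nhds ht] with s hs using h.early s hs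
  exact h1.unique h2

/-- The energy of an oscillator. -/
def modeEnergy (w : ℝ → ℝ) (u u' : ℝ → ℂ) (t : ℝ) : ℝ := ‖u' t‖ ^ 2 + w t * ‖u t‖ ^ 2

/-- By the equation of motion the energy changes only through the explicit time dependence of the
frequency. -/
theorem IsMode.hasDerivAt_modeEnergy (h : IsMode w ν a u u') (hw : ∀ t, HasDerivAt w (w' t) t)
    (t : ℝ) : HasDerivAt (modeEnergy w u u') (w' t * ‖u t‖ ^ 2) t := by
  have h1 := (h.hasDerivAt' t).norm_sq
  have h2 := (hw t).mul (h.hasDerivAt t).norm_sq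
  refine (h1.add h2).congr_deriv ?_
  simp only [Complex.inner]
  simp
  ring

theorem IsMode.modeEnergy_early (h : IsMode w ν a u u') (hw : ∀ t < a, w t = ν ^ 2) {t : ℝ}
    (ht : t < a) : modeEnergy w u u' t = 2 * ν ^ 2 := by
  rw [modeEnergy, h.early t ht, h.early' ht, norm_mul, norm_mul, norm_exp_I, hw t ht]
  simp
  ring

/-- For an increasing frequency the ratio E/w decreases, since its derivative is -w'|u'|²/w².
Initially it equals 2, and w|u|² ≤ E. -/
theorem IsMode.norm_sq_le_of_nonneg (h : IsMode w ν a u u') (hw : ∀ t, HasDerivAt w (w' t) t)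
    (hνa : ∀ t < a, w t = ν ^ 2) (hpos : ∀ t, 0 < w t) (hw' : ∀ t, 0 ≤ w' t) (t : ℝ) :
    ‖u t‖ ^ 2 ≤ 2 := by
  have hanti : Antitone fun t => modeEnergy w u u' t / w t := by
    refine antitone_of_hasDerivAt_nonpos
      (fun t => (h.hasDerivAt_modeEnergy hw t).div (hw t) (hpos t).ne') fun t => ?_
    refine div_nonpos_of_nonpos_of_nonneg ?_ (by positivity)
    have := mul_nonneg (hw' t) (sq_nonneg ‖u' t‖)
    simp only [modeEnergy]
    nlinarith
  set t₀ := min t (a - 1)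
  have ht₀ : t₀ < a := (min_le_right _ _).trans_lt (by linarith)
  have h1 := hanti (min_le_left t (a - 1))
  have h2 := hpos t₀
  simp only at h1
  rw [h.modeEnergy_early hνa ht₀, hνa t₀ ht₀] at h1
  rw [hνa t₀ ht₀] at h2
  rw [mul_div_assoc, div_self h2.ne', mul_one, div_le_iff₀ (hpos t), modeEnergy] at h1
  have h3 := sq_nonneg ‖u' t‖
  have h4 : w t * ‖u t‖ ^ 2 ≤ w t * 2 := by linarith
  exact le_of_mul_le_mul_left h4 (hpos t)

/-- For a decreasing frequency the energy itself decreases from its initial value 2ν², and c|u|² ≤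
E. -/
theorem IsMode.norm_sq_le_of_nonpos (h : IsMode w ν a u u') (hw : ∀ t, HasDerivAt w (w' t) t)
    (hνa : ∀ t < a, w t = ν ^ 2) (hw' : ∀ t, w' t ≤ 0) {c : ℝ} (hc : 0 < c) (hcw : ∀ t, c ≤ w t)
    (t : ℝ) : ‖u t‖ ^ 2 ≤ 2 * (ν ^ 2 / c) := by
  have hanti : Antitone (modeEnergy w u u') :=
    antitone_of_hasDerivAt_nonpos (h.hasDerivAt_modeEnergy hw) fun t =>
      mul_nonpos_of_nonpos_of_nonneg (hw' t) (sq_nonneg _)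
  set t₀ := min t (a - 1)
  have ht₀ : t₀ < a := (min_le_right _ _).trans_lt (by linarith)
  have h1 := hanti (min_le_left t (a - 1))
  rw [h.modeEnergy_early hνa ht₀, modeEnergy] at h1
  have h3 := sq_nonneg ‖u' t‖
  have h4 := mul_le_mul_of_nonneg_right (hcw t) (sq_nonneg ‖u t‖)
  rw [← mul_div_assoc, le_div_iff₀ hc]
  linarith

/-! ### The WKB approximation -/

/-- The Wronskian of a solution with an approximate solution `q exp (i σ θ)`, `θ' = q⁻²`,
has a small derivative. -/
theorem IsMode.hasDerivAt_wronskian (h : IsMode w ν a u u') {q q' q'' θ : ℝ → ℝ} {t σ : ℝ}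
    (hσ : σ ^ 2 = 1)
    (hq : HasDerivAt q (q' t) t) (hq' : HasDerivAt q' (q'' t) t) (hpos : 0 < q t)
    (hqw : q t ^ 4 * w t = 1) (hθ : HasDerivAt θ ((q t ^ 2)⁻¹) t) :
    HasDerivAt (fun t => (u t * (q' t + Complex.I * σ * (q t : ℂ)⁻¹) - u' t * q t) *
        Complex.exp (Complex.I * ((σ * θ t : ℝ) : ℂ)))
      (u t * q'' t * Complex.exp (Complex.I * ((σ * θ t : ℝ) : ℂ))) t := by
  have hq0 : (q t : ℂ) ≠ 0 := by exact_mod_cast hpos.ne'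
  have e := hasDerivAt_exp_I (hθ.const_mul σ)
  have h1 := (hq'.ofReal_comp.add ((hq.ofReal_comp.inv hq0).const_mul (Complex.I * σ)))
  have h2 := (((h.hasDerivAt t).mul h1).sub ((h.hasDerivAt' t).mul hq.ofReal_comp)).mul e
  refine h2.congr_deriv ?_
  have hw : (w t : ℂ) = (q t : ℂ)⁻¹ ^ 4 := by
    have : (q t : ℂ) ^ 4 * w t = 1 := by exact_mod_cast hqw
    field_simp
    linear_combination this
  have hσ' : (σ : ℂ) ^ 2 = 1 := by exact_mod_cast hσ
  simp only [Pi.mul_apply, Pi.sub_apply, Pi.add_apply, Pi.inv_apply]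
  rw [hw]
  push_cast
  generalize Complex.exp (Complex.I * (σ * θ t)) = E
  field_simp
  ring_nf
  simp only [Complex.I_sq, hσ']
  ring

end Mode

/-- The Wronskians of u with q exp(iθ) and q exp(-iθ) vary by at most UJ each. Since these two
functions span approximate solutions, u is recovered from the pair by linear algebra; the initial
values select q exp(iθ)/q(t₀). -/
theorem IsMode.wkb_estimate {w : ℝ → ℝ} {ν a : ℝ} {u u' : ℝ → ℂ} (h : IsMode w ν a u u')
    {q q' q'' θ : ℝ → ℝ} (hq : ∀ t, HasDerivAt q (q' t) t) (hq' : ∀ t, HasDerivAt q' (q'' t) t)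
    (hq'' : Continuous q'') (hpos : ∀ t, 0 < q t) (hqw : ∀ t, q t ^ 4 * w t = 1)
    (hθ : ∀ t, HasDerivAt θ ((q t ^ 2)⁻¹) t) {t₀ : ℝ} (ht₀ : t₀ < a) (hθ₀ : θ t₀ = ν * t₀)
    (hq'₀ : q' t₀ = 0) (hν : (q t₀ ^ 2)⁻¹ = ν) {U J : ℝ} (hU : ∀ t, ‖u t‖ ≤ U)
    {t : ℝ} (ht : t₀ ≤ t) (hJ : ∫ s in t₀..t, |q'' s| ≤ J) :
    ‖(q t₀ : ℂ) * u t - q t * Complex.exp (Complex.I * (θ t : ℂ))‖ ≤ q t₀ * q t * (U * J) := by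
  let A : ℝ → ℝ → ℂ := fun σ t => (u t * (q' t + Complex.I * σ * (q t : ℂ)⁻¹) - u' t * q t) *
        Complex.exp (Complex.I * ((σ * θ t : ℝ) : ℂ))
  have hU0 : 0 ≤ U := (norm_nonneg _).trans (hU 0)
  have huc : Continuous u := continuous_iff_continuousAt.2 fun t => (h.hasDerivAt t).continuousAt
  have hθc : Continuous θ := continuous_iff_continuousAt.2 fun t => (hθ t).continuousAt
  have hA : ∀ σ : ℝ, σ ^ 2 = 1 → ‖A σ t - A σ t₀‖ ≤ U * J := by
    intro σ hσ
    have hd : ∀ s, HasDerivAt (A σ)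
        (u s * q'' s * Complex.exp (Complex.I * ((σ * θ s : ℝ) : ℂ))) s := fun s =>
      h.hasDerivAt_wronskian hσ (hq s) (hq' s) (hpos s) (hqw s) (hθ s)
    have hc : Continuous fun s => u s * q'' s * Complex.exp (Complex.I * ((σ * θ s : ℝ) : ℂ)) := by
      fun_prop
    rw [← intervalIntegral.integral_eq_sub_of_hasDerivAt (fun s _ => hd s)
      (hc.intervalIntegrable _ _)]
    have hle : ‖∫ s in t₀..t, u s * q'' s * Complex.exp (Complex.I * ((σ * θ s : ℝ) : ℂ))‖ ≤
        ∫ s in t₀..t, U * |q'' s| := by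
      refine intervalIntegral.norm_integral_le_of_norm_le ht (ae_of_all _ fun s _ => ?_)
        ((continuous_const.mul hq''.abs).intervalIntegrable _ _)
      rw [norm_mul, norm_mul, norm_exp_I, mul_one, Complex.norm_real, Real.norm_eq_abs]
      exact mul_le_mul_of_nonneg_right (hU s) (abs_nonneg _)
    refine hle.trans ?_
    rw [intervalIntegral.integral_const_mul]
    exact mul_le_mul_of_nonneg_left hJ hU0
  have hq0 : ∀ t, (q t : ℂ) ≠ 0 := fun t => by exact_mod_cast (hpos t).ne'
  have hν' : (ν : ℂ) = (q t₀ : ℂ)⁻¹ ^ 2 := by rw [← hν]; push_cast; ring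
  have hee : ∀ r : ℝ, Complex.exp (Complex.I * (r : ℂ)) *
      Complex.exp (Complex.I * ((-1 * r : ℝ) : ℂ)) = 1 := by
    intro r
    rw [← Complex.exp_add]
    push_cast
    simp
  -- At t₀ the mode is proportional, with its derivative, to q exp(iθ). It has zero Wronskian with
  -- that solution and a nonzero one with the conjugate.
  have hA1 : A 1 t₀ = 0 := by
    simp only [A, h.early t₀ ht₀, h.early' ht₀, hq'₀, hν']
    have := hq0 t₀
    push_cast
    field_simp
    ring
  have hA2 : A (-1) t₀ = -2 * Complex.I * (q t₀ : ℂ)⁻¹ := by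
    have he := hee (ν * t₀)
    simp only [A, h.early t₀ ht₀, h.early' ht₀, hq'₀, hθ₀, hν'] at he ⊢
    have := hq0 t₀
    set e₁ := Complex.exp (Complex.I * ((ν * t₀ : ℝ) : ℂ))
    set e₂ := Complex.exp (Complex.I * ((-1 * (ν * t₀) : ℝ) : ℂ))
    push_cast
    field_simp
    linear_combination (-2 * Complex.I) * he
  -- Eliminating u' between the two Wronskians leaves exp(iθ) A(-1) - exp(-iθ) A(1) = -2iu/q.
  -- Subtracting its version with the initial values isolates the error.
  have hkey : -2 * Complex.I * ((q t₀ : ℂ) * u t - q t * Complex.exp (Complex.I * (θ t : ℂ))) =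
      q t₀ * q t * (Complex.exp (Complex.I * (θ t : ℂ)) * (A (-1) t - A (-1) t₀) -
        Complex.exp (Complex.I * ((-1 * θ t : ℝ) : ℂ)) * (A 1 t - A 1 t₀)) := by
    rw [hA1, hA2]
    simp only [A]
    have he := hee (θ t)
    have h0 := hq0 t
    have h1 := hq0 t₀
    simp only [one_mul]
    set e₁ := Complex.exp (Complex.I * (θ t : ℂ))
    set e₂ := Complex.exp (Complex.I * ((-1 * θ t : ℝ) : ℂ))
    push_cast
    field_simp
    linear_combination (2 * Complex.I * (q t₀ : ℂ) * u t) * he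
  have hn := congrArg norm hkey
  rw [norm_mul, norm_mul, norm_mul, norm_mul, Complex.norm_real, Complex.norm_real,
    Real.norm_of_nonneg (hpos _).le, Real.norm_of_nonneg (hpos _).le, Complex.norm_I] at hn
  have h3 : ‖Complex.exp (Complex.I * (θ t : ℂ)) * (A (-1) t - A (-1) t₀) -
      Complex.exp (Complex.I * ((-1 * θ t : ℝ) : ℂ)) * (A 1 t - A 1 t₀)‖ ≤ U * J + U * J := by
    refine (norm_sub_le _ _).trans (add_le_add ?_ ?_)
    · rw [norm_mul, norm_exp_I, one_mul]; exact hA (-1) (by norm_num)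
    · rw [norm_mul, norm_exp_I, one_mul]; exact hA 1 (by norm_num)
  have h4 := mul_le_mul_of_nonneg_left h3 (mul_nonneg (hpos t₀).le (hpos t).le)
  rw [← hn] at h4
  norm_num at h4
  linarith

/-! ### Switching profiles -/

/-- Rates of switching: nonnegative test functions with unit integral. -/
structure IsRate (χ : ℝ → ℝ) : Prop where
  smooth : ContDiff ℝ ∞ χ
  compact : HasCompactSupport χ
  nonneg : ∀ τ, 0 ≤ χ τ
  integral : ∫ τ, χ τ = 1

namespace IsRate

variable {χ : ℝ → ℝ}

theorem integrable (hχ : IsRate χ) : Integrable χ :=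
  hχ.smooth.continuous.integrable_of_hasCompactSupport hχ.compact

theorem profile_nonneg (hχ : IsRate χ) (t : ℝ) : 0 ≤ profile χ t :=
  integral_nonneg fun τ => hχ.nonneg τ

theorem profile_le_one (hχ : IsRate χ) (t : ℝ) : profile χ t ≤ 1 := by
  rw [← hχ.integral]
  exact setIntegral_le_integral hχ.integrable (ae_of_all _ hχ.nonneg)

theorem hasDerivAt_profile (hχ : IsRate χ) (t : ℝ) : HasDerivAt (profile χ) (χ t) t := by
  have h1 : profile χ = fun s => (∫ τ in Set.Iic t, χ τ) + ∫ τ in t..s, χ τ := by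
    funext s
    rw [← intervalIntegral.integral_Iic_sub_Iic hχ.integrable.integrableOn
      hχ.integrable.integrableOn]
    simp [profile]
  rw [h1]
  exact (intervalIntegral.integral_hasDerivAt_right (hχ.integrable.intervalIntegrable)
    (hχ.smooth.continuous.stronglyMeasurableAtFilter _ _)
    hχ.smooth.continuous.continuousAt).const_add _

theorem contDiff_profile (hχ : IsRate χ) : ContDiff ℝ ∞ (profile χ) := by
  rw [show (∞ : WithTop ℕ∞) = ∞ + 1 by rfl, contDiff_succ_iff_deriv]
  refine ⟨fun t => (hχ.hasDerivAt_profile t).differentiableAt, by simp, ?_⟩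
  rw [funext fun t => (hχ.hasDerivAt_profile t).deriv]
  exact hχ.smooth

theorem exists_early (hχ : IsRate χ) : ∃ a, ∀ t < a, profile χ t = 0 ∧ χ t = 0 := by
  obtain ⟨a, ha⟩ := hχ.compact.isCompact.bddBelow
  have h0 : ∀ t < a, χ t = 0 := fun t ht =>
    image_eq_zero_of_notMem_tsupport fun h => (ha h).not_gt ht
  refine ⟨a, fun t ht => ⟨?_, h0 t ht⟩⟩
  exact setIntegral_eq_zero_of_forall_eq_zero fun τ hτ => h0 τ (lt_of_le_of_lt hτ ht)

theorem integrable_deriv (hχ : IsRate χ) : Integrable (deriv χ) :=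
  (hχ.smooth.continuous_deriv (by simp)).integrable_of_hasCompactSupport hχ.compact.deriv

theorem le_integral_abs_deriv (hχ : IsRate χ) (t : ℝ) : χ t ≤ ∫ τ, |deriv χ τ| := by
  have h := HasCompactSupport.integral_Iic_deriv_eq
    (hχ.smooth.of_le (by exact_mod_cast le_top)) hχ.compact t
  rw [← h]
  refine (setIntegral_mono hχ.integrable_deriv.integrableOn
    hχ.integrable_deriv.abs.integrableOn fun τ => le_abs_self _).trans ?_
  exact setIntegral_le_integral hχ.integrable_deriv.abs (ae_of_all _ fun _ => abs_nonneg _)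

theorem intervalIntegral_le (hχ : IsRate χ) {t₀ t : ℝ} (ht : t₀ ≤ t) :
    ∫ τ in t₀..t, (χ τ ^ 2 + |deriv χ τ|) ≤ 2 * ∫ τ, |deriv χ τ| := by
  have hd := hχ.integrable_deriv.abs
  have hi : Integrable fun τ => (∫ τ, |deriv χ τ|) * χ τ + |deriv χ τ| :=
    (hχ.integrable.const_mul _).add hd
  have hc : Continuous fun τ => χ τ ^ 2 + |deriv χ τ| :=
    (hχ.smooth.continuous.pow 2).add (hχ.smooth.continuous_deriv (by simp)).abs
  have h0 : 0 ≤ ∫ τ, |deriv χ τ| := integral_nonneg fun _ => abs_nonneg _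
  calc ∫ τ in t₀..t, (χ τ ^ 2 + |deriv χ τ|)
      ≤ ∫ τ in t₀..t, ((∫ τ, |deriv χ τ|) * χ τ + |deriv χ τ|) := by
        refine intervalIntegral.integral_mono_on ht (hc.intervalIntegrable _ _)
          hi.intervalIntegrable fun τ _ => ?_
        have := mul_le_mul_of_nonneg_right (hχ.le_integral_abs_deriv τ) (hχ.nonneg τ)
        nlinarith
    _ ≤ ∫ τ, ((∫ τ, |deriv χ τ|) * χ τ + |deriv χ τ|) := by
        rw [intervalIntegral.integral_of_le ht]
        exact setIntegral_le_integral hi (ae_of_all _ fun τ =>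
          add_nonneg (mul_nonneg h0 (hχ.nonneg τ)) (abs_nonneg _))
    _ = 2 * ∫ τ, |deriv χ τ| := by
        rw [integral_add (hχ.integrable.const_mul _) hd, integral_const_mul, hχ.integral]
        ring

end IsRate

/-! ### The adiabatic limit of the modes -/

/-- The squared frequency while the mass is switched. -/
def switchedFreq (w₁ w₂ : ℝ) (χ : ℝ → ℝ) (t : ℝ) : ℝ := w₁ + (w₂ - w₁) * profile χ t

section SwitchedFreq

variable {w₁ w₂ : ℝ} {χ : ℝ → ℝ}

theorem hasDerivAt_switchedFreq (hχ : IsRate χ) (t : ℝ) :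
    HasDerivAt (switchedFreq w₁ w₂ χ) ((w₂ - w₁) * χ t) t :=
  ((hχ.hasDerivAt_profile t).const_mul _).const_add _

theorem min_le_switchedFreq (hχ : IsRate χ) (t : ℝ) : min w₁ w₂ ≤ switchedFreq w₁ w₂ χ t := by
  have h0 := hχ.profile_nonneg t
  have h1 := hχ.profile_le_one t
  unfold switchedFreq
  rcases le_total w₁ w₂ with h | h
  · rw [min_eq_left h]; nlinarith
  · rw [min_eq_right h]; nlinarith

theorem switchedFreq_pos (h₁ : 0 < w₁) (h₂ : 0 < w₂) (hχ : IsRate χ) (t : ℝ) :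
    0 < switchedFreq w₁ w₂ χ t := (lt_min h₁ h₂).trans_le (min_le_switchedFreq hχ t)

/-- The switching is monotone in one of two directions, each with its own energy argument. The bound
covers both and does not depend on the profile. -/
theorem IsMode.norm_sq_le {ν a : ℝ} {u u' : ℝ → ℂ} (h₁ : 0 < w₁) (h₂ : 0 < w₂) (hχ : IsRate χ)
    (hν : ν ^ 2 = w₁) (ha : ∀ t < a, profile χ t = 0)
    (h : IsMode (switchedFreq w₁ w₂ χ) ν a u u') (t : ℝ) :
    ‖u t‖ ^ 2 ≤ 2 * (1 + w₁ / w₂) := by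
  have hpos : 0 < w₁ / w₂ := div_pos h₁ h₂
  have hνa : ∀ t < a, switchedFreq w₁ w₂ χ t = ν ^ 2 := fun t ht => by
    simp [switchedFreq, ha t ht, hν]
  rcases le_total w₁ w₂ with hle | hle
  · refine (h.norm_sq_le_of_nonneg (hasDerivAt_switchedFreq hχ) hνa (switchedFreq_pos h₁ h₂ hχ)
      (fun t => mul_nonneg (sub_nonneg.2 hle) (hχ.nonneg t)) t).trans ?_
    linarith
  · refine (h.norm_sq_le_of_nonpos (hasDerivAt_switchedFreq hχ) hνa
      (fun t => mul_nonpos_of_nonpos_of_nonneg (sub_nonpos.2 hle) (hχ.nonneg t)) h₂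
      (fun t => (min_eq_right hle).symm.le.trans (min_le_switchedFreq hχ t)) t).trans ?_
    rw [hν]
    linarith

theorem IsMode.norm_le {ν a : ℝ} {u u' : ℝ → ℂ} (h₁ : 0 < w₁) (h₂ : 0 < w₂) (hχ : IsRate χ)
    (hν : ν ^ 2 = w₁) (ha : ∀ t < a, profile χ t = 0)
    (h : IsMode (switchedFreq w₁ w₂ χ) ν a u u') (t : ℝ) :
    ‖u t‖ ≤ Real.sqrt (2 * (1 + w₁ / w₂)) :=
  Real.le_sqrt_of_sq_le (h.norm_sq_le h₁ h₂ hχ hν ha t)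

/-- The amplitude `w ^ (-1/4)` of the WKB approximation. -/
def wkbAmp (w₁ w₂ : ℝ) (χ : ℝ → ℝ) (t : ℝ) : ℝ := switchedFreq w₁ w₂ χ t ^ (-(1 / 4) : ℝ)

/-- The first derivative of `wkbAmp`. -/
def wkbAmp' (w₁ w₂ : ℝ) (χ : ℝ → ℝ) (t : ℝ) : ℝ :=
  (w₂ - w₁) * χ t * (-(1 / 4)) * switchedFreq w₁ w₂ χ t ^ (-(5 / 4) : ℝ)

/-- The second derivative of `wkbAmp`. -/
def wkbAmp'' (w₁ w₂ : ℝ) (χ : ℝ → ℝ) (t : ℝ) : ℝ :=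
  (w₂ - w₁) * deriv χ t * (-(1 / 4)) * switchedFreq w₁ w₂ χ t ^ (-(5 / 4) : ℝ) +
    (w₂ - w₁) ^ 2 * χ t ^ 2 * (5 / 16) * switchedFreq w₁ w₂ χ t ^ (-(9 / 4) : ℝ)

theorem hasDerivAt_wkbAmp (h₁ : 0 < w₁) (h₂ : 0 < w₂) (hχ : IsRate χ) (t : ℝ) :
    HasDerivAt (wkbAmp w₁ w₂ χ) (wkbAmp' w₁ w₂ χ t) t := by
  have := (hasDerivAt_switchedFreq (w₁ := w₁) (w₂ := w₂) hχ t).rpow_const (p := -(1 / 4))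
    (Or.inl (switchedFreq_pos h₁ h₂ hχ t).ne')
  refine this.congr_deriv ?_
  unfold wkbAmp'
  norm_num

theorem hasDerivAt_wkbAmp' (h₁ : 0 < w₁) (h₂ : 0 < w₂) (hχ : IsRate χ) (t : ℝ) :
    HasDerivAt (wkbAmp' w₁ w₂ χ) (wkbAmp'' w₁ w₂ χ t) t := by
  have h3 := (hasDerivAt_switchedFreq (w₁ := w₁) (w₂ := w₂) hχ t).rpow_const (p := -(5 / 4))
    (Or.inl (switchedFreq_pos h₁ h₂ hχ t).ne')
  have h4 := (((hχ.smooth.differentiable (by simp) t).hasDerivAt.const_mul (w₂ - w₁)).mul_const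
    (-(1 / 4) : ℝ)).mul h3
  refine h4.congr_deriv ?_
  unfold wkbAmp''
  norm_num
  ring

theorem continuous_switchedFreq (hχ : IsRate χ) : Continuous (switchedFreq w₁ w₂ χ) :=
  continuous_iff_continuousAt.2 fun t => (hasDerivAt_switchedFreq hχ t).continuousAt

theorem continuous_switchedFreq_rpow (h₁ : 0 < w₁) (h₂ : 0 < w₂) (hχ : IsRate χ) (p : ℝ) :
    Continuous fun t => switchedFreq w₁ w₂ χ t ^ p :=
  (continuous_switchedFreq hχ).rpow_const fun t => Or.inl (switchedFreq_pos h₁ h₂ hχ t).ne'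

theorem continuous_wkbAmp'' (h₁ : 0 < w₁) (h₂ : 0 < w₂) (hχ : IsRate χ) :
    Continuous (wkbAmp'' w₁ w₂ χ) := by
  have a := continuous_switchedFreq_rpow h₁ h₂ hχ (-(5 / 4))
  have b := continuous_switchedFreq_rpow h₁ h₂ hχ (-(9 / 4))
  have c := hχ.smooth.continuous
  have d := hχ.smooth.continuous_deriv (by simp)
  unfold wkbAmp''
  fun_prop

theorem wkbAmp_pos (h₁ : 0 < w₁) (h₂ : 0 < w₂) (hχ : IsRate χ) (t : ℝ) :
    0 < wkbAmp w₁ w₂ χ t := Real.rpow_pos_of_pos (switchedFreq_pos h₁ h₂ hχ t) _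

theorem wkbAmp_le (h₁ : 0 < w₁) (h₂ : 0 < w₂) (hχ : IsRate χ) (t : ℝ) :
    wkbAmp w₁ w₂ χ t ≤ min w₁ w₂ ^ (-(1 / 4) : ℝ) :=
  Real.rpow_le_rpow_of_nonpos (lt_min h₁ h₂) (min_le_switchedFreq hχ t) (by norm_num)

theorem wkbAmp_pow_four (h₁ : 0 < w₁) (h₂ : 0 < w₂) (hχ : IsRate χ) (t : ℝ) :
    wkbAmp w₁ w₂ χ t ^ 4 * switchedFreq w₁ w₂ χ t = 1 := by
  have hp := switchedFreq_pos h₁ h₂ hχ t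
  rw [wkbAmp, ← Real.rpow_natCast, ← Real.rpow_mul hp.le]
  norm_num
  rw [Real.rpow_neg_one, inv_mul_cancel₀ hp.ne']

/-- q'' is linear in χ' and quadratic in χ with negative powers of w as coefficients; these are
largest at the smaller of the two end frequencies. -/
theorem abs_wkbAmp''_le (h₁ : 0 < w₁) (h₂ : 0 < w₂) (hχ : IsRate χ) (t : ℝ) :
    |wkbAmp'' w₁ w₂ χ t| ≤ (|w₂ - w₁| * min w₁ w₂ ^ (-(5 / 4) : ℝ) +
      (w₂ - w₁) ^ 2 * min w₁ w₂ ^ (-(9 / 4) : ℝ)) * (χ t ^ 2 + |deriv χ t|) := by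
  have hm := lt_min h₁ h₂
  have hle := min_le_switchedFreq (w₁ := w₁) (w₂ := w₂) hχ t
  have hp := switchedFreq_pos h₁ h₂ hχ t
  have a := Real.rpow_le_rpow_of_nonpos (z := -(5 / 4)) hm hle (by norm_num)
  have b := Real.rpow_le_rpow_of_nonpos (z := -(9 / 4)) hm hle (by norm_num)
  have a0 := Real.rpow_pos_of_pos hp (-(5 / 4))
  have b0 := Real.rpow_pos_of_pos hp (-(9 / 4))
  have a1 := Real.rpow_pos_of_pos hm (-(5 / 4))
  have b1 := Real.rpow_pos_of_pos hm (-(9 / 4))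
  unfold wkbAmp''
  set A := switchedFreq w₁ w₂ χ t ^ (-(5 / 4) : ℝ)
  set B := switchedFreq w₁ w₂ χ t ^ (-(9 / 4) : ℝ)
  refine (abs_add_le _ _).trans ?_
  rw [abs_mul, abs_mul, abs_mul, abs_of_pos a0, abs_of_nonneg
    (by positivity : 0 ≤ (w₂ - w₁) ^ 2 * χ t ^ 2 * (5 / 16) * B)]
  have e1 : |w₂ - w₁| * |deriv χ t| * |-(1 / 4 : ℝ)| * A ≤
      |w₂ - w₁| * |deriv χ t| * 1 * min w₁ w₂ ^ (-(5 / 4) : ℝ) := by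
    gcongr
    norm_num [abs_le]
  have e2 : (w₂ - w₁) ^ 2 * χ t ^ 2 * (5 / 16) * B ≤
      (w₂ - w₁) ^ 2 * χ t ^ 2 * 1 * min w₁ w₂ ^ (-(9 / 4) : ℝ) := by
    gcongr
    norm_num
  have e3 : 0 ≤ |w₂ - w₁| * min w₁ w₂ ^ (-(5 / 4) : ℝ) * χ t ^ 2 := by positivity
  have e4 : 0 ≤ (w₂ - w₁) ^ 2 * min w₁ w₂ ^ (-(9 / 4) : ℝ) * |deriv χ t| := by positivity
  linarith

/-- The error constant of the WKB approximation. -/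
def wkbConst (w₁ w₂ : ℝ) : ℝ :=
  w₁ ^ (-(1 / 4) : ℝ) * min w₁ w₂ ^ (-(1 / 4) : ℝ) * (Real.sqrt (2 * (1 + w₁ / w₂)) *
    ((|w₂ - w₁| * min w₁ w₂ ^ (-(5 / 4) : ℝ) + (w₂ - w₁) ^ 2 * min w₁ w₂ ^ (-(9 / 4) : ℝ)) * 2))

/-- Writing q(t₀)u as the WKB solution plus an error at most D, the product of one mode with the
conjugate of another time value has two cross terms and a quadratic term. The phase enters only
through θ(t) - θ(s), so the starting time drops out. -/
theorem IsMode.product_estimate {a : ℝ} {u u' : ℝ → ℂ} (h₁ : 0 < w₁) (h₂ : 0 < w₂)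
    (hχ : IsRate χ) (ha : ∀ t < a, profile χ t = 0 ∧ χ t = 0)
    (h : IsMode (switchedFreq w₁ w₂ χ) (Real.sqrt w₁) a u u') (t s : ℝ) :
    ‖((Real.sqrt w₁)⁻¹ : ℂ) * (u t * (starRingEnd ℂ) (u s)) -
      wkbAmp w₁ w₂ χ t * wkbAmp w₁ w₂ χ s * Complex.exp (Complex.I *
        ((∫ τ in s..t, (wkbAmp w₁ w₂ χ τ ^ 2)⁻¹ : ℝ) : ℂ))‖ ≤
      2 * (min w₁ w₂ ^ (-(1 / 4) : ℝ)) * (wkbConst w₁ w₂ * ∫ τ, |deriv χ τ|) +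
        (wkbConst w₁ w₂ * ∫ τ, |deriv χ τ|) ^ 2 := by
  set q := wkbAmp w₁ w₂ χ with hqdef
  set Q := min w₁ w₂ ^ (-(1 / 4) : ℝ)
  set D := wkbConst w₁ w₂ * ∫ τ, |deriv χ τ| with hD
  have hm := lt_min h₁ h₂
  -- A time before the switching and before both arguments, so that the estimate runs forward to
  -- each of them.
  set t₀ := min a (min t s) - 1 with ht₀
  have h0a : t₀ < a := by have := min_le_left a (min t s); linarith
  have h0t : t₀ ≤ t := by
    have := (min_le_right a (min t s)).trans (min_le_left t s); linarith
  have h0s : t₀ ≤ s := by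
    have := (min_le_right a (min t s)).trans (min_le_right t s); linarith
  have hqpos := wkbAmp_pos h₁ h₂ hχ
  have hqle := wkbAmp_le h₁ h₂ hχ
  have hq0 : q t₀ = w₁ ^ (-(1 / 4) : ℝ) := by
    simp [hqdef, wkbAmp, switchedFreq, (ha t₀ h0a).1]
  have hqc : Continuous fun τ => (q τ ^ 2)⁻¹ :=
    ((continuous_switchedFreq_rpow h₁ h₂ hχ _).pow 2).inv₀ fun τ => (pow_pos (hqpos τ) 2).ne'
  -- Normalised to √w₁ t₀ at t₀, matching the phase of the incoming wave.
  let θ : ℝ → ℝ := fun r => Real.sqrt w₁ * t₀ + ∫ τ in t₀..r, (q τ ^ 2)⁻¹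
  have hθ : ∀ r, HasDerivAt θ ((q r ^ 2)⁻¹) r := fun r =>
    (intervalIntegral.integral_hasDerivAt_right (hqc.intervalIntegrable _ _)
      (hqc.stronglyMeasurableAtFilter _ _) hqc.continuousAt).const_add _
  have hν : (q t₀ ^ 2)⁻¹ = Real.sqrt w₁ := by
    rw [hq0, ← Real.rpow_natCast, ← Real.rpow_mul h₁.le, ← Real.rpow_neg h₁.le, Real.sqrt_eq_rpow]
    norm_num
  have hest : ∀ r, t₀ ≤ r →
      ‖(q t₀ : ℂ) * u r - q r * Complex.exp (Complex.I * (θ r : ℂ))‖ ≤ D := by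
    intro r hr
    have hJ : ∫ τ in t₀..r, |wkbAmp'' w₁ w₂ χ τ| ≤
        (|w₂ - w₁| * min w₁ w₂ ^ (-(5 / 4) : ℝ) + (w₂ - w₁) ^ 2 * min w₁ w₂ ^ (-(9 / 4) : ℝ)) *
          (2 * ∫ τ, |deriv χ τ|) := by
      have hc : Continuous fun τ => χ τ ^ 2 + |deriv χ τ| :=
        (hχ.smooth.continuous.pow 2).add (hχ.smooth.continuous_deriv (by simp)).abs
      have hc2 : Continuous fun τ => (|w₂ - w₁| * min w₁ w₂ ^ (-(5 / 4) : ℝ) +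
          (w₂ - w₁) ^ 2 * min w₁ w₂ ^ (-(9 / 4) : ℝ)) * (χ τ ^ 2 + |deriv χ τ|) :=
        continuous_const.mul hc
      refine (intervalIntegral.integral_mono_on hr
        ((continuous_wkbAmp'' h₁ h₂ hχ).abs.intervalIntegrable _ _)
        (hc2.intervalIntegrable _ _)
        fun τ _ => abs_wkbAmp''_le h₁ h₂ hχ τ).trans ?_
      rw [intervalIntegral.integral_const_mul]
      exact mul_le_mul_of_nonneg_left (hχ.intervalIntegral_le hr) (by positivity)
    refine (h.wkb_estimate (hasDerivAt_wkbAmp h₁ h₂ hχ) (hasDerivAt_wkbAmp' h₁ h₂ hχ)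
      (continuous_wkbAmp'' h₁ h₂ hχ) hqpos (wkbAmp_pow_four h₁ h₂ hχ) hθ h0a (by simp [θ])
      (by simp [wkbAmp', (ha t₀ h0a).2]) hν
      (h.norm_le h₁ h₂ hχ (Real.sq_sqrt h₁.le) fun t ht => (ha t ht).1) hr hJ).trans ?_
    have hI : 0 ≤ ∫ τ, |deriv χ τ| := integral_nonneg fun _ => abs_nonneg _
    calc _ ≤ w₁ ^ (-(1 / 4) : ℝ) * Q * (Real.sqrt (2 * (1 + w₁ / w₂)) *
          ((|w₂ - w₁| * min w₁ w₂ ^ (-(5 / 4) : ℝ) + (w₂ - w₁) ^ 2 * min w₁ w₂ ^ (-(9 / 4) : ℝ)) *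
          (2 * ∫ τ, |deriv χ τ|))) := by
          rw [← hq0]
          have := (hqpos t₀).le
          gcongr
          exact hqle r
      _ = D := by rw [hD, wkbConst]; ring
  set dt := (q t₀ : ℂ) * u t - q t * Complex.exp (Complex.I * (θ t : ℂ)) with hdt
  set ds := (q t₀ : ℂ) * u s - q s * Complex.exp (Complex.I * (θ s : ℂ)) with hds
  have et := hest t h0t
  have es := hest s h0s
  have hθd : ∫ τ in s..t, (q τ ^ 2)⁻¹ = θ t - θ s := by
    simp only [θ]
    rw [← intervalIntegral.integral_interval_sub_left (hqc.intervalIntegrable t₀ t)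
      (hqc.intervalIntegrable t₀ s)]
    ring
  have hexp : Complex.exp (Complex.I * ((θ t - θ s : ℝ) : ℂ)) =
      Complex.exp (Complex.I * (θ t : ℂ)) * (starRingEnd ℂ) (Complex.exp (Complex.I * (θ s : ℂ))) := by
    rw [← Complex.exp_conj, ← Complex.exp_add]
    congr 1
    simp
    ring
  have hqq : ((Real.sqrt w₁)⁻¹ : ℂ) = (q t₀ : ℂ) ^ 2 := by
    rw [← hν]; push_cast; rw [inv_inv]
  have hmain : ((Real.sqrt w₁)⁻¹ : ℂ) * (u t * (starRingEnd ℂ) (u s)) -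
      q t * q s * Complex.exp (Complex.I * ((∫ τ in s..t, (q τ ^ 2)⁻¹ : ℝ) : ℂ)) =
      dt * (starRingEnd ℂ) (q s * Complex.exp (Complex.I * (θ s : ℂ))) +
      (q t * Complex.exp (Complex.I * (θ t : ℂ))) * (starRingEnd ℂ) ds +
      dt * (starRingEnd ℂ) ds := by
    rw [hθd, hexp, hqq, hdt, hds]
    simp only [map_sub, map_mul, Complex.conj_ofReal]
    ring
  rw [hmain]
  have hv : ∀ r, ‖(q r : ℂ) * Complex.exp (Complex.I * (θ r : ℂ))‖ ≤ Q := fun r => by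
    rw [norm_mul, norm_exp_I, mul_one, Complex.norm_real, Real.norm_of_nonneg (hqpos r).le]
    exact hqle r
  have hD0 : 0 ≤ D := (norm_nonneg _).trans et
  have hQ0 : 0 ≤ Q := (norm_nonneg _).trans (hv t)
  calc _ ≤ D * Q + Q * D + D * D := by
        refine norm_add₃_le.trans (add_le_add (add_le_add ?_ ?_) ?_)
        · refine (norm_mul_le _ _).trans (mul_le_mul et ?_ (norm_nonneg _) hD0)
          exact (RCLike.norm_conj _).trans_le (hv s)
        · refine (norm_mul_le _ _).trans (mul_le_mul (hv t) ?_ (norm_nonneg _) hQ0)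
          exact (RCLike.norm_conj _).trans_le es
        · refine (norm_mul_le _ _).trans (mul_le_mul et ?_ (norm_nonneg _) hD0)
          exact (RCLike.norm_conj _).trans_le es
    _ = _ := by ring

end SwitchedFreq

/-- The WKB error tends to 0 with ∫ |χ'|. On the fixed interval between s and t the frequency tends
pointwise to w₂ and stays below w₁ + w₂, so the relative phase converges by dominated convergence.
-/
theorem tendsto_mode_product {ι : Type*} {l : Filter ι} [l.IsCountablyGenerated]
    {χ : ι → ℝ → ℝ} (hχ : ∀ i, IsRate (χ i)) (hone : ∀ t, Tendsto (fun i => profile (χ i) t) l (𝓝 1))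
    (hslow : Tendsto (fun i => ∫ τ, |deriv (χ i) τ|) l (𝓝 0)) {w₁ w₂ : ℝ} (h₁ : 0 < w₁)
    (h₂ : 0 < w₂) {u u' : ι → ℝ → ℂ} {a : ι → ℝ}
    (ha : ∀ i, ∀ t < a i, profile (χ i) t = 0 ∧ χ i t = 0)
    (h : ∀ i, IsMode (switchedFreq w₁ w₂ (χ i)) (Real.sqrt w₁) (a i) (u i) (u' i)) (t s : ℝ) :
    Tendsto (fun i => ((Real.sqrt w₁)⁻¹ : ℂ) * (u i t * (starRingEnd ℂ) (u i s))) l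
      (𝓝 (((Real.sqrt w₂)⁻¹ : ℂ) * Complex.exp (Complex.I * ((Real.sqrt w₂ * (t - s) : ℝ) : ℂ)))) := by
  have hw : ∀ t, Tendsto (fun i => switchedFreq w₁ w₂ (χ i) t) l (𝓝 w₂) := fun t => by
    have := ((hone t).const_mul (w₂ - w₁)).const_add w₁
    simpa [switchedFreq] using this
  have hq : ∀ t, Tendsto (fun i => wkbAmp w₁ w₂ (χ i) t) l (𝓝 (w₂ ^ (-(1 / 4) : ℝ))) := fun t =>
    (hw t).rpow_const (Or.inl h₂.ne')
  have hq2 : ((w₂ ^ (-(1 / 4) : ℝ)) ^ 2)⁻¹ = Real.sqrt w₂ := by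
    rw [← Real.rpow_natCast, ← Real.rpow_mul h₂.le, ← Real.rpow_neg h₂.le, Real.sqrt_eq_rpow]
    norm_num
  have hqc : ∀ i, Continuous fun τ => (wkbAmp w₁ w₂ (χ i) τ ^ 2)⁻¹ := fun i =>
    ((continuous_switchedFreq_rpow h₁ h₂ (hχ i) _).pow 2).inv₀
      fun τ => (pow_pos (wkbAmp_pos h₁ h₂ (hχ i) τ) 2).ne'
  have hint : Tendsto (fun i => ∫ τ in s..t, (wkbAmp w₁ w₂ (χ i) τ ^ 2)⁻¹) l
      (𝓝 (∫ _ in s..t, Real.sqrt w₂)) := by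
    refine intervalIntegral.tendsto_integral_filter_of_dominated_convergence
      (fun _ => Real.sqrt (w₁ + w₂)) (Eventually.of_forall fun i => (hqc i).aestronglyMeasurable)
      (Eventually.of_forall fun i => ae_of_all _ fun τ _ => ?_)
      (continuous_const.intervalIntegrable _ _) (ae_of_all _ fun τ _ => ?_)
    · have hp := switchedFreq_pos h₁ h₂ (hχ i) τ
      have : (wkbAmp w₁ w₂ (χ i) τ ^ 2)⁻¹ = Real.sqrt (switchedFreq w₁ w₂ (χ i) τ) := by
        rw [wkbAmp, ← Real.rpow_natCast, ← Real.rpow_mul hp.le, ← Real.rpow_neg hp.le,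
          Real.sqrt_eq_rpow]
        norm_num
      rw [this, Real.norm_of_nonneg (Real.sqrt_nonneg _)]
      refine Real.sqrt_le_sqrt ?_
      have h0 := (hχ i).profile_nonneg τ
      have h1 := (hχ i).profile_le_one τ
      unfold switchedFreq
      nlinarith
    · rw [← hq2]
      exact ((hq τ).pow 2).inv₀ (by positivity)
  rw [intervalIntegral.integral_const, smul_eq_mul] at hint
  have hlim : Tendsto (fun i => (wkbAmp w₁ w₂ (χ i) t : ℂ) * wkbAmp w₁ w₂ (χ i) s *
      Complex.exp (Complex.I * ((∫ τ in s..t, (wkbAmp w₁ w₂ (χ i) τ ^ 2)⁻¹ : ℝ) : ℂ))) l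
      (𝓝 (((Real.sqrt w₂)⁻¹ : ℂ) * Complex.exp (Complex.I *
        ((Real.sqrt w₂ * (t - s) : ℝ) : ℂ)))) := by
    have e1 := (Complex.continuous_ofReal.tendsto _).comp (hq t)
    have e2 := (Complex.continuous_ofReal.tendsto _).comp (hq s)
    have hc : Continuous fun r : ℝ => Complex.exp (Complex.I * (r : ℂ)) := by fun_prop
    have e3 := (hc.tendsto _).comp hint
    have := (e1.mul e2).mul e3
    rw [mul_comm (t - s)] at this
    rw [show ((Real.sqrt w₂)⁻¹ : ℂ) = ((w₂ ^ (-(1 / 4) : ℝ) : ℝ) : ℂ) *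
      ((w₂ ^ (-(1 / 4) : ℝ) : ℝ) : ℂ) by rw [← hq2]; push_cast; rw [inv_inv, sq]]
    exact this
  have herr : Tendsto (fun i => 2 * (min w₁ w₂ ^ (-(1 / 4) : ℝ)) *
      (wkbConst w₁ w₂ * ∫ τ, |deriv (χ i) τ|) +
        (wkbConst w₁ w₂ * ∫ τ, |deriv (χ i) τ|) ^ 2) l (𝓝 0) := by
    have e := hslow.const_mul (wkbConst w₁ w₂)
    simpa using (e.const_mul (2 * (min w₁ w₂ ^ (-(1 / 4) : ℝ)))).add (e.pow 2)
  have hz := squeeze_zero_norm (fun i => (h i).product_estimate h₁ h₂ (hχ i) (ha i) t s) herr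
  simpa using hz.add hlim

/-! ### The Møller map on plane waves for a spatially constant switch-on -/

/-- The spatially constant cutoff function with switch-on profile `∫_{-∞}^t χ`. -/
def switchOn (χ : ℝ → ℝ) (x : Spacetime) : ℝ := profile χ x.1

theorem isCutoff_switchOn {χ : ℝ → ℝ} (hχ : IsRate χ) : IsCutoff (switchOn χ) := by
  obtain ⟨a, ha⟩ := hχ.exists_early
  refine ⟨hχ.contDiff_profile.comp contDiff_fst, ?_⟩
  refine (isFutureSet_halfSpace a).pastCompact.mono (isClosed_tsupport _) ?_
  refine closure_minimal (fun x hx => ?_) (isFutureSet_halfSpace a).isClosed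
  by_contra h
  exact hx (ha x.1 (not_le.1 h)).1

theorem dirDeriv_conj {u : Spacetime → ℂ} (hu : ContDiff ℝ ∞ u) (v : Spacetime) :
    dirDeriv v (fun x => (starRingEnd ℂ) (u x)) = fun x => (starRingEnd ℂ) (dirDeriv v u x) := by
  funext x
  have := (Complex.conjCLE.toContinuousLinearMap.hasFDerivAt.comp x
    (differentiable_of_smooth hu x).hasFDerivAt).fderiv
  change fderiv ℝ (Complex.conjCLE.toContinuousLinearMap ∘ u) x v = _
  rw [this]
  rfl

theorem contDiff_conj {u : Spacetime → ℂ} (hu : ContDiff ℝ ∞ u) :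
    ContDiff ℝ ∞ fun x => (starRingEnd ℂ) (u x) :=
  Complex.conjCLE.toContinuousLinearMap.contDiff.comp hu

theorem box_conj {u : Spacetime → ℂ} (hu : ContDiff ℝ ∞ u) (x : Spacetime) :
    box (fun x => (starRingEnd ℂ) (u x)) x = (starRingEnd ℂ) (box u x) := by
  simp only [box, dirDeriv_conj hu, dirDeriv_conj (contDiff_dirDeriv _ hu), map_sub, map_sum]

/-- The potential is real, so conjugation commutes with the field equation and the initial
condition. -/
theorem moller_conj {m₁ m₂ : ℝ} {f : Spacetime → ℝ} (hf : IsCutoff f) {φ : Spacetime → ℂ}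
    (hφ : IsSmooth φ) : moller m₁ m₂ f (fun x => (starRingEnd ℂ) (φ x)) =
      fun x => (starRingEnd ℂ) (moller m₁ m₂ f φ x) := by
  have hm := isMollerImage_moller (m₁ := m₁) (m₂ := m₂) hf hφ
  refine moller_eq_of_eq_off hf (isFutureSet_massChange (m₁ := m₁) (m₂ := m₂) hf)
    (contDiff_conj hφ) (contDiff_conj hm.1) (fun x => ?_) fun x hx => ?_
  · have := congrArg (starRingEnd ℂ) (hm.2.1 x)
    rw [kleinGordon_eq_box _ hm.1, kleinGordon_eq_box _ hφ] at this
    rw [kleinGordon_eq_box _ (contDiff_conj hm.1), kleinGordon_eq_box _ (contDiff_conj hφ),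
      box_conj hm.1, box_conj hφ]
    simpa using this
  · simp only [hm.2.2 x hx]

theorem IsSpaceWave.conj {κ : Space} {c : Spacetime → ℂ} (hc : IsSpaceWave κ c) :
    IsSpaceWave (-κ) fun x => (starRingEnd ℂ) (c x) := by
  refine ⟨contDiff_conj hc.1, fun j => ?_⟩
  rw [dirDeriv_conj hc.1, hc.2 j]
  funext x
  simp

theorem sum_sq_eq_norm_sq (k : Space) : ∑ j, (k j : ℂ) ^ 2 = ((‖k‖ ^ 2 : ℝ) : ℂ) := by
  rw [EuclideanSpace.norm_sq_eq]
  simp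

theorem IsSpaceWave.sum_dirDeriv_dirDeriv {κ : Space} {c : Spacetime → ℂ} (hc : IsSpaceWave κ c)
    (x : Spacetime) : ∑ j, dirDeriv (spaceDir j) (dirDeriv (spaceDir j) c) x =
      -((‖κ‖ ^ 2 : ℝ) : ℂ) * c x := by
  simp only [hc.2, dirDeriv_const_mul hc.1]
  rw [← sum_sq_eq_norm_sq, ← Finset.sum_neg_distrib, Finset.sum_mul]
  refine Finset.sum_congr rfl fun j _ => ?_
  linear_combination (κ j : ℂ) ^ 2 * c x * Complex.I_sq

theorem kleinGordon_planeWave (m : ℝ) (k : Space) (x : Spacetime) :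
    kleinGordon (fun _ => m ^ 2) (planeWave (energy m k) k) x = 0 := by
  have hc := contDiff_planeWave (energy m k) k
  rw [kleinGordon_eq_box _ hc, box, (isSpaceWave_planeWave (energy m k) k).sum_dirDeriv_dirDeriv]
  simp only [dirDeriv_timeDir_planeWave, dirDeriv_const_mul hc]
  have h : ((energy m k : ℝ) : ℂ) ^ 2 = ((‖k‖ ^ 2 + m ^ 2 : ℝ) : ℂ) := by
    rw [← sq_energy]; push_cast; rfl
  push_cast at h ⊢
  linear_combination (energy m k : ℂ) ^ 2 * planeWave (energy m k) k x * Complex.I_sq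
    - planeWave (energy m k) k x * h

section ModeField

variable {m₁ m₂ : ℝ} {χ : ℝ → ℝ}

/-- The image of a plane wave under the Møller map. -/
def modeField (m₁ m₂ : ℝ) (χ : ℝ → ℝ) (k : Space) : Spacetime → ℂ :=
  moller m₁ m₂ (switchOn χ) (planeWave (energy m₁ k) k)

theorem isMollerImage_modeField (m₁ m₂ : ℝ) (hχ : IsRate χ) (k : Space) :
    IsMollerImage m₁ m₂ (switchOn χ) (planeWave (energy m₁ k) k) (modeField m₁ m₂ χ k) :=
  isMollerImage_moller (isCutoff_switchOn hχ) (contDiff_planeWave _ k)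

theorem modeField_early (m₁ m₂ : ℝ) {a : ℝ} (ha : ∀ t < a, profile χ t = 0) (hχ : IsRate χ)
    (k : Space) {x : Spacetime} (hx : x.1 < a) :
    modeField m₁ m₂ χ k x = planeWave (energy m₁ k) k x := by
  refine (isMollerImage_modeField m₁ m₂ hχ k).2.2 x ?_
  rintro ⟨y, hy, hxy⟩
  have hsub : tsupport (massChange m₁ m₂ (switchOn χ)) ⊆ {x : Spacetime | a ≤ x.1} := by
    refine closure_minimal (fun x hx => ?_) (isFutureSet_halfSpace a).isClosed
    by_contra h
    exact hx (by simp [massChange, switchOn, ha x.1 (not_le.1 h)])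
  have h1 : a ≤ y.1 := hsub hy
  have h2 := (norm_nonneg _).trans hxy
  linarith

/-- The potential depends on time alone. The spatial translate of the mode, with the phase removed,
solves the same equation and agrees with the plane wave before the switching, so uniqueness
identifies the two. -/
theorem modeField_translate (m₁ m₂ : ℝ) (hχ : IsRate χ) (k b : Space) (x : Spacetime) :
    modeField m₁ m₂ χ k (x + (0, b)) =
      Complex.exp (Complex.I * (inner ℝ k b : ℂ)) * modeField m₁ m₂ χ k x := by
  obtain ⟨a, ha⟩ := hχ.exists_early
  have hm := isMollerImage_modeField m₁ m₂ hχ k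
  have hpw : ∀ x, planeWave (energy m₁ k) k (x + (0, b)) =
      Complex.exp (Complex.I * (inner ℝ k b : ℂ)) * planeWave (energy m₁ k) k x := fun x => by
    rw [planeWave, planeWave, ← Complex.exp_add]
    congr 1
    simp [inner_add_right]
    ring
  have he : Complex.exp (-(Complex.I * (inner ℝ k b : ℂ))) *
      Complex.exp (Complex.I * (inner ℝ k b : ℂ)) = 1 := by
    rw [← Complex.exp_add]; simp
  have ht : ContDiff ℝ ∞ fun x => modeField m₁ m₂ χ k (x + (0, b)) :=
    hm.1.comp (contDiff_id.add contDiff_const)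
  have key : modeField m₁ m₂ χ k = fun x => Complex.exp (-(Complex.I * (inner ℝ k b : ℂ))) *
      modeField m₁ m₂ χ k (x + (0, b)) := by
    refine moller_eq_of_eq_off (isCutoff_switchOn hχ) (isFutureSet_halfSpace a)
      (contDiff_planeWave _ k) (contDiff_const.mul ht) (fun x => ?_) fun x hx => ?_
    · have h1 := hm.2.1 (x + (0, b))
      rw [kleinGordon_planeWave, kleinGordon_eq_box _ hm.1] at h1
      rw [kleinGordon_planeWave, kleinGordon_eq_box _ (contDiff_const.mul ht), box_const_mul ht,
        box_translate]
      simp only [massChange, switchOn, Prod.fst_add, add_zero] at h1 ⊢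
      linear_combination Complex.exp (-(Complex.I * (inner ℝ k b : ℂ))) * h1
    · rw [modeField_early m₁ m₂ (fun t ht => (ha t ht).1) hχ k (by simpa using hx), hpw,
        ← mul_assoc, he, one_mul]
  have h2 := congrFun key x
  rw [h2, ← mul_assoc, mul_comm (Complex.exp _), he, one_mul]

/-- Differentiating the translation law at zero displacement. -/
theorem isSpaceWave_modeField (m₁ m₂ : ℝ) (hχ : IsRate χ) (k : Space) :
    IsSpaceWave k (modeField m₁ m₂ χ k) := by
  have hm := isMollerImage_modeField m₁ m₂ hχ k
  refine ⟨hm.1, fun j => funext fun x => ?_⟩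
  have hline : HasDerivAt (fun s : ℝ => x + (0, s • EuclideanSpace.single j (1 : ℝ)))
      (spaceDir j) 0 := by
    have h := ((hasDerivAt_const (0 : ℝ) (0 : ℝ)).prodMk ((hasDerivAt_id (0 : ℝ)).smul_const
      (EuclideanSpace.single j (1 : ℝ)))).const_add x
    simpa [spaceDir] using h
  have h1 := HasFDerivAt.comp_hasDerivAt (0 : ℝ) (l := modeField m₁ m₂ χ k)
    (f := fun s : ℝ => x + (0, s • EuclideanSpace.single j (1 : ℝ)))
    (differentiable_of_smooth hm.1 _).hasFDerivAt hline
  have h2 : HasDerivAt (fun s : ℝ => Complex.exp (Complex.I * ((k j * s : ℝ) : ℂ)) *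
      modeField m₁ m₂ χ k x) (Complex.I * k j * modeField m₁ m₂ χ k x) 0 := by
    have := (hasDerivAt_exp_I (θ := fun s => k j * s) (θ' := k j) (t := 0)
      (by simpa using (hasDerivAt_id (0 : ℝ)).const_mul (k j))).mul_const (modeField m₁ m₂ χ k x)
    simpa using this
  have h3 : (modeField m₁ m₂ χ k ∘ fun s : ℝ => x + (0, s • EuclideanSpace.single j (1 : ℝ))) =
      fun s : ℝ => Complex.exp (Complex.I * ((k j * s : ℝ) : ℂ)) * modeField m₁ m₂ χ k x := by
    funext s
    simp only [Function.comp_apply]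
    rw [modeField_translate m₁ m₂ hχ, inner_smul_right, inner_single_one, mul_comm s]
  rw [h3] at h1
  have h4 := h1.unique h2
  rw [zero_smul, ← Prod.zero_eq_mk, add_zero] at h4
  exact h4

/-- On a space wave -∇² acts as |𝐤|², which reduces the field equation on the time axis to the
oscillator with the switched frequency. -/
theorem isMode_modeField (m₁ m₂ : ℝ) (hχ : IsRate χ) {a : ℝ} (ha : ∀ t < a, profile χ t = 0)
    (k : Space) :
    IsMode (switchedFreq (‖k‖ ^ 2 + m₁ ^ 2) (‖k‖ ^ 2 + m₂ ^ 2) χ) (energy m₁ k) a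
      (fun t => modeField m₁ m₂ χ k (t, 0))
      (fun t => dirDeriv timeDir (modeField m₁ m₂ χ k) (t, 0)) where
  hasDerivAt t := hasDerivAt_time
    (differentiable_of_smooth (isMollerImage_modeField m₁ m₂ hχ k).1) t 0
  hasDerivAt' t := by
    have hm := isMollerImage_modeField m₁ m₂ hχ k
    refine (hasDerivAt_time (differentiable_of_smooth (contDiff_dirDeriv timeDir hm.1))
      t 0).congr_deriv ?_
    have h1 := hm.2.1 (t, 0)
    rw [kleinGordon_planeWave, kleinGordon_eq_box _ hm.1, box,
      (isSpaceWave_modeField m₁ m₂ hχ k).sum_dirDeriv_dirDeriv] at h1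
    simp only [massChange, switchOn] at h1
    simp only [switchedFreq]
    push_cast at h1 ⊢
    linear_combination h1
  early t ht := by
    rw [modeField_early m₁ m₂ ha hχ k ht, planeWave]
    simp

theorem modeField_eq (m₁ m₂ : ℝ) (hχ : IsRate χ) (k : Space) (x : Spacetime) :
    modeField m₁ m₂ χ k x =
      Complex.exp (Complex.I * (inner ℝ k x.2 : ℂ)) * modeField m₁ m₂ χ k (x.1, 0) := by
  rw [← modeField_translate m₁ m₂ hχ]
  simp

theorem norm_sq_modeField_le (m₁ m₂ : ℝ) (hχ : IsRate χ) {k : Space} (hk : k ≠ 0)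
    (x : Spacetime) : ‖modeField m₁ m₂ χ k x‖ ^ 2 ≤
      2 * (1 + (‖k‖ ^ 2 + m₁ ^ 2) / (‖k‖ ^ 2 + m₂ ^ 2)) := by
  obtain ⟨a, ha⟩ := hχ.exists_early
  have hk' := norm_pos_iff.2 hk
  have h := (isMode_modeField m₁ m₂ hχ (fun t ht => (ha t ht).1) k).norm_sq_le (by positivity)
    (by positivity) hχ (sq_energy m₁ k) (fun t ht => (ha t ht).1) x.1
  rw [modeField_eq m₁ m₂ hχ, norm_mul, norm_exp_I, one_mul]
  exact h

/-- A bound for the modes. -/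
def modeBound (m₁ m₂ : ℝ) (k : Space) : ℝ :=
  Real.sqrt (2 * (1 + (‖k‖ ^ 2 + m₁ ^ 2) / (‖k‖ ^ 2 + m₂ ^ 2)))

theorem norm_modeField_le (m₁ m₂ : ℝ) (hχ : IsRate χ) {k : Space} (hk : k ≠ 0)
    (x : Spacetime) : ‖modeField m₁ m₂ χ k x‖ ≤ modeBound m₁ m₂ k :=
  Real.le_sqrt_of_sq_le (norm_sq_modeField_le m₁ m₂ hχ hk x)

theorem modeBound_nonneg (m₁ m₂ : ℝ) (k : Space) : 0 ≤ modeBound m₁ m₂ k := Real.sqrt_nonneg _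

end ModeField

/-- The Møller transformed modes tend to the plane waves of the new mass. -/
theorem tendsto_modeField_product {ι : Type*} {l : Filter ι} [l.IsCountablyGenerated]
    (m₁ m₂ : ℝ) {χ : ι → ℝ → ℝ} (hχ : ∀ i, IsRate (χ i))
    (hone : ∀ t, Tendsto (fun i => profile (χ i) t) l (𝓝 1))
    (hslow : Tendsto (fun i => ∫ τ, |deriv (χ i) τ|) l (𝓝 0)) {k : Space} (hk : k ≠ 0)
    (x y : Spacetime) :
    Tendsto (fun i => ((2 * energy m₁ k : ℝ) : ℂ)⁻¹ * (modeField m₁ m₂ (χ i) k x *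
        (starRingEnd ℂ) (modeField m₁ m₂ (χ i) k y))) l
      (𝓝 (((2 * energy m₂ k : ℝ) : ℂ)⁻¹ * (planeWave (energy m₂ k) k x *
        (starRingEnd ℂ) (planeWave (energy m₂ k) k y)))) := by
  have hk' := norm_pos_iff.2 hk
  choose a ha using fun i => (hχ i).exists_early
  have h := tendsto_mode_product hχ hone hslow (w₁ := ‖k‖ ^ 2 + m₁ ^ 2) (w₂ := ‖k‖ ^ 2 + m₂ ^ 2)
    (by positivity) (by positivity) ha
    (fun i => isMode_modeField m₁ m₂ (hχ i) (fun t ht => (ha i t ht).1) k) x.1 y.1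
  have h2 := h.const_mul ((2 : ℂ)⁻¹ * (Complex.exp (Complex.I * (inner ℝ k x.2 : ℂ)) *
    (starRingEnd ℂ) (Complex.exp (Complex.I * (inner ℝ k y.2 : ℂ)))))
  convert h2 using 2
  · rename_i i
    rw [modeField_eq m₁ m₂ (hχ i) k x, modeField_eq m₁ m₂ (hχ i) k y, map_mul, ← energy]
    push_cast
    rw [mul_inv]
    ring
  · have hexp : planeWave (energy m₂ k) k x * (starRingEnd ℂ) (planeWave (energy m₂ k) k y) =
        Complex.exp (Complex.I * (inner ℝ k x.2 : ℂ)) *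
          (starRingEnd ℂ) (Complex.exp (Complex.I * (inner ℝ k y.2 : ℂ))) *
          Complex.exp (Complex.I * ((energy m₂ k * (x.1 - y.1) : ℝ) : ℂ)) := by
      rw [planeWave, planeWave, ← Complex.exp_conj, ← Complex.exp_conj, ← Complex.exp_add,
        ← Complex.exp_add, ← Complex.exp_add]
      congr 1
      simp
      ring
    rw [← energy, hexp, Complex.ofReal_mul, mul_inv, Complex.ofReal_ofNat]
    ring

/-! ### The mode expansion of the transported operator -/

/-- Test functions that approximate the point evaluation at `x`. -/
theorem exists_test_approx (x : Spacetime) : ∃ g : ℕ → Spacetime → ℂ, (∀ n, IsTest (g n)) ∧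
    (∀ n, ∫ y, ‖g n y‖ = 1) ∧
    ∀ w : Spacetime → ℂ, Continuous w → Tendsto (fun n => ∫ y, w y * g n y) atTop (𝓝 (w x)) := by
  let φ : ℕ → ContDiffBump (0 : Spacetime) := fun n =>
    ⟨(1 / ((n : ℝ) + 1)) / 2, 1 / ((n : ℝ) + 1), by positivity, half_lt_self (by positivity)⟩
  have hφ : Tendsto (fun n => (φ n).rOut) atTop (𝓝 0) := tendsto_one_div_add_atTop_nhds_zero_nat
  refine ⟨fun n y => (((φ n).normed volume (x - y) : ℝ) : ℂ), fun n => ⟨?_, ?_⟩, fun n => ?_,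
    fun w hw => ?_⟩
  · exact Complex.ofRealCLM.contDiff.comp
      ((φ n).contDiff_normed.comp (contDiff_const.sub contDiff_id))
  · have h := ((φ n).hasCompactSupport_normed (μ := volume)).comp_homeomorph (Homeomorph.subLeft x)
    exact h.comp_left (g := fun r : ℝ => (r : ℂ)) Complex.ofReal_zero
  · simp only [Complex.norm_real, Real.norm_of_nonneg ((φ n).nonneg_normed _)]
    rw [integral_sub_left_eq_self (fun y => (φ n).normed volume y) volume x]
    exact (φ n).integral_normed
  · have := ContDiffBump.convolution_tendsto_right_of_continuous (μ := volume) hφ hw x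
    refine this.congr fun n => ?_
    rw [convolution_lsmul_swap]
    refine integral_congr_ae (ae_of_all _ fun y => ?_)
    simp [mul_comm]

section Expansion

variable {χ : ℝ → ℝ}

/-- The coefficient of a mode in the expansion of a test function. -/
def modeAmplitude (m₁ m₂ : ℝ) (χ : ℝ → ℝ) (h : Spacetime → ℂ) (k : Space) : ℂ :=
  ∫ y, (starRingEnd ℂ) (modeField m₁ m₂ χ k y) * h y

theorem continuous_modeField (m₁ m₂ : ℝ) (hχ : IsRate χ) (k : Space) :
    Continuous (modeField m₁ m₂ χ k) := (isMollerImage_modeField m₁ m₂ hχ k).1.continuous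

/-- The adjoint moves the Møller map from h onto the conjugate plane wave, and R commutes with
conjugation. -/
theorem amplitude_mollerAdjoint (m₁ m₂ : ℝ) (hχ : IsRate χ) {h : Spacetime → ℂ} (hh : IsTest h) :
    amplitude m₁ (mollerAdjoint m₁ m₂ (switchOn χ) h) = modeAmplitude m₁ m₂ χ h := by
  funext k
  have hf := isCutoff_switchOn hχ
  have hp := contDiff_planeWave (energy m₁ k) k
  rw [amplitude, ← integral_moller_mul_eq hf (contDiff_conj hp) hh, moller_conj hf hp]
  rfl

theorem integral_modeField_mul (m₁ m₂ : ℝ) (hχ : IsRate χ) {g : Spacetime → ℂ} (hg : IsTest g)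
    (k : Space) : ∫ x, modeField m₁ m₂ χ k x * g x =
      ∫ x, planeWave (energy m₁ k) k x * mollerAdjoint m₁ m₂ (switchOn χ) g x :=
  integral_moller_mul_eq (isCutoff_switchOn hχ) (contDiff_planeWave _ k) hg

theorem continuous_integral_modeField_mul (m₁ m₂ : ℝ) (hχ : IsRate χ) {g : Spacetime → ℂ}
    (hg : IsTest g) : Continuous fun k => ∫ x, modeField m₁ m₂ χ k x * g x := by
  have hg' := isTest_mollerAdjoint (m₁ := m₁) (m₂ := m₂) (isCutoff_switchOn hχ) hg
  simp only [integral_modeField_mul m₁ m₂ hχ hg]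
  refine continuous_of_dominated
    (bound := fun y => ‖mollerAdjoint m₁ m₂ (switchOn χ) g y‖) (fun k => ?_)
    (fun k => ae_of_all _ fun y => ?_) hg'.integrable.norm (ae_of_all _ fun y => ?_)
  · exact ((contDiff_planeWave _ k).continuous.mul hg'.1.continuous).aestronglyMeasurable
  · rw [norm_mul, norm_planeWave, one_mul]
  · exact (continuous_planeWave_energy m₁ y).mul continuous_const

theorem norm_integral_modeField_mul_le (m₁ m₂ : ℝ) (hχ : IsRate χ) {g : Spacetime → ℂ}
    (hg : IsTest g) {k : Space} (hk : k ≠ 0) :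
    ‖∫ x, modeField m₁ m₂ χ k x * g x‖ ≤ modeBound m₁ m₂ k * ∫ x, ‖g x‖ := by
  rw [← integral_const_mul]
  refine norm_integral_le_of_norm_le (hg.integrable.norm.const_mul _) (ae_of_all _ fun x => ?_)
  rw [norm_mul]
  exact mul_le_mul_of_nonneg_right (norm_modeField_le m₁ m₂ hχ hk x) (norm_nonneg _)

/-- No regularity of the mode in 𝐤 is established directly. Smeared modes are pairings of plane
waves with a fixed test function R†g and so are continuous in 𝐤; point values are limits of these.
-/
theorem aestronglyMeasurable_modeField (m₁ m₂ : ℝ) (hχ : IsRate χ) (x : Spacetime) :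
    AEStronglyMeasurable (fun k => modeField m₁ m₂ χ k x) := by
  obtain ⟨g, hg, -, hgx⟩ := exists_test_approx x
  exact aestronglyMeasurable_of_tendsto_ae atTop
    (fun n => (continuous_integral_modeField_mul m₁ m₂ hχ (hg n)).aestronglyMeasurable)
    (ae_of_all _ fun k => hgx _ (continuous_modeField m₁ m₂ hχ k))

theorem continuous_modeAmplitude (m₁ m₂ : ℝ) (hχ : IsRate χ) {h : Spacetime → ℂ}
    (hh : IsTest h) : Continuous (modeAmplitude m₁ m₂ χ h) := by
  rw [← amplitude_mollerAdjoint m₁ m₂ hχ hh]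
  exact continuous_amplitude m₁ (isTest_mollerAdjoint (isCutoff_switchOn hχ) hh)

theorem norm_modeAmplitude_le (m₁ m₂ : ℝ) (hχ : IsRate χ) {h : Spacetime → ℂ} (hh : IsTest h)
    {k : Space} (hk : k ≠ 0) : ‖modeAmplitude m₁ m₂ χ h k‖ ≤
      modeBound m₁ m₂ k * (∫ x, ‖oneSubLaplacian^[2] h x‖) * (1 + ‖k‖ ^ 2)⁻¹ ^ 2 := by
  have := (isSpaceWave_modeField m₁ m₂ hχ k).conj.norm_integral_le
    (fun x => (RCLike.norm_conj _).trans_le (norm_modeField_le m₁ m₂ hχ hk x)) 2 hh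
  simpa [modeAmplitude] using this

/-- The dominating function for the momentum integrals. -/
def momentumBound (m₁ m₂ : ℝ) (k : Space) : ℝ :=
  ‖((2 * energy m₁ k : ℝ) : ℂ)⁻¹‖ * modeBound m₁ m₂ k ^ 2 * (1 + ‖k‖ ^ 2)⁻¹ ^ 2

theorem momentumBound_nonneg (m₁ m₂ : ℝ) (k : Space) : 0 ≤ momentumBound m₁ m₂ k := by
  unfold momentumBound
  positivity

/-- Times (2ω₁)⁻¹ the squared mode bound equals ω₁⁻¹ + ω₁ω₂⁻², at most 2|𝐤|⁻¹ + |m₁||𝐤|⁻². Both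
singularities are integrable in three dimensions, so neither mass has to be positive. -/
theorem integrable_momentumBound (m₁ m₂ : ℝ) : Integrable (momentumBound m₁ m₂) := by
  have hc := continuous_energy m₁
  have hint : Integrable fun k : Space => 2 * (‖k‖⁻¹ * (1 + ‖k‖ ^ 2)⁻¹ ^ 2) +
      |m₁| * (‖k‖⁻¹ ^ 2 * (1 + ‖k‖ ^ 2)⁻¹ ^ 2) :=
    (integrable_inv_norm_mul_decay.const_mul 2).add
      (integrable_inv_norm_sq_mul_decay.const_mul |m₁|)
  refine hint.mono' ?_ ?_
  · unfold momentumBound modeBound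
    refine Measurable.aestronglyMeasurable ?_
    have := hc.measurable
    fun_prop
  · filter_upwards [ae_ne_zero] with k hk
    have hk' := norm_pos_iff.2 hk
    rw [Real.norm_of_nonneg (momentumBound_nonneg m₁ m₂ k)]
    have hE := energy_pos m₁ hk
    have hE2 := energy_pos m₂ hk
    have h1 : ‖((2 * energy m₁ k : ℝ) : ℂ)⁻¹‖ * modeBound m₁ m₂ k ^ 2 ≤
        2 * ‖k‖⁻¹ + |m₁| * ‖k‖⁻¹ ^ 2 := by
      rw [modeBound, Real.sq_sqrt (by positivity), norm_inv, Complex.norm_real,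
        Real.norm_of_nonneg (by positivity), ← sq_energy, ← sq_energy]
      have e1 : (2 * energy m₁ k)⁻¹ * (2 * (1 + energy m₁ k ^ 2 / energy m₂ k ^ 2)) =
          (energy m₁ k)⁻¹ + energy m₁ k * (energy m₂ k)⁻¹ ^ 2 := by
        field_simp
      rw [e1]
      have e2 : (energy m₁ k)⁻¹ ≤ ‖k‖⁻¹ := inv_anti₀ hk' (norm_le_energy m₁ k)
      have e3 : (energy m₂ k)⁻¹ ≤ ‖k‖⁻¹ := inv_anti₀ hk' (norm_le_energy m₂ k)
      have e4 : energy m₁ k * (energy m₂ k)⁻¹ ^ 2 ≤ (‖k‖ + |m₁|) * ‖k‖⁻¹ ^ 2 := by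
        have := energy_le m₁ k
        gcongr
      have e5 : (‖k‖ + |m₁|) * ‖k‖⁻¹ ^ 2 = ‖k‖⁻¹ + |m₁| * ‖k‖⁻¹ ^ 2 := by
        field_simp
      linarith
    calc momentumBound m₁ m₂ k ≤ (2 * ‖k‖⁻¹ + |m₁| * ‖k‖⁻¹ ^ 2) * (1 + ‖k‖ ^ 2)⁻¹ ^ 2 :=
          mul_le_mul_of_nonneg_right h1 (by positivity)
      _ = _ := by ring

theorem norm_mode_term_le (m₁ m₂ : ℝ) (hχ : IsRate χ) {h : Spacetime → ℂ} (hh : IsTest h)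
    {k : Space} (hk : k ≠ 0) {z : ℂ} (hz : ‖z‖ ≤ modeBound m₁ m₂ k) :
    ‖((2 * energy m₁ k : ℝ) : ℂ)⁻¹ * (z * modeAmplitude m₁ m₂ χ h k)‖ ≤
      momentumBound m₁ m₂ k * ∫ x, ‖oneSubLaplacian^[2] h x‖ := by
  rw [norm_mul, norm_mul]
  calc _ ≤ ‖((2 * energy m₁ k : ℝ) : ℂ)⁻¹‖ * (modeBound m₁ m₂ k *
        (modeBound m₁ m₂ k * (∫ x, ‖oneSubLaplacian^[2] h x‖) * (1 + ‖k‖ ^ 2)⁻¹ ^ 2)) := by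
        have := norm_modeAmplitude_le m₁ m₂ hχ hh hk
        have := modeBound_nonneg m₁ m₂ k
        gcongr
    _ = _ := by rw [momentumBound]; ring

/-- Fubini for the pairing of `vacuumOp` with a test function. -/
theorem integral_vacuumOp_mul (m : ℝ) {h g : Spacetime → ℂ} (hh : IsTest h) (hg : IsTest g) :
    ∫ x, vacuumOp m h x * g x = ((2 * Real.pi : ℝ) : ℂ)⁻¹ ^ 3 * ∫ k : Space,
      ((2 * energy m k : ℝ) : ℂ)⁻¹ *
        ((∫ x, planeWave (energy m k) k x * g x) * amplitude m h k) := by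
  have hE := continuous_energy m
  have hca := continuous_amplitude m hh
  have hA : Integrable fun k : Space => ((2 * energy m k : ℝ) : ℂ)⁻¹ * amplitude m h k := by
    refine (integrable_norm_iff ?_).1 (by simpa using integrable_pow_mul_amplitude m hh 0)
    exact (Measurable.aestronglyMeasurable (by
      have := hE.measurable
      fun_prop)).mul hca.aestronglyMeasurable
  have hpw : Continuous fun p : Spacetime × Space => planeWave (energy m p.2) p.2 p.1 := by
    unfold planeWave
    fun_prop
  have hprod : Integrable (fun p : Spacetime × Space => planeWave (energy m p.2) p.2 p.1 *
      (g p.1 * (((2 * energy m p.2 : ℝ) : ℂ)⁻¹ * amplitude m h p.2)))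
      ((volume : Measure Spacetime).prod volume) :=
    (hg.integrable.mul_prod hA).bdd_mul (c := 1) hpw.aestronglyMeasurable
      (ae_of_all _ fun p => (norm_planeWave _ _ _).le)
  have hswap := integral_integral_swap (f := fun x k => planeWave (energy m k) k x *
    (g x * (((2 * energy m k : ℝ) : ℂ)⁻¹ * amplitude m h k))) hprod
  simp only [vacuumOp_eq, mul_assoc, integral_const_mul]
  congr 1
  calc _ = ∫ x, ∫ k : Space, planeWave (energy m k) k x *
        (g x * (((2 * energy m k : ℝ) : ℂ)⁻¹ * amplitude m h k)) := by
        refine integral_congr_ae (ae_of_all _ fun x => ?_)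
        simp only [← integral_mul_const]
        refine integral_congr_ae (ae_of_all _ fun k => ?_)
        simp only
        ring
    _ = _ := hswap
    _ = _ := by
        refine integral_congr_ae (ae_of_all _ fun k => ?_)
        simp only [← integral_mul_const, ← integral_const_mul]
        refine integral_congr_ae (ae_of_all _ fun x => ?_)
        simp only
        ring

/-- R acts on a momentum integral of plane waves, and exchanging it with the integral is done
weakly. Pairing with test functions that approximate the delta at x moves R to R†, Fubini applies to
the vacuum operator, and R† moves back onto each plane wave; the limit is taken at the end. -/
theorem transportedOp_switchOn_eq (m₁ m₂ : ℝ) (hχ : IsRate χ) {h : Spacetime → ℂ}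
    (hh : IsTest h) (x : Spacetime) :
    transportedOp m₁ m₂ (switchOn χ) h x = ((2 * Real.pi : ℝ) : ℂ)⁻¹ ^ 3 * ∫ k : Space,
      ((2 * energy m₁ k : ℝ) : ℂ)⁻¹ * (modeField m₁ m₂ χ k x * modeAmplitude m₁ m₂ χ h k) := by
  have hf := isCutoff_switchOn hχ
  have hh' := isTest_mollerAdjoint (m₁ := m₁) (m₂ := m₂) hf hh
  have hφ := isSmooth_vacuumOp m₁ hh'
  have hE := continuous_energy m₁
  obtain ⟨g, hg, hg1, hgx⟩ := exists_test_approx x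
  have hlim := hgx _ (isMollerImage_moller (m₁ := m₁) (m₂ := m₂) hf hφ).1.continuous
  refine tendsto_nhds_unique hlim ?_
  have hpair : ∀ n, ∫ y, moller m₁ m₂ (switchOn χ)
      (vacuumOp m₁ (mollerAdjoint m₁ m₂ (switchOn χ) h)) y * g n y =
      ((2 * Real.pi : ℝ) : ℂ)⁻¹ ^ 3 * ∫ k : Space, ((2 * energy m₁ k : ℝ) : ℂ)⁻¹ *
        ((∫ y, modeField m₁ m₂ χ k y * g n y) * modeAmplitude m₁ m₂ χ h k) := fun n => by
    rw [integral_moller_mul_eq hf hφ (hg n),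
      integral_vacuumOp_mul m₁ hh' (isTest_mollerAdjoint hf (hg n)),
      amplitude_mollerAdjoint m₁ m₂ hχ hh]
    simp only [integral_modeField_mul m₁ m₂ hχ (hg n)]
  simp only [hpair]
  refine Tendsto.const_mul _ (tendsto_integral_of_dominated_convergence
    (fun k => momentumBound m₁ m₂ k * ∫ x, ‖oneSubLaplacian^[2] h x‖) (fun n => ?_)
    ((integrable_momentumBound m₁ m₂).mul_const _) (fun n => ?_) ?_)
  · exact (Measurable.aestronglyMeasurable (by
      have := hE.measurable
      fun_prop)).mul ((continuous_integral_modeField_mul m₁ m₂ hχ (hg n)).mul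
        (continuous_modeAmplitude m₁ m₂ hχ hh)).aestronglyMeasurable
  · filter_upwards [ae_ne_zero] with k hk
    refine norm_mode_term_le m₁ m₂ hχ hh hk ?_
    -- The unit L¹ norm of the approximating functions keeps the smeared modes below the same bound
    -- as the modes.
    simpa [hg1] using norm_integral_modeField_mul_le m₁ m₂ hχ (hg n) hk
  · exact ae_of_all _ fun k =>
      ((hgx _ (continuous_modeField m₁ m₂ hχ k)).mul_const _).const_mul _

end Expansion

/-! ### Convergence of the kernels -/

section Kernel

variable {F : Spacetime × Spacetime → ℂ}

theorem eq_zero_of_notMem_fst {x : Spacetime} (hx : x ∉ Prod.fst '' tsupport F) (y : Spacetime) :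
    F (x, y) = 0 := image_eq_zero_of_notMem_tsupport fun h => hx ⟨_, h, rfl⟩

theorem eq_zero_of_notMem_snd {y : Spacetime} (hy : y ∉ Prod.snd '' tsupport F) (x : Spacetime) :
    F (x, y) = 0 := image_eq_zero_of_notMem_tsupport fun h => hy ⟨_, h, rfl⟩

theorem tsupport_slice_subset (hF' : HasCompactSupport F) (x : Spacetime) :
    tsupport (fun y => F (x, y)) ⊆ Prod.snd '' tsupport F := by
  refine closure_minimal (fun y hy => ?_) (hF'.isCompact.image continuous_snd).isClosed
  by_contra h
  exact hy (eq_zero_of_notMem_snd h x)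

theorem isTest_slice (hF : ContDiff ℝ ∞ F) (hF' : HasCompactSupport F) (x : Spacetime) :
    IsTest fun y => F (x, y) :=
  ⟨hF.comp (contDiff_const.prodMk contDiff_id),
    (hF'.isCompact.image continuous_snd).of_isClosed_subset (isClosed_tsupport _)
      (tsupport_slice_subset hF' x)⟩

theorem dirDeriv_slice (hF : ContDiff ℝ ∞ F) (x v : Spacetime) :
    dirDeriv v (fun y => F (x, y)) = fun y => fderiv ℝ F (x, y) (0, v) := by
  funext y
  have h := ((hF.differentiable (by simp) (x, y)).hasFDerivAt.comp y
    (hasFDerivAt_prodMk_right x y)).fderiv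
  exact congrArg (fun L => L v) h

theorem exists_dirDeriv_slice (hF : ContDiff ℝ ∞ F) (hF' : HasCompactSupport F) (v : Spacetime) :
    ∃ G : Spacetime × Spacetime → ℂ, ContDiff ℝ ∞ G ∧ HasCompactSupport G ∧
      ∀ x, dirDeriv v (fun y => F (x, y)) = fun y => G (x, y) :=
  ⟨fun p => fderiv ℝ F p (0, v), (hF.fderiv_right (m := ∞) (by simp)).clm_apply contDiff_const,
    hF'.fderiv_apply (𝕜 := ℝ) (0, v), fun x => dirDeriv_slice hF x v⟩

theorem exists_oneSubLaplacian_slice (hF : ContDiff ℝ ∞ F) (hF' : HasCompactSupport F) :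
    ∃ G : Spacetime × Spacetime → ℂ, ContDiff ℝ ∞ G ∧ HasCompactSupport G ∧
      ∀ x, oneSubLaplacian (fun y => F (x, y)) = fun y => G (x, y) := by
  choose G hG hG' hGe using fun j => exists_dirDeriv_slice hF hF' (spaceDir j)
  choose H hH hH' hHe using fun j => exists_dirDeriv_slice (hG j) (hG' j) (spaceDir j)
  refine ⟨fun p => F p - ∑ j, H j p, hF.sub (ContDiff.sum fun j _ => hH j), ?_, fun x => ?_⟩
  · have : HasCompactSupport (F - (H 0 + H 1 + H 2)) :=
      hF'.sub (((hH' 0).add (hH' 1)).add (hH' 2))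
    convert this using 1
    funext p
    simp [Fin.sum_univ_three]
  · funext y
    simp only [oneSubLaplacian, hGe, hHe]

/-- Applying 1 - ∇² in the second variable to F gives again a test function on M × M, so the slice
norms are bounded uniformly in x. -/
theorem exists_bound_integral_slice (hF : ContDiff ℝ ∞ F) (hF' : HasCompactSupport F) (N : ℕ) :
    ∃ B, ∀ x, ∫ y, ‖oneSubLaplacian^[N] (fun y => F (x, y)) y‖ ≤ B := by
  induction N generalizing F with
  | zero =>
    have hc : Continuous fun x => ∫ y, ‖F (x, y)‖ := by
      rw [← continuousOn_univ]
      exact continuousOn_integral_of_compact_support (f := fun x y => ‖F (x, y)‖)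
        (hF'.isCompact.image continuous_snd) hF.continuous.norm.continuousOn
        fun x y _ hy => by simp [eq_zero_of_notMem_snd hy]
    obtain ⟨B, hB⟩ := hc.bounded_above_of_compact_support
      (HasCompactSupport.intro (hF'.isCompact.image continuous_fst) fun x hx => by
        simp [eq_zero_of_notMem_fst hx])
    exact ⟨B, fun x => (Real.le_norm_self _).trans (hB x)⟩
  | succ N ih =>
    obtain ⟨G, hG, hG', hGe⟩ := exists_oneSubLaplacian_slice hF hF'
    obtain ⟨B, hB⟩ := ih hG hG'
    exact ⟨B, fun x => by simpa [hGe] using hB x⟩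

/-! ### Locality and continuity of the transported operator -/

theorem transportedOp_zero {m₁ m₂ : ℝ} {f : Spacetime → ℝ} (hf : IsCutoff f) :
    transportedOp m₁ m₂ f 0 = 0 := by
  rw [transportedOp, mollerAdjoint_zero hf, vacuumOp_zero, moller_zero hf]

theorem transportedOp_congr {m₁ m₂ : ℝ} {f f' : Spacetime → ℝ} (hf : IsCutoff f)
    (hf' : IsCutoff f') {K : Set Spacetime} (hff : ∀ x ∈ causalPast K, f x = f' x)
    {h : Spacetime → ℂ} (hh : IsTest h) (hK : tsupport h ⊆ K) {x : Spacetime}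
    (hx : x ∈ interior K) : transportedOp m₁ m₂ f h x = transportedOp m₁ m₂ f' h x := by
  rw [transportedOp, transportedOp, mollerAdjoint_congr hf hf' hff hh hK]
  exact moller_congr hf hf' hff (isSmooth_vacuumOp m₁ (isTest_mollerAdjoint hf' hh)) hx

/-- Agreement on the past of a set that covers both projections of supp F suffices. The first
projection has to lie in the interior because the Møller images are compared on an open set; off it
the slices vanish. -/
theorem kernel_transportedOp_congr {m₁ m₂ : ℝ} {f f' : Spacetime → ℝ} (hf : IsCutoff f)
    (hf' : IsCutoff f') (hF : ContDiff ℝ ∞ F) (hF' : HasCompactSupport F) {K : Set Spacetime}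
    (hff : ∀ x ∈ causalPast K, f x = f' x) (h₁ : Prod.fst '' tsupport F ⊆ interior K)
    (h₂ : Prod.snd '' tsupport F ⊆ K) :
    kernel (transportedOp m₁ m₂ f) F = kernel (transportedOp m₁ m₂ f') F := by
  refine integral_congr_ae (ae_of_all _ fun x => ?_)
  by_cases hx : x ∈ Prod.fst '' tsupport F
  · exact transportedOp_congr hf hf' hff (isTest_slice hF hF' x)
      ((tsupport_slice_subset hF' x).trans h₂) (h₁ hx)
  · have : (fun y => F (x, y)) = 0 := funext fun y => eq_zero_of_notMem_fst hx y
    simp only [this, transportedOp_zero hf, transportedOp_zero hf']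

theorem continuous_transportedOp_slice (m₁ m₂ : ℝ) {χ : ℝ → ℝ} (hχ : IsRate χ)
    (hF : ContDiff ℝ ∞ F) (hF' : HasCompactSupport F) :
    Continuous fun x => transportedOp m₁ m₂ (switchOn χ) (fun y => F (x, y)) x := by
  obtain ⟨B, hB⟩ := exists_bound_integral_slice hF hF' 2
  simp only [fun x => transportedOp_switchOn_eq m₁ m₂ hχ (isTest_slice hF hF' x) x]
  refine continuous_const.mul (continuous_of_dominated
    (bound := fun k => momentumBound m₁ m₂ k * B) (fun x => ?_) (fun x => ?_)
    ((integrable_momentumBound m₁ m₂).mul_const _) (ae_of_all _ fun k => ?_))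
  · exact (Measurable.aestronglyMeasurable (by
      have := (continuous_energy m₁).measurable
      fun_prop)).mul ((aestronglyMeasurable_modeField m₁ m₂ hχ x).mul
        (continuous_modeAmplitude m₁ m₂ hχ (isTest_slice hF hF' x)).aestronglyMeasurable)
  · filter_upwards [ae_ne_zero] with k hk
    exact (norm_mode_term_le m₁ m₂ hχ (isTest_slice hF hF' x) hk
      (norm_modeField_le m₁ m₂ hχ hk x)).trans
      (mul_le_mul_of_nonneg_left (hB x) (momentumBound_nonneg m₁ m₂ k))
  · refine continuous_const.mul ((continuous_modeField m₁ m₂ hχ k).mul ?_)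
    have hU := continuous_modeField m₁ m₂ hχ k
    have hFc := hF.continuous
    have hc : Continuous fun p : Spacetime × Spacetime =>
        (starRingEnd ℂ) (modeField m₁ m₂ χ k p.2) * F (p.1, p.2) :=
      (Complex.continuous_conj.comp (hU.comp continuous_snd)).mul hFc
    rw [← continuousOn_univ]
    exact continuousOn_integral_of_compact_support
      (f := fun x y => (starRingEnd ℂ) (modeField m₁ m₂ χ k y) * F (x, y))
      (hF'.isCompact.image continuous_snd) hc.continuousOn
      fun x y _ hy => by simp [eq_zero_of_notMem_snd hy]

variable {ι : Type*} {l : Filter ι} [l.IsCountablyGenerated] {χ : ι → ℝ → ℝ}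

theorem tendsto_mode_term (m₁ m₂ : ℝ) (hχ : ∀ i, IsRate (χ i))
    (hone : ∀ t, Tendsto (fun i => profile (χ i) t) l (𝓝 1))
    (hslow : Tendsto (fun i => ∫ τ, |deriv (χ i) τ|) l (𝓝 0)) {h : Spacetime → ℂ}
    (hh : IsTest h) (x : Spacetime) {k : Space} (hk : k ≠ 0) :
    Tendsto (fun i => ((2 * energy m₁ k : ℝ) : ℂ)⁻¹ *
        (modeField m₁ m₂ (χ i) k x * modeAmplitude m₁ m₂ (χ i) h k)) l
      (𝓝 (((2 * energy m₂ k : ℝ) : ℂ)⁻¹ * planeWave (energy m₂ k) k x * amplitude m₂ h k)) := by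
  have e1 : ∀ i, ((2 * energy m₁ k : ℝ) : ℂ)⁻¹ *
      (modeField m₁ m₂ (χ i) k x * modeAmplitude m₁ m₂ (χ i) h k) =
      ∫ y, ((2 * energy m₁ k : ℝ) : ℂ)⁻¹ * (modeField m₁ m₂ (χ i) k x *
        (starRingEnd ℂ) (modeField m₁ m₂ (χ i) k y)) * h y := fun i => by
    rw [modeAmplitude, ← integral_const_mul, ← integral_const_mul]
    simp only [mul_assoc]
  have e2 : ((2 * energy m₂ k : ℝ) : ℂ)⁻¹ * planeWave (energy m₂ k) k x * amplitude m₂ h k =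
      ∫ y, ((2 * energy m₂ k : ℝ) : ℂ)⁻¹ * (planeWave (energy m₂ k) k x *
        (starRingEnd ℂ) (planeWave (energy m₂ k) k y)) * h y := by
    rw [amplitude, ← integral_const_mul]
    simp only [mul_assoc]
  simp only [e1]
  rw [e2]
  refine tendsto_integral_filter_of_dominated_convergence
    (fun y => ‖((2 * energy m₁ k : ℝ) : ℂ)⁻¹‖ * (modeBound m₁ m₂ k * modeBound m₁ m₂ k) * ‖h y‖)
    (Eventually.of_forall fun i => ?_) (Eventually.of_forall fun i => ae_of_all _ fun y => ?_)
    (hh.integrable.norm.const_mul _) (ae_of_all _ fun y =>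
      (tendsto_modeField_product m₁ m₂ hχ hone hslow hk x y).mul_const _)
  · exact ((continuous_const.mul (continuous_const.mul (Complex.continuous_conj.comp
      (continuous_modeField m₁ m₂ (hχ i) k)))).mul hh.1.continuous).aestronglyMeasurable
  · rw [norm_mul, norm_mul, norm_mul, RCLike.norm_conj]
    have := norm_modeField_le m₁ m₂ (hχ i) hk x
    have := norm_modeField_le m₁ m₂ (hχ i) hk y
    have := modeBound_nonneg m₁ m₂ k
    gcongr

theorem tendsto_transportedOp_switchOn (m₁ m₂ : ℝ) (hχ : ∀ i, IsRate (χ i))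
    (hone : ∀ t, Tendsto (fun i => profile (χ i) t) l (𝓝 1))
    (hslow : Tendsto (fun i => ∫ τ, |deriv (χ i) τ|) l (𝓝 0)) {h : Spacetime → ℂ}
    (hh : IsTest h) (x : Spacetime) :
    Tendsto (fun i => transportedOp m₁ m₂ (switchOn (χ i)) h x) l (𝓝 (vacuumOp m₂ h x)) := by
  simp only [fun i => transportedOp_switchOn_eq m₁ m₂ (hχ i) hh x]
  rw [vacuumOp_eq]
  refine Tendsto.const_mul _ (tendsto_integral_filter_of_dominated_convergence
    (fun k => momentumBound m₁ m₂ k * ∫ x, ‖oneSubLaplacian^[2] h x‖)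
    (Eventually.of_forall fun i => ?_) (Eventually.of_forall fun i => ?_)
    ((integrable_momentumBound m₁ m₂).mul_const _) ?_)
  · exact (Measurable.aestronglyMeasurable (by
      have := (continuous_energy m₁).measurable
      fun_prop)).mul ((aestronglyMeasurable_modeField m₁ m₂ (hχ i) x).mul
        (continuous_modeAmplitude m₁ m₂ (hχ i) hh).aestronglyMeasurable)
  · filter_upwards [ae_ne_zero] with k hk
    exact norm_mode_term_le m₁ m₂ (hχ i) hh hk (norm_modeField_le m₁ m₂ (hχ i) hk x)
  · filter_upwards [ae_ne_zero] with k hk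
    exact tendsto_mode_term m₁ m₂ hχ hone hslow hh x hk

theorem norm_transportedOp_switchOn_le (m₁ m₂ : ℝ) {χ : ℝ → ℝ} (hχ : IsRate χ)
    {h : Spacetime → ℂ} (hh : IsTest h) (x : Spacetime) :
    ‖transportedOp m₁ m₂ (switchOn χ) h x‖ ≤ ‖((2 * Real.pi : ℝ) : ℂ)⁻¹ ^ 3‖ *
      ((∫ k, momentumBound m₁ m₂ k) * ∫ x, ‖oneSubLaplacian^[2] h x‖) := by
  rw [transportedOp_switchOn_eq m₁ m₂ hχ hh x, norm_mul, ← integral_mul_const]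
  refine mul_le_mul_of_nonneg_left (norm_integral_le_of_norm_le
    ((integrable_momentumBound m₁ m₂).mul_const _) ?_) (norm_nonneg _)
  filter_upwards [ae_ne_zero] with k hk
  exact norm_mode_term_le m₁ m₂ hχ hh hk (norm_modeField_le m₁ m₂ hχ hk x)

/-- The last of three nested dominated convergences, over y, then 𝐤, then x. Its majorant is a
constant on the compact first projection of supp F. -/
theorem tendsto_kernel_switchOn (m₁ m₂ : ℝ) (hχ : ∀ i, IsRate (χ i))
    (hone : ∀ t, Tendsto (fun i => profile (χ i) t) l (𝓝 1))
    (hslow : Tendsto (fun i => ∫ τ, |deriv (χ i) τ|) l (𝓝 0)) (hF : ContDiff ℝ ∞ F)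
    (hF' : HasCompactSupport F) :
    Tendsto (fun i => kernel (transportedOp m₁ m₂ (switchOn (χ i))) F) l
      (𝓝 (kernel (vacuumOp m₂) F)) := by
  obtain ⟨B, hB⟩ := exists_bound_integral_slice hF hF' 2
  have hK : IsCompact (Prod.fst '' tsupport F) := hF'.isCompact.image continuous_fst
  refine tendsto_integral_filter_of_dominated_convergence
    ((Prod.fst '' tsupport F).indicator fun _ => ‖((2 * Real.pi : ℝ) : ℂ)⁻¹ ^ 3‖ *
      ((∫ k, momentumBound m₁ m₂ k) * B))
    (Eventually.of_forall fun i =>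
      (continuous_transportedOp_slice m₁ m₂ (hχ i) hF hF').aestronglyMeasurable)
    (Eventually.of_forall fun i => ae_of_all _ fun x => ?_) ?_
    (ae_of_all _ fun x => tendsto_transportedOp_switchOn m₁ m₂ hχ hone hslow
      (isTest_slice hF hF' x) x)
  · by_cases hx : x ∈ Prod.fst '' tsupport F
    · rw [Set.indicator_of_mem hx]
      refine (norm_transportedOp_switchOn_le m₁ m₂ (hχ i) (isTest_slice hF hF' x) x).trans ?_
      have : 0 ≤ ∫ k, momentumBound m₁ m₂ k :=
        integral_nonneg fun k => momentumBound_nonneg m₁ m₂ k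
      have := hB x
      gcongr
    · have h0 : (fun y => F (x, y)) = 0 := funext fun y => eq_zero_of_notMem_fst hx y
      rw [h0, transportedOp_zero (isCutoff_switchOn (hχ i)), Set.indicator_of_notMem hx]
      simp
  · exact (integrable_indicator_iff hK.measurableSet).2
      (integrableOn_const hK.measure_lt_top.ne)

end Kernel

/-! ### From general cutoffs to spatially constant ones, and the main theorem -/

theorem IsAdiabaticLimit.isCutoff {ι : Type*} {l : Filter ι} {f : ι → Spacetime → ℝ}
    {χ : ι → ℝ → ℝ} (hf : IsAdiabaticLimit l f χ) (i : ι) : IsCutoff (f i) :=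
  ⟨hf.smooth i, hf.pastCompact i⟩

theorem IsAdiabaticLimit.isRate {ι : Type*} {l : Filter ι} {f : ι → Spacetime → ℝ}
    {χ : ι → ℝ → ℝ} (hf : IsAdiabaticLimit l f χ) (i : ι) : IsRate (χ i) :=
  ⟨hf.smooth_rate i, hf.compact_rate i, hf.nonneg_rate i, hf.integral_rate i⟩

theorem IsAdiabaticLimit.tendsto_kernel (m₁ m₂ : ℝ) {ι : Type*} {l : Filter ι}
    [l.IsCountablyGenerated] {f : ι → Spacetime → ℝ} {χ : ι → ℝ → ℝ}
    (hf : IsAdiabaticLimit l f χ) {F : Spacetime × Spacetime → ℂ} (hF : ContDiff ℝ ∞ F)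
    (hF' : HasCompactSupport F) :
    Tendsto (fun i => kernel (transportedOp m₁ m₂ (f i)) F) l (𝓝 (kernel (vacuumOp m₂) F)) := by
  have hK₀ : IsCompact (Prod.fst '' tsupport F ∪ Prod.snd '' tsupport F) :=
    (hF'.isCompact.image continuous_fst).union (hF'.isCompact.image continuous_snd)
  -- The compact set is enlarged so that both projections lie in its interior, as locality requires.
  obtain ⟨K, hK, hsub⟩ := exists_compact_superset hK₀
  have hsub' := Set.union_subset_iff.1 hsub
  refine (tendsto_kernel_switchOn m₁ m₂ hf.isRate hf.tendsto_one hf.slow hF hF').congr' ?_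
  filter_upwards [hf.eventually_eq K hK] with i hi
  exact (kernel_transportedOp_congr (hf.isCutoff i) (isCutoff_switchOn (hf.isRate i)) hF hF' hi
    hsub'.1 (hsub'.2.trans interior_subset)).symm

end AdiabaticVacuum

end

theorem mainTheorem10 (m₁ m₂ : ℝ) (hm₁ : 0 ≤ m₁) (hm₂ : 0 ≤ m₂)
    {ι : Type*} (l : Filter ι) [l.IsCountablyGenerated]
    (f : ι → AdiabaticVacuum.Spacetime → ℝ) (χ : ι → ℝ → ℝ)
    (hf : AdiabaticVacuum.IsAdiabaticLimit l f χ) :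
    (∀ i φ, AdiabaticVacuum.IsSmooth φ →
      ∃! ψ, AdiabaticVacuum.IsMollerImage m₁ m₂ (f i) φ ψ) ∧
    (∀ i h, AdiabaticVacuum.IsTest h →
      ∃! h', AdiabaticVacuum.IsMollerAdjointImage m₁ m₂ (f i) h h') ∧
    (∀ h, AdiabaticVacuum.IsTest h →
      AdiabaticVacuum.IsSmooth (AdiabaticVacuum.vacuumOp m₁ h)) ∧
    (∀ F : AdiabaticVacuum.Spacetime × AdiabaticVacuum.Spacetime → ℂ,
      ContDiff ℝ ∞ F → HasCompactSupport F →
      Tendsto (fun i => AdiabaticVacuum.kernel (AdiabaticVacuum.transportedOp m₁ m₂ (f i)) F) l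
        (𝓝 (AdiabaticVacuum.kernel (AdiabaticVacuum.vacuumOp m₂) F))) := by
  refine ⟨fun i φ hφ => ?_, fun i h hh => ?_, fun h hh => AdiabaticVacuum.isSmooth_vacuumOp m₁ hh,
    fun F hF hF' => hf.tendsto_kernel m₁ m₂ hF hF'⟩
  · obtain ⟨ψ, hψ⟩ := AdiabaticVacuum.exists_isMollerImage (m₁ := m₁) (m₂ := m₂) (hf.isCutoff i) hφ
    exact ⟨ψ, hψ, fun ψ' hψ' => hψ'.eq (hf.isCutoff i) hψ⟩
  · have H := AdiabaticVacuum.isMollerAdjointImage_mollerAdjoint (m₁ := m₁) (m₂ := m₂)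
      (hf.isCutoff i) hh
    exact ⟨_, H, fun h' hh' => hh'.eq H⟩
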